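/- **Setting.** Let $\Omega\subset\mathbb R^N$ ($N\ge1$) be a bounded open set meshed by a conforming simplicial mesh $\Omega_h$ that is shape regular, i.e. every element $K$ contains a ball of radius $\rho_K$ with $\operatorname{diam}K\le\sigma\rho_K$. Let $\mathcal G$ and $\mathcal L^j$ ($1\le j\le N$) be symmetric $L\times L$ matrix fields on $\Omega$ ($L\ge1$), bounded by $\Lambda$, constant on each element, with $\mathcal G y\cdot y\ge\gamma\|y\|_2^2$, $\gamma>0$, and $\sum_j\partial_j\mathcal L^j=0$ in the sense of distributions. Let $c\ge 0$ bound the wave speeds (the $|\lambda|$ with $\sum_j\nu_j\mathcal L^je=\lambda\mathcal Ge$, $\|\nu\|_2=1$, $e\ne0$), and let $\hat c>c$. Let $\Omega^{v}$ be the patch, consisting of the elements $K\in\Omega_h^v$ that contain the mesh vertex $v$, and let $\varphi_{\rm bot},\varphi_{\rm top}$ be continuous and affine on each element of the patch, equal at all its vertices but $v$, with $\varphi_{\rm bot}(v)<\varphi_{\rm top}(v)$ and gradients of Euclidean norm at most $1/\hat c$ (causality). Put $\delta=\varphi_{\rm top}-\varphi_{\rm bot}$. On $\partial K$ with outward unit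 normal $n$ let $\mathcal D=\sum_jn_j\mathcal L^j$; at a point shared with a neighbour, let $w_o$ denote the value of $w$ in the neighbour. The numerical flux is $\hat F_w=\tfrac12\mathcal D(w+w_o)+S(w-w_o)$ on interior facets and $\hat F_w=\tfrac12(\mathcal D+B)w$ on facets in $\partial\Omega$. For a constant $C_0$, all $y,z\in\mathbb R^L$, and with $|y|_S=(Sy\cdot y)^{1/2}$, $|y|_B=(By\cdot y)^{1/2}$, the fields $S$, $B$ satisfy: $By\cdot y\ge0$, $\|B\|_2\le C_0$, $(\mathcal D+B)y\cdot z\le C_0\|y\|_2|z|_B$ on boundary facets, and $Sy\cdot y\ge0$, $\|S\|_2\le C_0$, $Sy\cdot z\le C_0|y|_S|z|_S$, $\mathcal Dy\cdot z\le C_0\|y\|_2|z|_S$ on interior facets. Let $V_h$ be the space of $\mathbb R^L$-valued functions on $\Omega^v$ that are polynomials of degree at most $p$ on each element, with the $L^2$ inner product $(\cdot,\cdot)_v$, and let $$a(w,u)=\sum_{K\in\Omega_h^v}\Big[\sum_j\int_K\delta\,\mathcal L^jw\cdot\partial_ju-\int_{\partial K}\delta\,\hat F_w\cdot u\Big].$$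 Operators on $V_h$ are defined by $(A_hw,u)_v=a(w,u)$, $(M_0w,u)_v=(\mathcal Gw,u)_v-\sum_j((\partial_j\varphi_{\rm bot})\mathcal L^jw,u)_v$, $(M_1w,u)_v=\sum_j((\partial_j\delta)\mathcal L^jw,u)_v$, and $M(\tau)=M_0-\tau M_1$. Let $\|w\|_{M(\tau)}=(M(\tau)w,w)_v^{1/2}$, $\|w\|_{M_0}=\|w\|_{M(0)}$, and $|w|_d^2=-[2a(w,w)+(M_1w,w)_v]$. With $X_{h,0}=I$, $X_{h,k}=M_0^{-1}(A_h+kM_1)X_{h,k-1}$, the $s$-stage SAT flow is $$R^{\rm sat}_{hs}(\tau)=\sum_{k=0}^{s-1}\frac{\tau^k}{k!}X_{h,k}+\frac{\tau^s}{s!}M(\tau)^{-1}M_0X_{h,s}.$$ For an integer $r\ge1$, $R^{\rm sat}_{rhs}$ is the composition, for $\ell=1,\dots,r$ in this order, of the flows $R^{\rm sat}_{hs}(1)$ of the subtents that lie between the graphs of $\varphi_{\rm bot}+\frac{\ell-1}r\delta$ and $\varphi_{\rm bot}+\frac\ell r\delta$. Let $K_h=\ker(A_h+A_h^t+M_1)$,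 where $A_h^t$ is the adjoint of $A_h$ with respect to $(\cdot,\cdot)_v$, let $K_h^\perp$ be its orthogonal complement in $V_h$, and let $$\kappa=\sup_{0\le\tau\le1}\ \sup_{0\ne w\in K_h^\perp}\frac{\|M(\tau)^{-1}(A_h+M_1)w\|_{M(\tau)}^2}{|w|_d^2}$$ (with $\kappa=0$ if $K_h^\perp=\{0\}$). **Proposition (Conditional strong stability).** Let $p=0$ and $s=1$. 1. $\kappa\le C$ with a constant $C$ that depends only on $N,L,\sigma,\gamma,\Lambda,c,\hat c,C_0$; in particular it does not depend on the mesh or on the tent. 2. For all $\tau\in[0,1]$ with $\tau\le1/\kappa$ (where $1/0=\infty$) and all $w\in V_h$: $\|R^{\rm sat}_{h1}(\tau)w\|_{M(\tau)}\le\|w\|_{M_0}$. 3. If $r\ge1$ is an integer with $r\ge\kappa$, then $\|R^{\rm sat}_{rh1}w\|_{M(1)}\le\|w\|_{M_0}$ for all $w\in V_h$. That is, the stability assumption $\|R^{\rm sat}_{rh1}w\|_{M(1)}\le(1+C_{\rm sta}h_v)\|w\|_{M(0)}$, with $h_v=\max_{K\in\Omega_h^v}\operatorname{diam}K$, holds with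 $C_{\rm sta}=0$. -/

import Mathlib

open MeasureTheory Matrix
open scoped NNReal ENNReal ContDiff Gradient

noncomputable section

namespace TentDG

/-- Euclidean space `ℝ^N`. -/
abbrev E (N : ℕ) := EuclideanSpace ℝ (Fin N)

/-- `L × L` real matrices. -/
abbrev Mat (L : ℕ) := Matrix (Fin L) (Fin L) ℝ

/-- Euclidean norm `‖y‖₂` of `y ∈ ℝ^L`. -/
def norm2 {L : ℕ} (y : Fin L → ℝ) : ℝ := √(y ⬝ᵥ y)

/-- The seminorm `|y|_Q = (Q y · y)^{1/2}` of a matrix `Q` with `Q + Qᵗ ≥ 0`. -/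
def matSeminorm {L : ℕ} (Q : Mat L) (y : Fin L → ℝ) : ℝ := √((Q *ᵥ y) ⬝ᵥ y)

/-! ### Conforming simplicial meshes -/

/-- A conforming simplicial mesh in `ℝ^N`: a finite simplicial complex all of whose simplices are
faces of `N`-dimensional simplices. A simplex is given by its set of vertices. -/
structure SimplicialMesh (N : ℕ) where
  complex : Geometry.SimplicialComplex ℝ (E N)
  finite : complex.faces.Finite
  pure : ∀ s ∈ complex.faces, ∃ K ∈ complex.faces, s ⊆ K ∧ K.card = N + 1

/-- The closed simplex with a given vertex set. -/
def hull {N : ℕ} (K : Finset (E N)) : Set (E N) := convexHull ℝ (K : Set (E N))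

namespace SimplicialMesh

variable {N : ℕ} (T : SimplicialMesh N)

/-- The mesh elements: the `N`-dimensional simplices. -/
def elements : Finset (Finset (E N)) := {K ∈ T.finite.toFinset | K.card = N + 1}

/-- The open set `Ω` that is meshed: the interior of the union of the closed elements. -/
def domain : Set (E N) := interior T.complex.space

/-- The elements of the vertex patch of the mesh vertex `z`. -/
def patch (z : E N) : Finset (Finset (E N)) := {K ∈ T.elements | z ∈ K}

/-- Shape regularity with constant `σ`: every element `K` contains a closed ball of some
radius `ρ > 0` with `diam K ≤ σ ρ`. -/
def ShapeRegular (σ : ℝ) : Prop :=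
  ∀ K ∈ T.elements, ∃ x : E N, ∃ ρ : ℝ, 0 < ρ ∧ Metric.closedBall x ρ ⊆ hull K ∧
    Metric.diam (hull K) ≤ σ * ρ

/-- The facet `K.erase q` of the element `K`, opposite to its vertex `q`, is shared with
another element. Otherwise it lies on `∂Ω`. -/
def IsInteriorFacet (K : Finset (E N)) (q : E N) : Prop :=
  ∃ K' ∈ T.elements, K' ≠ K ∧ K.erase q ⊆ K'

end SimplicialMesh

/-- `n` is the unit normal, pointing out of the simplex `K`, of the facet of `K` opposite to its
vertex `q`. -/
def IsOutwardNormal {N : ℕ} (K : Finset (E N)) (q : E N) (n : E N) : Prop :=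
  ‖n‖ = 1 ∧ (∀ y ∈ K.erase q, ∀ z ∈ K.erase q, inner ℝ n (y - z) = 0) ∧
    ∀ y ∈ K.erase q, 0 < inner ℝ n (y - q)

open Classical in
/-- The outward unit normal of the simplex `K` on its facet opposite to `q` (it exists and is
unique for a nondegenerate `N`-simplex, `N ≥ 1`). -/
def outwardNormal {N : ℕ} (K : Finset (E N)) (q : E N) : E N :=
  if h : ∃ n, IsOutwardNormal K q n then h.choose else 0

/-! ### The hyperbolic system and the data of the DG discretization -/

/-- A mesh, one of its vertices, the coefficients `𝒢` and `ℒ^j` of the hyperbolic system, and the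
matrix fields `S` (on interior facets) and `B` (on boundary facets) of the numerical flux; the
latter are functions of the facet (given by its vertex set) and of the point on it. -/
structure Setting (N L : ℕ) where
  mesh : SimplicialMesh N
  vtx : E N
  G : E N → Mat L
  Lc : Fin N → E N → Mat L
  S : Finset (E N) → E N → Mat L
  B : Finset (E N) → E N → Mat L

namespace Setting

variable {N L : ℕ} (Q : Setting N L)

/-- The elements of the vertex patch `Ω^v`. -/
def patch : Finset (Finset (E N)) := Q.mesh.patch Q.vtx

/-- `h_v`, the largest diameter of an element of the patch. -/
def patchSize : ℝ := ⨆ K : Q.patch, Metric.diam (hull (K : Finset (E N)))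

/-- The constant value of `ℒ^j` on the element `K`. -/
def LcOn (K : Finset (E N)) (j : Fin N) : Mat L := Q.Lc j (K.centroid ℝ id)

/-- `𝒟^{(ν)}(x) = ∑ⱼ νⱼ ℒ^j(x)`. -/
def symbol (ν : E N) (x : E N) : Mat L := ∑ j, ν j • Q.Lc j x

/-- `𝒟 = ∑ⱼ nⱼ ℒ^j` on the facet of `K` opposite to `q`, as seen from the element `K`, with the
outward unit normal `n` on `∂K`. -/
def Dmat (K : Finset (E N)) (q : E N) : Mat L := ∑ j, outwardNormal K q j • Q.LcOn K j

/-- The standing assumptions on the system `∂ₜ(𝒢u) + ∑ⱼ ∂ⱼ(ℒ^j u) = 0` in `Ω`: symmetric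
coefficients bounded by `Λ`, `𝒢 ≥ γ`, constant on each (open) mesh element,
`∑ⱼ ∂ⱼ ℒ^j = 0` in the sense of distributions, and wave speeds, i.e. the `|lam|` with
`𝒟^{(ν)} e = lam 𝒢 e` for a unit vector `ν` and some `e ≠ 0`, at most `c`. -/
structure IsHyperbolic (γ Λ c : ℝ) : Prop where
  symm_G : ∀ x ∈ Q.mesh.domain, (Q.G x).IsSymm
  symm_Lc : ∀ x ∈ Q.mesh.domain, ∀ j, (Q.Lc j x).IsSymm
  bound_G : ∀ x ∈ Q.mesh.domain, ∀ y, norm2 (Q.G x *ᵥ y) ≤ Λ * norm2 y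
  bound_Lc : ∀ x ∈ Q.mesh.domain, ∀ j y, norm2 (Q.Lc j x *ᵥ y) ≤ Λ * norm2 y
  pos_G : ∀ x ∈ Q.mesh.domain, ∀ y, γ * norm2 y ^ 2 ≤ (Q.G x *ᵥ y) ⬝ᵥ y
  const_G : ∀ K ∈ Q.mesh.elements, ∀ x ∈ interior (hull K), Q.G x = Q.G (K.centroid ℝ id)
  const_Lc : ∀ K ∈ Q.mesh.elements, ∀ x ∈ interior (hull K), ∀ j, Q.Lc j x = Q.LcOn K j
  div_Lc : ∀ ψ : E N → ℝ, ContDiff ℝ ∞ ψ → HasCompactSupport ψ → tsupport ψ ⊆ Q.mesh.domain →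
    ∀ l k, ∫ x in Q.mesh.domain, ∑ j, (∇ ψ x) j * Q.Lc j x l k = 0
  wave_speed : ∀ x ∈ Q.mesh.domain, ∀ ν : E N, ‖ν‖ = 1 → ∀ (e : Fin L → ℝ) (lam : ℝ), e ≠ 0 →
    Q.symbol ν x *ᵥ e = lam • (Q.G x *ᵥ e) → |lam| ≤ c

/-- The design conditions on the matrix fields `B` and `S` of the numerical flux on the facets of
the vertex patch, with constant `C` in all the bounds. -/
structure IsDesign (C : ℝ) : Prop where
  meas_B : ∀ F i j, Measurable fun x => Q.B F x i j
  meas_S : ∀ F i j, Measurable fun x => Q.S F x i j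
  nonneg_B : ∀ K ∈ Q.patch, ∀ q ∈ K, ¬ Q.mesh.IsInteriorFacet K q →
    ∀ x ∈ hull (K.erase q), ∀ y, 0 ≤ (Q.B (K.erase q) x *ᵥ y) ⬝ᵥ y
  norm_B : ∀ K ∈ Q.patch, ∀ q ∈ K, ¬ Q.mesh.IsInteriorFacet K q →
    ∀ x ∈ hull (K.erase q), ∀ y, norm2 (Q.B (K.erase q) x *ᵥ y) ≤ C * norm2 y
  bound_DB : ∀ K ∈ Q.patch, ∀ q ∈ K, ¬ Q.mesh.IsInteriorFacet K q →
    ∀ x ∈ hull (K.erase q), ∀ y z,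
      ((Q.Dmat K q + Q.B (K.erase q) x) *ᵥ y) ⬝ᵥ z
        ≤ C * norm2 y * matSeminorm (Q.B (K.erase q) x) z
  nonneg_S : ∀ K ∈ Q.patch, ∀ q ∈ K, Q.mesh.IsInteriorFacet K q →
    ∀ x ∈ hull (K.erase q), ∀ y, 0 ≤ (Q.S (K.erase q) x *ᵥ y) ⬝ᵥ y
  norm_S : ∀ K ∈ Q.patch, ∀ q ∈ K, Q.mesh.IsInteriorFacet K q →
    ∀ x ∈ hull (K.erase q), ∀ y, norm2 (Q.S (K.erase q) x *ᵥ y) ≤ C * norm2 y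
  bound_S : ∀ K ∈ Q.patch, ∀ q ∈ K, Q.mesh.IsInteriorFacet K q →
    ∀ x ∈ hull (K.erase q), ∀ y z,
      (Q.S (K.erase q) x *ᵥ y) ⬝ᵥ z
        ≤ C * matSeminorm (Q.S (K.erase q) x) y * matSeminorm (Q.S (K.erase q) x) z
  bound_D : ∀ K ∈ Q.patch, ∀ q ∈ K, Q.mesh.IsInteriorFacet K q →
    ∀ x ∈ hull (K.erase q), ∀ y z,
      (Q.Dmat K q *ᵥ y) ⬝ᵥ z ≤ C * norm2 y * matSeminorm (Q.S (K.erase q) x) z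

/-- `φb` and `φt` are the bottom and the top of a tent pitched at the vertex: they are affine on
each closed element of the patch (hence continuous on the patch), they agree at all vertices of
the patch but the pitched one, which is raised, and they satisfy the causality condition
`‖grad φ‖₂ ≤ 1/ĉ`. -/
structure IsCausalTent (chat : ℝ) (φb φt : E N → ℝ) : Prop where
  affine_bot : ∀ K ∈ Q.patch, ∃ g : E N →ᵃ[ℝ] ℝ, ∀ x ∈ hull K, φb x = g x
  affine_top : ∀ K ∈ Q.patch, ∃ g : E N →ᵃ[ℝ] ℝ, ∀ x ∈ hull K, φt x = g x
  fixed : ∀ K ∈ Q.patch, ∀ q ∈ K, q ≠ Q.vtx → φt q = φb q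
  raised : φb Q.vtx < φt Q.vtx
  causal_bot : ∀ K ∈ Q.patch, ∀ x ∈ interior (hull K), ‖∇ φb x‖ ≤ 1 / chat
  causal_top : ∀ K ∈ Q.patch, ∀ x ∈ interior (hull K), ‖∇ φt x‖ ≤ 1 / chat

/-! ### The DG space on the patch -/

/-- The DG space `V_h` on the vertex patch: on each element, `L` polynomials of (total) degree at
most `p`. -/
abbrev Vh (p : ℕ) : Type :=
  (K : Q.patch) → Fin L → MvPolynomial.restrictTotalDegree (Fin N) ℝ p

variable {Q} {p : ℕ}

open Classical in
/-- The value at `x` of (the polynomial extension of) the restriction of `w` to `K`; zero if `K`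
is not in the patch. -/
def val (w : Q.Vh p) (K : Finset (E N)) (x : E N) : Fin L → ℝ := fun l =>
  if h : K ∈ Q.patch then MvPolynomial.eval (fun i => x i) (w ⟨K, h⟩ l : MvPolynomial (Fin N) ℝ)
  else 0

open Classical in
/-- The value at `x` of `∂ⱼ` of the restriction of `w` to `K`. -/
def dval (w : Q.Vh p) (K : Finset (E N)) (j : Fin N) (x : E N) : Fin L → ℝ := fun l =>
  if h : K ∈ Q.patch then
    MvPolynomial.eval (fun i => x i) (MvPolynomial.pderiv j (w ⟨K, h⟩ l : MvPolynomial (Fin N) ℝ))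
  else 0

/-- The inner product `(w, u)_v` of `L²(Ω^v)^L` on the DG space. -/
def ip (w u : Q.Vh p) : ℝ := ∑ K ∈ Q.patch, ∫ x in hull K, val w K x ⬝ᵥ val u K x

open Classical in
/-- The operator `O` on `V_h` with `(O w, u)_v = b(w, u)` for all `w, u`, for a bilinear form `b`
on `V_h`. (It exists and is unique, since `(·,·)_v` is an inner product on the finite-dimensional
space `V_h`.) -/
def opOf (b : Q.Vh p → Q.Vh p → ℝ) : Module.End ℝ (Q.Vh p) :=
  if h : ∃ O : Module.End ℝ (Q.Vh p), ∀ w u, ip (O w) u = b w u then h.choose else 0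

open Classical in
/-- The numerical flux `F̂ⁿ_w` at the point `x` of the facet of `K` opposite to `q`:
`𝒟{w} + S⟦w⟧` on an interior facet, with the neighbour's value `w_o` (on a facet on
`∂Ω^v \ ∂Ω`, where the weight `δ` vanishes, `w_o = 0`), and `(𝒟 + B)w/2` on a boundary facet. -/
def numFlux (w : Q.Vh p) (K : Finset (E N)) (q x : E N) : Fin L → ℝ :=
  if h : Q.mesh.IsInteriorFacet K q then
    Q.Dmat K q *ᵥ ((1 / 2 : ℝ) • (val w K x + val w h.choose x))
      + Q.S (K.erase q) x *ᵥ (val w K x - val w h.choose x)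
  else (1 / 2 : ℝ) • ((Q.Dmat K q + Q.B (K.erase q) x) *ᵥ val w K x)

/-! ### Forms and operators on a tent with bottom `φb` and top `φt` -/

/-- The form `a(w, u)`, with `δ = φt - φb`; surface integrals are with respect to the
`(N-1)`-dimensional Euclidean surface measure. -/
def aForm (φb φt : E N → ℝ) (w u : Q.Vh p) : ℝ :=
  ∑ K ∈ Q.patch,
    ((∑ j, ∫ x in hull K, (φt x - φb x) * ((Q.Lc j x *ᵥ val w K x) ⬝ᵥ dval u K j x))
      - ∑ q ∈ K, ∫ x in hull (K.erase q), (φt x - φb x) * (numFlux w K q x ⬝ᵥ val u K x)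
          ∂(μHE[N - 1]))

/-- The form `(M₀ w, u)_v = (𝒢 w, u)_v - ∑ⱼ ((∂ⱼ φb) ℒ^j w, u)_v`. -/
def m0Form (φb : E N → ℝ) (w u : Q.Vh p) : ℝ :=
  ∑ K ∈ Q.patch, ((∫ x in hull K, (Q.G x *ᵥ val w K x) ⬝ᵥ val u K x)
    - ∑ j, ∫ x in hull K, (∇ φb x) j * ((Q.Lc j x *ᵥ val w K x) ⬝ᵥ val u K x))

/-- The form `(M₁ w, u)_v = ∑ⱼ ((∂ⱼ δ) ℒ^j w, u)_v`. -/
def m1Form (φb φt : E N → ℝ) (w u : Q.Vh p) : ℝ :=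
  ∑ K ∈ Q.patch, ∑ j, ∫ x in hull K,
    (∇ (fun y => φt y - φb y) x) j * ((Q.Lc j x *ᵥ val w K x) ⬝ᵥ val u K x)

variable (Q p)

/-- `A_h`. -/
def Ah (φb φt : E N → ℝ) : Module.End ℝ (Q.Vh p) := opOf (aForm φb φt)

/-- The adjoint `A_hᵗ` of `A_h` with respect to `(·,·)_v`. -/
def AhT (φb φt : E N → ℝ) : Module.End ℝ (Q.Vh p) := opOf fun w u => ip w (Q.Ah p φb φt u)

/-- `M₀` on `V_h`. -/
def M0 (φb : E N → ℝ) : Module.End ℝ (Q.Vh p) := opOf (m0Form φb)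

/-- `M₁` on `V_h`. -/
def M1 (φb φt : E N → ℝ) : Module.End ℝ (Q.Vh p) := opOf (m1Form φb φt)

/-- `M(τ) = M₀ - τ M₁`. -/
def M (φb φt : E N → ℝ) (τ : ℝ) : Module.End ℝ (Q.Vh p) := Q.M0 p φb - τ • Q.M1 p φb φt

/-- `M(τ)⁻¹` (`M(τ)` is invertible for `0 ≤ τ ≤ 1` on a causal tent). -/
def Minv (φb φt : E N → ℝ) (τ : ℝ) : Module.End ℝ (Q.Vh p) := Ring.inverse (Q.M p φb φt τ)

/-- `X_{h,k}`: `X_{h,0} = I` and `X_{h,k} = M₀⁻¹ (A_h + k M₁) X_{h,k-1}`. -/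
def Xh (φb φt : E N → ℝ) : ℕ → Module.End ℝ (Q.Vh p)
  | 0 => 1
  | k + 1 => Ring.inverse (Q.M0 p φb) *
      (Q.Ah p φb φt + ((k + 1 : ℕ) : ℝ) • Q.M1 p φb φt) * Xh φb φt k

/-- The discrete `s`-stage SAT flow `R^sat_{hs}(τ)`. -/
def Rsat (φb φt : E N → ℝ) (s : ℕ) (τ : ℝ) : Module.End ℝ (Q.Vh p) :=
  ∑ k ∈ Finset.range s, (τ ^ k / (k.factorial : ℝ)) • Q.Xh p φb φt k
    + (τ ^ s / (s.factorial : ℝ)) • (Q.Minv p φb φt τ * Q.M0 p φb * Q.Xh p φb φt s)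

/-- The front `φ(x, t̂) = (1 - t̂) φb(x) + t̂ φt(x)` at pseudotime `t̂`. -/
def front (φb φt : E N → ℝ) (t : ℝ) (x : E N) : ℝ := (1 - t) * φb x + t * φt x

/-- The composition of the flows at `τ = 1` on the lowest `l` of the `r` subtents; the subtents
lie between the fronts at pseudotimes `l / r` and `(l + 1) / r`, `l = 0, …, r - 1`. -/
def RsubUpTo (φb φt : E N → ℝ) (r s : ℕ) : ℕ → Module.End ℝ (Q.Vh p)
  | 0 => 1
  | l + 1 => Q.Rsat p (front φb φt ((l : ℝ) / r)) (front φb φt (((l : ℝ) + 1) / r)) s 1 *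
      RsubUpTo φb φt r s l

/-- The `s`-stage SAT propagator `R^sat_{rhs}` using `r` subtents. -/
def Rsub (φb φt : E N → ℝ) (r s : ℕ) : Module.End ℝ (Q.Vh p) := Q.RsubUpTo p φb φt r s r

variable {Q p}

/-- The norm `‖w‖_{M(τ)} = (M(τ) w, w)_v^{1/2}`. -/
def normM (φb φt : E N → ℝ) (τ : ℝ) (w : Q.Vh p) : ℝ := √(ip (Q.M p φb φt τ w) w)

/-- `d(w, u) = -[a(w, u) + a(u, w) + (M₁ w, u)_v]`. -/
def dForm (φb φt : E N → ℝ) (w u : Q.Vh p) : ℝ :=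
  -(aForm φb φt w u + aForm φb φt u w + ip (Q.M1 p φb φt w) u)

/-- `|w|_d = d(w, w)^{1/2}`. -/
def dNorm (φb φt : E N → ℝ) (w : Q.Vh p) : ℝ := √(dForm φb φt w w)

variable (Q p)

/-- The kernel `K_h` of `A_h + A_hᵗ + M₁` on `V_h`. -/
def Kh (φb φt : E N → ℝ) : Submodule ℝ (Q.Vh p) :=
  LinearMap.ker (Q.Ah p φb φt + Q.AhT p φb φt + Q.M1 p φb φt)

/-- The orthogonal complement of `K_h` in `V_h` with respect to `(·,·)_v`. -/
def KhPerp (φb φt : E N → ℝ) : Set (Q.Vh p) := {w | ∀ k ∈ Q.Kh p φb φt, ip w k = 0}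

/-- `κ`, the supremum over `0 ≤ τ ≤ 1` and `0 ≠ w ∈ K_h^⊥` of
`‖M(τ)⁻¹ (A_h + M₁) w‖²_{M(τ)} / |w|_d²`, as an extended nonnegative number. -/
def kappa (φb φt : E N → ℝ) : ℝ≥0∞ :=
  ⨆ τ ∈ Set.Icc (0 : ℝ) 1, ⨆ w ∈ Q.KhPerp p φb φt, ⨆ _ : w ≠ 0,
    ENNReal.ofReal
        (normM φb φt τ (Q.Minv p φb φt τ ((Q.Ah p φb φt + Q.M1 p φb φt) w)) ^ 2)
      / ENNReal.ofReal (dNorm φb φt w ^ 2)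

/-- The SAT stability assumption with constant `Csta` on the tent:
`‖R^sat_{rhs} w‖_{M(1)} ≤ (1 + Csta h_v) ‖w‖_{M(0)}`. -/
def SATStable (φb φt : E N → ℝ) (r s : ℕ) (Csta : ℝ) : Prop :=
  ∀ w : Q.Vh p, normM φb φt 1 (Q.Rsub p φb φt r s w) ≤ (1 + Csta * Q.patchSize) * normM φb φt 0 w

end Setting

end TentDG

end

noncomputable section

namespace TentDG

/-! ### Linear algebra: symmetric pencils, the energy step, operators from forms -/

section

/-! ### Symmetric matrix pencils -/

/-! For one stage the factor `M₀` cancels and the flow is `w ↦ w + τ z` with `M(τ) z = (A_h + M₁)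
w`. Expanding the square and using `M(τ) = M₀ - τ M₁` gives `‖w + τ z‖²_{M(τ)} = ‖w‖²_{M₀} - τ
|w|_d² + τ² ‖z‖²_{M(τ)}`, so stability holds as soon as `τ ‖z‖²_{M(τ)} ≤ |w|_d²` (`step_le`,
`substep_le`). This is what `τ κ ≤ 1` provides on `K_h^⊥`. It extends to all of `V_h` because `A_h +
M₁` vanishes on `K_h` and `|·|_d` does not see a `K_h`-component (`ratio_le_kappa`).

The bound on `κ` uses that functions in `V_h` are piecewise constant. The volume term of `a`
vanishes, and the divergence theorem writes `M₁` as a sum of facet integrals of `δ 𝒟`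
(`divergence_identity`). Hence `A_h + M₁` is a sum over facets of `δ` times `½𝒟(w - w_o) - S(w -
w_o)`, or `½(𝒟 - B) w` on the boundary. It involves `w` only through jumps and boundary values. The
design conditions bound these terms by `‖u‖₂ |jump|_S` or `‖u‖₂ |w|_B` (`interior_flux_le`,
`boundary_flux_le`).

On the other side, `|w|_d²` is exactly the `δ`-weighted sum of the squared seminorms of these jumps
and boundary values (`dQ_eq`). The remaining terms cancel between the two sides of a facet, because
`𝒟` changes sign there. That sign change is the continuity of the normal component of a piecewise
constant divergence-free field (`Dmat_neg`), obtained by testing the distributional equation with a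
radial bump centred on the facet.

What remains is the scaling: `∫_F δ ≤ (2|σ|/ĉ) |K|`, from causality and shape regularity
(`facInt_le`), and `M(τ) ≥ (1 - c/ĉ) γ`, from the wave speed bound and causality (`massOn_coercive`,
`M_coercive`). With Young's inequality this yields `‖z‖²_{M(τ)} ≤ C |w|_d²` (`ratio_bound`).

For subtents, `A_h` and `M₁` scale with the height while the mass operator at the bottom front is
`M(ℓ/r)`. A subtent flow at `τ = 1` is therefore the same step with length `1/r`, started at
pseudotime `ℓ/r` of the whole tent (`Rsat_front_apply`), and the energy inequalities telescope
(`RsubUpTo_le`). -/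

lemma dotProduct_self_nonneg' {L : ℕ} (y : Fin L → ℝ) : 0 ≤ y ⬝ᵥ y :=
  Finset.sum_nonneg fun _ _ => mul_self_nonneg _

lemma norm2_sq {L : ℕ} (y : Fin L → ℝ) : norm2 y ^ 2 = y ⬝ᵥ y :=
  Real.sq_sqrt (dotProduct_self_nonneg' y)

lemma norm2_nonneg {L : ℕ} (y : Fin L → ℝ) : 0 ≤ norm2 y := Real.sqrt_nonneg _

lemma dotProduct_le_norm2 {L : ℕ} (y z : Fin L → ℝ) : y ⬝ᵥ z ≤ norm2 y * norm2 z := by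
  have h := Finset.sum_mul_sq_le_sq_mul_sq Finset.univ y z
  refine le_trans (le_abs_self _) (abs_le_of_sq_le_sq ?_ (by positivity [norm2_nonneg y, norm2_nonneg z])) |>.trans le_rfl
  rw [mul_pow, norm2_sq, norm2_sq]
  simpa [dotProduct, sq] using h

lemma mulVec_dotProduct_comm_of_isSymm {L : ℕ} {A : Mat L} (hA : A.IsSymm) (y z : Fin L → ℝ) :
    (A *ᵥ y) ⬝ᵥ z = (A *ᵥ z) ⬝ᵥ y := by
  rw [dotProduct_comm, dotProduct_mulVec, ← mulVec_transpose, hA.eq, dotProduct_comm]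

/-- If all eigenvalues `lam` of the symmetric pencil `(D, G)` with `G` positive definite are at
most `c`, then `D ≤ c G`. -/
lemma pencil_le {L : ℕ} {D G : Mat L} {γ c : ℝ} (hγ : 0 < γ) (hD : D.IsSymm) (hG : G.IsSymm)
    (hpos : ∀ y, γ * norm2 y ^ 2 ≤ (G *ᵥ y) ⬝ᵥ y)
    (hev : ∀ (e : Fin L → ℝ) (lam : ℝ), e ≠ 0 → D *ᵥ e = lam • (G *ᵥ e) → lam ≤ c)
    (y : Fin L → ℝ) : (D *ᵥ y) ⬝ᵥ y ≤ c * ((G *ᵥ y) ⬝ᵥ y) := by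
  by_cases hy : y = 0
  · simp [hy]
  have hq : ∀ z : Fin L → ℝ, z ≠ 0 → 0 < (G *ᵥ z) ⬝ᵥ z := by
    intro z hz
    refine lt_of_lt_of_le ?_ (hpos z)
    rw [norm2_sq]
    have : 0 < z ⬝ᵥ z :=
      lt_of_le_of_ne (dotProduct_self_nonneg' z) fun h => hz (dotProduct_self_eq_zero.mp h.symm)
    positivity
  have hcontG : Continuous fun z : Fin L → ℝ => (G *ᵥ z) ⬝ᵥ z := by fun_prop
  have hcontD : Continuous fun z : Fin L → ℝ => (D *ᵥ z) ⬝ᵥ z := by fun_prop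
  have hcomp : IsCompact {z : Fin L → ℝ | (G *ᵥ z) ⬝ᵥ z = 1} := by
    refine Metric.isCompact_of_isClosed_isBounded (isClosed_eq hcontG continuous_const) ?_
    refine (Metric.isBounded_closedBall (x := (0 : Fin L → ℝ)) (r := √(1 / γ))).subset ?_
    intro z hz
    have h1 : z ⬝ᵥ z ≤ 1 / γ := by
      rw [le_div_iff₀ hγ, mul_comm, ← norm2_sq]
      exact (hpos z).trans_eq hz
    rw [mem_closedBall_zero_iff, pi_norm_le_iff_of_nonneg (Real.sqrt_nonneg _)]
    intro i
    rw [Real.norm_eq_abs]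
    refine Real.abs_le_sqrt (le_trans ?_ h1)
    rw [sq]
    exact Finset.single_le_sum (f := fun i => z i * z i) (fun i _ => mul_self_nonneg _)
      (Finset.mem_univ i)
  have hscale : ∀ (A : Mat L) (r : ℝ) (z : Fin L → ℝ),
      (A *ᵥ (r • z)) ⬝ᵥ (r • z) = r ^ 2 * ((A *ᵥ z) ⬝ᵥ z) := by
    intro A r z
    simp [mulVec_smul, smul_dotProduct, dotProduct_smul]; ring
  have hnormalize : ∀ z : Fin L → ℝ, z ≠ 0 →
      (G *ᵥ ((√((G *ᵥ z) ⬝ᵥ z))⁻¹ • z)) ⬝ᵥ ((√((G *ᵥ z) ⬝ᵥ z))⁻¹ • z) = 1 := by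
    intro z hz
    rw [hscale, inv_pow, Real.sq_sqrt (hq z hz).le, inv_mul_cancel₀ (hq z hz).ne']
  -- A maximiser of the Rayleigh quotient on the compact set `G = 1` is an eigenvector for the
  -- maximal value `lam`: the form `lam G - D` is positive semidefinite and vanishes at `e`, so `e`
  -- lies in its kernel. The hypothesis on eigenvalues then bounds `lam`.
  obtain ⟨e, he, hmax⟩ := hcomp.exists_isMaxOn ⟨_, hnormalize y hy⟩ hcontD.continuousOn
  have he0 : e ≠ 0 := by
    rintro rfl
    simp at he
  set lam := (D *ᵥ e) ⬝ᵥ e with hlam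
  have hle : ∀ z : Fin L → ℝ, (D *ᵥ z) ⬝ᵥ z ≤ lam * ((G *ᵥ z) ⬝ᵥ z) := by
    intro z
    by_cases hz : z = 0
    · simp [hz]
    have := hmax (hnormalize z hz)
    simp only [Set.mem_ofPred_eq, hscale, inv_pow, Real.sq_sqrt (hq z hz).le] at this
    rwa [inv_mul_le_iff₀ (hq z hz), mul_comm] at this
  have hpsd : (lam • G - D).PosSemidef := by
    refine Matrix.PosSemidef.of_dotProduct_mulVec_nonneg ?_ ?_
    · rw [Matrix.IsHermitian, conjTranspose_eq_transpose_of_trivial, transpose_sub,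
        transpose_smul, hD.eq, hG.eq]
    · intro z
      have := hle z
      simp only [star_trivial, sub_mulVec, smul_mulVec, dotProduct_sub, dotProduct_smul, smul_eq_mul]
      rw [dotProduct_comm z, dotProduct_comm z]
      linarith
  have hker : (lam • G - D) *ᵥ e = 0 := by
    rw [← hpsd.dotProduct_mulVec_zero_iff]
    simp only [star_trivial, sub_mulVec, smul_mulVec, dotProduct_sub, dotProduct_smul, smul_eq_mul]
    have he' : (G *ᵥ e) ⬝ᵥ e = 1 := he
    rw [dotProduct_comm e, dotProduct_comm e, he', ← hlam]
    ring
  have hlc : lam ≤ c := by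
    refine hev e lam he0 ?_
    rw [sub_mulVec, smul_mulVec, sub_eq_zero] at hker
    exact hker.symm
  exact (hle y).trans (mul_le_mul_of_nonneg_right hlc (hq y hy).le)

/-! ### The energy identity of a one-stage step -/

/-- One step `w ↦ w + h M(t+h)⁻¹ (A + M₁) w` does not increase the `M`-norm. -/
lemma step_le {V : Type*} [AddCommGroup V] [Module ℝ V] (B : LinearMap.BilinForm ℝ V)
    (hB : ∀ x y, B x y = B y x) {Mt Mth A M1 : Module.End ℝ V} {h κ : ℝ} (hh : 0 ≤ h)
    (hM : Mth = Mt - h • M1) (hsym : ∀ x y, B (Mth x) y = B x (Mth y))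
    (w z : V) (hz : Mth z = (A + M1) w)
    (hd : 0 ≤ -(2 * B (A w) w + B (M1 w) w)) (hκ : h * κ ≤ 1)
    (hbound : B (Mth z) z ≤ κ * -(2 * B (A w) w + B (M1 w) w)) :
    B (Mth (w + h • z)) (w + h • z) ≤ B (Mt w) w := by
  have h1 : B (Mth w) w = B (Mt w) w - h * B (M1 w) w := by
    simp [hM]
  have h2 : B (Mth w) z = B (Mth z) w := by rw [hsym, hB]
  have h3 : B (Mth z) w = B (A w) w + B (M1 w) w := by rw [hz]; simp
  have h4 : B (Mth (w + h • z)) (w + h • z)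
      = B (Mth w) w + 2 * h * B (Mth z) w + h ^ 2 * B (Mth z) z := by
    simp [h2]; ring
  -- With `d = -(2 (A w, w) + (M₁ w, w))`, the left side is now `(Mt w, w) - h d + h² (Mth z, z)`.
  rw [h4, h1, h3]
  have h5 : h ^ 2 * B (Mth z) z ≤ h ^ 2 * (κ * -(2 * B (A w) w + B (M1 w) w)) :=
    mul_le_mul_of_nonneg_left hbound (sq_nonneg h)
  have h6 : h * κ * (h * -(2 * B (A w) w + B (M1 w) w)) ≤ 1 * (h * -(2 * B (A w) w + B (M1 w) w)) :=
    mul_le_mul_of_nonneg_right hκ (mul_nonneg hh hd)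
  nlinarith

/-- In finite dimension a bilinear form is represented by an operator with respect to a positive
definite form. -/
lemma exists_operator {V : Type*} [AddCommGroup V] [Module ℝ V] [FiniteDimensional ℝ V]
    (B : LinearMap.BilinForm ℝ V) (hpos : ∀ x, x ≠ 0 → 0 < B x x)
    (b : LinearMap.BilinForm ℝ V) : ∃ O : Module.End ℝ V, ∀ w u, B (O w) u = b w u := by
  have hinj : Function.Injective B := by
    rw [← LinearMap.ker_eq_bot, LinearMap.ker_eq_bot']
    intro x hx
    by_contra h
    have := hpos x h
    simp [hx] at this
  let e : V ≃ₗ[ℝ] Module.Dual ℝ V := LinearEquiv.ofInjectiveOfFinrankEq B hinj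
    (Subspace.dual_finrank_eq).symm
  refine ⟨e.symm.toLinearMap ∘ₗ b, fun w u => ?_⟩
  have : B (e.symm (b w)) = b w := e.apply_symm_apply (b w)
  simp [this]

lemma isUnit_of_pos {V : Type*} [AddCommGroup V] [Module ℝ V] [FiniteDimensional ℝ V]
    (B : LinearMap.BilinForm ℝ V) (O : Module.End ℝ V) (hpos : ∀ x, x ≠ 0 → 0 < B (O x) x) :
    IsUnit O := by
  rw [LinearMap.isUnit_iff_ker_eq_bot, LinearMap.ker_eq_bot']
  intro x hx
  by_contra h
  have := hpos x h
  simp [hx] at this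

end

/-! ### Affine functions and barycentric coordinates on one simplex -/

section

variable {N : ℕ}

/-! ### Gradients of affine functions -/

/-- The gradient of an affine function. -/
def affGrad (f : E N →ᵃ[ℝ] ℝ) : E N :=
  (InnerProductSpace.toDual ℝ (E N)).symm (LinearMap.toContinuousLinearMap f.linear)

lemma inner_affGrad (f : E N →ᵃ[ℝ] ℝ) (y : E N) : inner ℝ (affGrad f) y = f.linear y := by
  simp [affGrad]

lemma affine_sub (f : E N →ᵃ[ℝ] ℝ) (x y : E N) : f x - f y = inner ℝ (affGrad f) (x - y) := by
  rw [inner_affGrad]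
  simpa using (f.linearMap_vsub x y).symm

lemma affGrad_unique (f : E N →ᵃ[ℝ] ℝ) (g : E N) (h : ∀ y, inner ℝ g y = f.linear y) :
    affGrad f = g :=
  ext_inner_right ℝ fun y => by rw [inner_affGrad, h]

lemma hasGradientAt_affine (f : E N →ᵃ[ℝ] ℝ) (x : E N) : HasGradientAt f (affGrad f) x := by
  rw [hasGradientAt_iff_hasFDerivAt]
  simp only [affGrad, LinearIsometryEquiv.apply_symm_apply]
  have h1 : HasFDerivAt (fun y => (LinearMap.toContinuousLinearMap f.linear) y + f 0)
      (LinearMap.toContinuousLinearMap f.linear) x :=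
    (ContinuousLinearMap.hasFDerivAt _).add_const _
  refine h1.congr_of_eventuallyEq (Filter.Eventually.of_forall fun y => ?_)
  have := f.linearMap_vsub y 0
  simp at this
  simp [this]

lemma gradient_eq_affGrad {φ : E N → ℝ} {s : Set (E N)} {f : E N →ᵃ[ℝ] ℝ}
    (h : ∀ x ∈ s, φ x = f x) {x : E N} (hx : x ∈ interior s) : ∇ φ x = affGrad f := by
  refine HasGradientAt.gradient ?_
  have h1 := hasGradientAt_affine f x
  rw [hasGradientAt_iff_hasFDerivAt] at h1 ⊢
  refine h1.congr_of_eventuallyEq ?_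
  filter_upwards [mem_interior_iff_mem_nhds.mp hx] with y hy using h y hy

/-! ### Simplices and barycentric coordinates -/

/-- `K` is the vertex set of a nondegenerate `N`-simplex in `ℝ^N`. -/
def IsSimplex (K : Finset (E N)) : Prop :=
  AffineIndependent ℝ ((↑) : K → E N) ∧ K.card = N + 1

lemma IsSimplex.span_eq_top {K : Finset (E N)} (hK : IsSimplex K) :
    affineSpan ℝ (Set.range ((↑) : K → E N)) = ⊤ := by
  rw [hK.1.affineSpan_eq_top_iff_card_eq_finrank_add_one]
  simp [hK.2]

/-- The vertices of a simplex as an affine basis. -/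
def IsSimplex.basis {K : Finset (E N)} (hK : IsSimplex K) : AffineBasis K ℝ (E N) :=
  ⟨(↑), hK.1, hK.span_eq_top⟩

@[simp] lemma IsSimplex.basis_apply {K : Finset (E N)} (hK : IsSimplex K) (p : K) :
    hK.basis p = p := rfl

open Classical in
/-- The barycentric coordinate function of the simplex `K` that belongs to its vertex `q`. -/
def bc (K : Finset (E N)) (q : E N) : E N →ᵃ[ℝ] ℝ :=
  if h : IsSimplex K ∧ q ∈ K then h.1.basis.coord ⟨q, h.2⟩ else AffineMap.const ℝ _ 0

lemma bc_eq {K : Finset (E N)} (hK : IsSimplex K) {q : E N} (hq : q ∈ K) :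
    bc K q = hK.basis.coord ⟨q, hq⟩ := by
  rw [bc, dif_pos ⟨hK, hq⟩]

variable {K : Finset (E N)} (hK : IsSimplex K)
include hK

lemma bc_self {q : E N} (hq : q ∈ K) : bc K q q = 1 := by
  rw [bc_eq hK hq]
  exact hK.basis.coord_apply_eq ⟨q, hq⟩

lemma bc_ne {p q : E N} (hq : q ∈ K) (hp : p ∈ K) (hpq : p ≠ q) : bc K q p = 0 := by
  rw [bc_eq hK hq]
  exact hK.basis.coord_apply_ne (i := ⟨q, hq⟩) (j := ⟨p, hp⟩) (by simpa using hpq.symm)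

lemma affine_eq_sum_bc (f : E N →ᵃ[ℝ] ℝ) (x : E N) : f x = ∑ q ∈ K, bc K q x * f q := by
  have h := hK.basis.affineCombination_coord_eq_self x
  have h1 : f x = ∑ q : K, hK.basis.coord q x * f q := by
    conv_lhs => rw [← h]
    rw [Finset.map_affineCombination _ _ _ (hK.basis.sum_coord_apply_eq_one x),
      Finset.affineCombination_eq_linear_combination _ _ _ (hK.basis.sum_coord_apply_eq_one x)]
    simp
  rw [h1, ← Finset.sum_coe_sort K (fun q => bc K q x * f q)]
  exact Finset.sum_congr rfl fun q _ => by rw [bc_eq hK q.2]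

lemma sum_bc (x : E N) : ∑ q ∈ K, bc K q x = 1 := by
  have := affine_eq_sum_bc hK (AffineMap.const ℝ _ 1) x
  simpa using this.symm

lemma sum_bc_smul (x : E N) : ∑ q ∈ K, bc K q x • q = x := by
  have h := hK.basis.linear_combination_coord_eq_self x
  rw [← Finset.sum_coe_sort]
  conv_rhs => rw [← h]
  exact Finset.sum_congr rfl fun q _ => by rw [bc_eq hK q.2]; rfl

lemma affine_ext {f g : E N →ᵃ[ℝ] ℝ} (h : ∀ q ∈ K, f q = g q) : f = g := by
  ext x
  rw [affine_eq_sum_bc hK f, affine_eq_sum_bc hK g]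
  exact Finset.sum_congr rfl fun q hq => by rw [h q hq]

lemma mem_hull_iff {x : E N} : x ∈ hull K ↔ ∀ q ∈ K, 0 ≤ bc K q x := by
  have h := hK.basis.convexHull_eq_nonneg_coord
  have h2 : Set.range hK.basis = (K : Set (E N)) := by
    ext y; simp
  rw [hull, ← h2, h]
  constructor
  · intro h q hq
    rw [bc_eq hK hq]; exact h ⟨q, hq⟩
  · intro h q
    have := h q q.2
    rwa [bc_eq hK q.2] at this

lemma mem_interior_hull_iff {x : E N} : x ∈ interior (hull K) ↔ ∀ q ∈ K, 0 < bc K q x := by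
  have h := hK.basis.interior_convexHull
  have h2 : Set.range hK.basis = (K : Set (E N)) := by
    ext y; simp
  rw [hull, ← h2, h]
  constructor
  · intro h q hq
    rw [bc_eq hK hq]; exact h ⟨q, hq⟩
  · intro h q
    have := h q q.2
    rwa [bc_eq hK q.2] at this

lemma bc_centroid {q : E N} (hq : q ∈ K) : bc K q (K.centroid ℝ id) = (K.card : ℝ)⁻¹ := by
  have hne : K.card ≠ 0 := by rw [hK.2]; omega
  have h1 := Finset.sum_centroidWeights_eq_one_of_card_ne_zero ℝ K
    (by exact_mod_cast hne)
  rw [Finset.centroid, Finset.map_affineCombination _ _ _ h1,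
    Finset.affineCombination_eq_linear_combination _ _ _ h1]
  rw [Finset.sum_eq_single_of_mem q hq]
  · simp [bc_self hK hq]
  · intro p hp hpq
    simp [bc_ne hK hq hp hpq]

lemma centroid_mem_interior : K.centroid ℝ id ∈ interior (hull K) := by
  rw [mem_interior_hull_iff hK]
  intro q hq
  rw [bc_centroid hK hq, hK.2]
  positivity

lemma mem_facet_iff {q : E N} (hq : q ∈ K) {x : E N} :
    x ∈ hull (K.erase q) ↔ x ∈ hull K ∧ bc K q x = 0 := by
  constructor
  · intro hx
    refine ⟨convexHull_mono (by simp) hx, ?_⟩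
    have h1 : hull (K.erase q) ⊆ (bc K q) ⁻¹' {0} := by
      refine convexHull_min ?_ ((convex_singleton (0 : ℝ)).affine_preimage _)
      intro p hp
      simp only [Finset.coe_erase, Set.mem_sdiff, Finset.mem_coe, Set.mem_singleton_iff] at hp
      exact bc_ne hK hq hp.1 hp.2
    exact h1 hx
  · rintro ⟨hx, h0⟩
    rw [mem_hull_iff hK] at hx
    have hs := sum_bc hK x
    have hs' := sum_bc_smul hK x
    rw [← Finset.add_sum_erase _ _ hq, h0] at hs hs'
    simp only [zero_add, zero_smul] at hs hs'
    rw [← hs']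
    refine (convex_convexHull ℝ _).sum_mem (fun p hp => hx p (Finset.mem_of_mem_erase hp)) hs ?_
    intro p hp
    exact subset_convexHull ℝ _ (by simpa [and_comm] using hp)

omit hK in
lemma homothety_affine (f : E N →ᵃ[ℝ] ℝ) (p x : E N) (r : ℝ) :
    f (AffineMap.homothety p r x) = r * (f x - f p) + f p := by
  rw [AffineMap.homothety_eq_lineMap, AffineMap.apply_lineMap, AffineMap.lineMap_apply]
  simp

/-- The homothety about `q` with ratio `1 - t` multiplies every other barycentric coordinate by `1 -
t` and sends the value `0` of `bc K q` to `t`. Slices of `K` parallel to a facet are thus scaled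
copies of that facet. -/
lemma slice_eq {q : E N} (hq : q ∈ K) {t : ℝ} (h0 : 0 ≤ t) (h1 : t < 1) :
    hull K ∩ {x | bc K q x = t} = AffineMap.homothety q (1 - t) '' hull (K.erase q) := by
  have ht : 0 < 1 - t := by linarith
  ext x
  constructor
  · rintro ⟨hx, hxt⟩
    rw [mem_hull_iff hK] at hx
    refine ⟨AffineMap.homothety q (1 - t)⁻¹ x, ?_, ?_⟩
    · rw [mem_facet_iff hK hq, mem_hull_iff hK]
      have hqq : bc K q (AffineMap.homothety q (1 - t)⁻¹ x) = 0 := by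
        rw [homothety_affine, bc_self hK hq, hxt]; field_simp; ring
      refine ⟨fun p hp => ?_, hqq⟩
      by_cases hpq : p = q
      · rw [hpq, hqq]
      · rw [homothety_affine, bc_ne hK hp hq (Ne.symm hpq)]
        have := hx p hp
        simp only [sub_zero, add_zero]
        positivity
    · simp [AffineMap.homothety_apply, smul_smul, mul_inv_cancel₀ ht.ne']
  · rintro ⟨y, hy, rfl⟩
    rw [mem_facet_iff hK hq, mem_hull_iff hK] at hy
    have hqq : bc K q (AffineMap.homothety q (1 - t) y) = t := by
      rw [homothety_affine, bc_self hK hq, hy.2]; ring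
    refine ⟨?_, hqq⟩
    rw [mem_hull_iff hK]
    intro p hp
    by_cases hpq : p = q
    · rw [hpq, hqq]; exact h0
    · rw [homothety_affine, bc_ne hK hp hq (Ne.symm hpq)]
      have := hy.1 p hp
      simp only [sub_zero, add_zero]
      positivity

/-- The same scaling inside a facet, centred at one of its vertices `v`: since `1 - bc K v` is
multiplied by `1 - t`, the image fills the part with `bc K v ≥ t`. -/
lemma facet_superlevel_eq {q v : E N} (hq : q ∈ K) (hv : v ∈ K) (hvq : v ≠ q) {t : ℝ}
    (h0 : 0 ≤ t) (h1 : t < 1) :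
    hull (K.erase q) ∩ {x | t ≤ bc K v x} = AffineMap.homothety v (1 - t) '' hull (K.erase q) := by
  have ht : 0 < 1 - t := by linarith
  ext x
  constructor
  · rintro ⟨hx, hxt⟩
    rw [mem_facet_iff hK hq, mem_hull_iff hK] at hx
    refine ⟨AffineMap.homothety v (1 - t)⁻¹ x, ?_, ?_⟩
    · rw [mem_facet_iff hK hq, mem_hull_iff hK]
      refine ⟨fun p hp => ?_, ?_⟩
      · by_cases hpv : p = v
        · rw [hpv, homothety_affine, bc_self hK hv]
          have hxt' : t ≤ bc K v x := hxt
          have : (1 - t)⁻¹ * (bc K v x - 1) + 1 = (1 - t)⁻¹ * (bc K v x - t) := by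
            field_simp; ring
          rw [this]
          have h2 : 0 ≤ bc K v x - t := by linarith
          positivity
        · rw [homothety_affine, bc_ne hK hp hv (Ne.symm hpv)]
          have := hx.1 p hp
          simp only [sub_zero, add_zero]
          positivity
      · rw [homothety_affine, bc_ne hK hq hv hvq, hx.2]; simp
    · simp [AffineMap.homothety_apply, smul_smul, mul_inv_cancel₀ ht.ne']
  · rintro ⟨y, hy, rfl⟩
    rw [mem_facet_iff hK hq, mem_hull_iff hK] at hy
    have hvv : bc K v (AffineMap.homothety v (1 - t) y) = (1 - t) * bc K v y + t := by
      rw [homothety_affine, bc_self hK hv]; ring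
    have hvy := hy.1 v hv
    refine ⟨?_, ?_⟩
    · rw [mem_facet_iff hK hq, mem_hull_iff hK]
      refine ⟨fun p hp => ?_, ?_⟩
      · by_cases hpv : p = v
        · rw [hpv, hvv]; positivity
        · rw [homothety_affine, bc_ne hK hp hv (Ne.symm hpv)]
          have := hy.1 p hp
          simp only [sub_zero, add_zero]
          positivity
      · rw [homothety_affine, bc_ne hK hq hv hvq, hy.2]; simp
    · change t ≤ bc K v _
      rw [hvv]
      have : 0 ≤ (1 - t) * bc K v y := by positivity
      linarith

lemma bc_le_one {q x : E N} (hq : q ∈ K) (hx : x ∈ hull K) : bc K q x ≤ 1 := by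
  rw [← sum_bc hK x]
  exact Finset.single_le_sum (f := fun p => bc K p x) (fun p hp => (mem_hull_iff hK).mp hx p hp) hq

omit hK in
lemma continuous_bc (K : Finset (E N)) (q : E N) : Continuous (bc K q) :=
  AffineMap.continuous_of_finiteDimensional _

omit hK in
lemma isCompact_hull (K : Finset (E N)) : IsCompact (hull K) :=
  K.finite_toSet.isCompact_convexHull ℝ

omit hK in
lemma measurableSet_hull (K : Finset (E N)) : MeasurableSet (hull K) :=
  (isCompact_hull K).measurableSet

/-- The gradient of the barycentric coordinate function. -/
def bcGrad (K : Finset (E N)) (q : E N) : E N := affGrad (bc K q)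

lemma exists_ne_mem (hN : 0 < N) (q : E N) : ∃ p ∈ K, p ≠ q := by
  by_contra! h
  have : K ⊆ {q} := fun p hp => by simpa using h p hp
  have := Finset.card_le_card this
  rw [hK.2] at this
  simp at this
  omega

lemma bcGrad_ne_zero (hN : 0 < N) {q : E N} (hq : q ∈ K) : bcGrad K q ≠ 0 := by
  intro h
  obtain ⟨p, hp, hpq⟩ := exists_ne_mem hK hN q
  have h1 := affine_sub (bc K q) q p
  rw [bc_self hK hq, bc_ne hK hq hp hpq] at h1
  change _ = inner ℝ (bcGrad K q) _ at h1
  simp [h] at h1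

lemma sum_bcGrad : ∑ q ∈ K, bcGrad K q = 0 := by
  refine ext_inner_right ℝ fun y => ?_
  have h1 := sum_bc hK y
  have h2 := sum_bc hK 0
  rw [sum_inner, inner_zero_left]
  have : ∀ q ∈ K, inner ℝ (bcGrad K q) y = bc K q y - bc K q 0 := by
    intro q _
    have := affine_sub (bc K q) y 0
    rw [this]; simp [bcGrad]
  rw [Finset.sum_congr rfl this, Finset.sum_sub_distrib, h1, h2, sub_self]

end

/-! ### Measures, normals and shape regularity of one simplex -/

section

variable {N : ℕ} {K : Finset (E N)}

/-! ### Volumes of simplices and of their facets -/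

lemma homothety_measure (d : ℕ) (p : E N) {t : ℝ} (h1 : t < 1) (s : Set (E N)) :
    μHE[d] (AffineMap.homothety p (1 - t) '' s) = ENNReal.ofReal ((1 - t) ^ d) * μHE[d] s := by
  have ht : 0 < 1 - t := by linarith
  rw [euclideanHausdorffMeasure_homothety_image d p ht.ne', ENNReal.smul_def, smul_eq_mul]
  congr 1
  rw [ENNReal.ofReal_pow ht.le, ENNReal.coe_pow, Real.nnnorm_of_nonneg ht.le, ENNReal.ofReal]
  congr 2
  exact (Real.toNNReal_of_nonneg ht.le).symm

/-- Layer cake formula: each superlevel set of the coordinate is a copy of the facet scaled by `1 -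
t`. The right-hand side is left unevaluated, since `volume_hull_eq` produces the same expression. -/
lemma lintegral_bc_facet (hK : IsSimplex K) {q v : E N} (hq : q ∈ K) (hv : v ∈ K)
    (hvq : v ≠ q) :
    ∫⁻ x in hull (K.erase q), ENNReal.ofReal (bc K v x) ∂(μHE[N - 1])
      = ∫⁻ t in Set.Ioo (0 : ℝ) 1, ENNReal.ofReal ((1 - t) ^ (N - 1)) * μHE[N - 1] (hull (K.erase q)) := by
  have hle : hull (K.erase q) ⊆ hull K := convexHull_mono (by simp)
  rw [lintegral_eq_lintegral_meas_le _ _ (continuous_bc K v).aemeasurable]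
  · rw [← Set.Ioo_union_Ici_eq_Ioi (zero_lt_one (α := ℝ)), lintegral_union measurableSet_Ici]
    · have hz : ∫⁻ t in Set.Ici (1 : ℝ),
          (μHE[N - 1]).restrict (hull (K.erase q)) {a | t ≤ bc K v a} = 0 := by
        -- The level `1` is dropped as a null set of levels: there the superlevel set is `{v}`,
        -- whose measure is not zero when `N = 1`.
        rw [setLIntegral_congr (Ioi_ae_eq_Ici (a := (1 : ℝ))).symm]
        rw [setLIntegral_congr_fun (g := fun _ => 0) measurableSet_Ioi]
        · simp
        · intro t ht
          simp only [Set.mem_Ioi] at ht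
          beta_reduce
          rw [Measure.restrict_apply (measurableSet_le measurable_const (continuous_bc K v).measurable)]
          convert measure_empty (μ := (μHE[N - 1] : Measure (E N)))
          ext x
          simp only [Set.mem_inter_iff, Set.mem_ofPred_eq, Set.mem_empty_iff_false, iff_false, not_and]
          intro h hx
          have := bc_le_one hK hv (hle hx)
          linarith
      rw [hz, add_zero]
      refine setLIntegral_congr_fun measurableSet_Ioo fun t ht => ?_
      rw [Measure.restrict_apply (measurableSet_le measurable_const (continuous_bc K v).measurable),
        Set.inter_comm, facet_superlevel_eq hK hq hv hvq ht.1.le ht.2, homothety_measure _ _ ht.2]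
    · rw [Set.disjoint_left]
      intro t ht ht'
      exact absurd ht.2 (not_lt.mpr ht')
  · rw [Filter.EventuallyLE, ae_restrict_iff' (measurableSet_hull _)]
    exact Filter.Eventually.of_forall fun x hx => (mem_hull_iff hK).mp (hle hx) v hv

/-- Cavalieri's principle along the gradient of `bc K q`: the slices are copies of the facet scaled
by `1 - t`, and the factor `‖bcGrad K q‖` is the speed of the parameter `t`. Comparison with
`lintegral_bc_facet` relates facet integrals to volumes without evaluating either, and without
knowing beforehand that the facet has finite measure. -/
lemma volume_hull_eq (hK : IsSimplex K) (hN : 0 < N) {q : E N} (hq : q ∈ K) :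
    ‖bcGrad K q‖ₑ * volume (hull K)
      = ∫⁻ t in Set.Ioo (0 : ℝ) 1, ENNReal.ofReal ((1 - t) ^ (N - 1)) * μHE[N - 1] (hull (K.erase q)) := by
  set g := bcGrad K q with hg
  have hg0 : g ≠ 0 := bcGrad_ne_zero hK hN hq
  obtain ⟨p, hp, hpq⟩ := exists_ne_mem hK hN q
  have hp0 := bc_ne hK hq hp hpq
  -- Scaled so that `bc K q` takes the value `t` at `p + t v`. The hyperplane orthogonal to `v`
  -- through that point is then the level set `t`, and `‖g‖ ‖v‖ = 1`.
  set v : E N := (‖g‖ ^ 2)⁻¹ • g with hv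
  have hng : ‖g‖ ≠ 0 := norm_ne_zero_iff.mpr hg0
  have hv0 : v ≠ 0 := by
    rw [hv]
    exact smul_ne_zero (inv_ne_zero (pow_ne_zero _ hng)) hg0
  have hgv : inner ℝ g v = 1 := by
    rw [hv, inner_smul_right, real_inner_self_eq_norm_sq, inv_mul_cancel₀ (pow_ne_zero _ hng)]
  have hslice : ∀ t : ℝ, hull K ∩ (AffineSubspace.mk' (t • v +ᵥ p) (ℝ ∙ v)ᗮ : Set (E N))
      = hull K ∩ {x | bc K q x = t} := by
    intro t
    ext x
    simp only [Set.mem_inter_iff, Set.mem_ofPred_eq, and_congr_right_iff]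
    intro _
    rw [SetLike.mem_coe, AffineSubspace.mem_mk', Submodule.mem_orthogonal_singleton_iff_inner_right]
    have h1 : bc K q x - 0 = inner ℝ g (x - p) := by rw [← hp0]; exact affine_sub _ _ _
    rw [sub_zero] at h1
    have h2 : inner ℝ v (x -ᵥ (t • v +ᵥ p)) = (‖g‖ ^ 2)⁻¹ * (bc K q x - t) := by
      have : x -ᵥ (t • v +ᵥ p) = (x - p) - t • v := by simp; abel
      rw [this, hv, inner_smul_left, inner_sub_right, ← hv, inner_smul_right, hgv, ← h1]
      simp
    rw [h2]
    constructor
    · intro h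
      have := (mul_eq_zero.mp h).resolve_left (inv_ne_zero (pow_ne_zero _ hng))
      linarith
    · intro h; rw [h]; simp
  have hvol := EuclideanGeometry.euclideanHausdorffMeasure_eq_lintegral p hv0 (measurableSet_hull K)
  simp only [finrank_euclideanSpace, Fintype.card_fin] at hvol
  rw [EuclideanSpace.euclideanHausdorffMeasure_eq_volume] at hvol
  have hnn : ‖g‖ₑ * ‖v‖ₑ = 1 := by
    rw [hv, enorm_smul, enorm_inv (pow_ne_zero _ hng), enorm_pow, enorm_norm, mul_comm, mul_assoc, ← sq]
    exact ENNReal.inv_mul_cancel (by simpa using hg0) (by simp)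
  rw [hvol, ← mul_assoc, hnn, one_mul]
  simp_rw [hslice]
  rw [← lintegral_add_compl _ (measurableSet_Ico (a := (0 : ℝ)) (b := 1))]
  -- Slices outside `[0, 1)` are empty, except the single point `q` at `t = 1`; that one level is
  -- null.
  have hz : ∫⁻ t in (Set.Ico (0 : ℝ) 1)ᶜ, μHE[N - 1] (hull K ∩ {x | bc K q x = t}) = 0 := by
    have : ∀ᵐ t : ℝ, t ∈ (Set.Ico (0 : ℝ) 1)ᶜ → μHE[N - 1] (hull K ∩ {x | bc K q x = t}) = 0 := by
      have h1 : ∀ᵐ t : ℝ, t ≠ 1 := by simp [ae_iff]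
      filter_upwards [h1] with t ht1 ht
      convert measure_empty (μ := (μHE[N - 1] : Measure (E N)))
      ext x
      simp only [Set.mem_inter_iff, Set.mem_ofPred_eq, Set.mem_empty_iff_false, iff_false, not_and]
      intro hx hxt
      refine ht ⟨hxt ▸ (mem_hull_iff hK).mp hx q hq, lt_of_le_of_ne (hxt ▸ bc_le_one hK hq hx) ht1⟩
    rw [← ae_restrict_iff' measurableSet_Ico.compl] at this
    rw [lintegral_congr_ae this]
    simp
  rw [hz, add_zero, setLIntegral_congr Ioo_ae_eq_Ico.symm]
  refine setLIntegral_congr_fun measurableSet_Ioo fun t ht => ?_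
  rw [slice_eq hK hq ht.1.le ht.2, homothety_measure _ _ ht.2]

lemma volume_hull_lt_top (K : Finset (E N)) : volume (hull K) < ⊤ := (isCompact_hull K).measure_lt_top

lemma volume_hull_pos (hK : IsSimplex K) : 0 < (volume (hull K)).toReal := by
  refine ENNReal.toReal_pos ?_ (volume_hull_lt_top K).ne
  exact (Measure.measure_pos_of_nonempty_interior _ ⟨_, centroid_mem_interior hK⟩).ne'

lemma bc_facet_nonneg (hK : IsSimplex K) {q v : E N} (hv : v ∈ K) :
    ∀ x ∈ hull (K.erase q), 0 ≤ bc K v x := fun x hx =>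
  (mem_hull_iff hK).mp (convexHull_mono (by simp) hx) v hv

lemma integrableOn_bc_facet (hK : IsSimplex K) (hN : 0 < N) {q v : E N} (hq : q ∈ K) (hv : v ∈ K)
    (hvq : v ≠ q) : IntegrableOn (bc K v) (hull (K.erase q)) (μHE[N - 1]) := by
  refine ⟨(continuous_bc K v).aestronglyMeasurable, ?_⟩
  rw [hasFiniteIntegral_iff_ofReal]
  · rw [lintegral_bc_facet hK hq hv hvq, ← volume_hull_eq hK hN hq]
    exact ENNReal.mul_lt_top (by simp) (volume_hull_lt_top K)
  · rw [Filter.EventuallyLE, ae_restrict_iff' (measurableSet_hull _)]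
    exact Filter.Eventually.of_forall (bc_facet_nonneg hK hv)

/-- The integral of a barycentric coordinate over a facet, in terms of the volume of the simplex. -/
lemma integral_bc_facet (hK : IsSimplex K) (hN : 0 < N) {q v : E N} (hq : q ∈ K) (hv : v ∈ K)
    (hvq : v ≠ q) : ∫ x in hull (K.erase q), bc K v x ∂(μHE[N - 1])
      = ‖bcGrad K q‖ * (volume (hull K)).toReal := by
  rw [integral_eq_lintegral_of_nonneg_ae _ (continuous_bc K v).aestronglyMeasurable,
    lintegral_bc_facet hK hq hv hvq, ← volume_hull_eq hK hN hq]
  · simp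
  · rw [Filter.EventuallyLE, ae_restrict_iff' (measurableSet_hull _)]
    exact Filter.Eventually.of_forall (bc_facet_nonneg hK hv)

/-- The coefficients are prescribed only on open elements; the frontier of a convex set is null. -/
lemma setIntegral_hull_congr (K : Finset (E N)) {f g : E N → ℝ}
    (h : ∀ x ∈ interior (hull K), f x = g x) : ∫ x in hull K, f x = ∫ x in hull K, g x := by
  have h0 : interior (hull K) =ᵐ[volume] hull K :=
    interior_ae_eq_of_null_frontier ((convex_convexHull ℝ _).addHaar_frontier _)
  rw [← setIntegral_congr_set h0, ← setIntegral_congr_set h0]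
  exact setIntegral_congr_fun isOpen_interior.measurableSet h

lemma setIntegral_hull_const (K : Finset (E N)) {f : E N → ℝ} {a : ℝ}
    (h : ∀ x ∈ interior (hull K), f x = a) : ∫ x in hull K, f x = (volume (hull K)).toReal * a := by
  rw [setIntegral_hull_congr K h]
  simp [Measure.real]

/-! ### Outward normals -/

/-- `outwardNormal` is a choice, so uniqueness is needed. For any admissible `n` the function `y ↦ n
· (y - p)`, with `p` a vertex of the facet, is affine and vanishes on the facet's vertices, hence is
a multiple of `bc K q`. Orientation and `‖n‖ = 1` fix the factor. -/
lemma outwardNormal_eq (hK : IsSimplex K) (hN : 0 < N) {q : E N} (hq : q ∈ K) :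
    outwardNormal K q = -(‖bcGrad K q‖⁻¹ • bcGrad K q) := by
  have hg0 : bcGrad K q ≠ 0 := bcGrad_ne_zero hK hN hq
  have hng : ‖bcGrad K q‖ ≠ 0 := norm_ne_zero_iff.mpr hg0
  have hpos : 0 < ‖bcGrad K q‖ := norm_pos_iff.mpr hg0
  have hbc : ∀ y z, bc K q y - bc K q z = inner ℝ (bcGrad K q) (y - z) := affine_sub _
  have hex : IsOutwardNormal K q (-(‖bcGrad K q‖⁻¹ • bcGrad K q)) := by
    refine ⟨?_, ?_, ?_⟩
    · rw [norm_neg, norm_smul, norm_inv, norm_norm, inv_mul_cancel₀ hng]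
    · intro y hy z hz
      rw [Finset.mem_erase] at hy hz
      rw [inner_neg_left, inner_smul_left, ← hbc, bc_ne hK hq hy.2 hy.1, bc_ne hK hq hz.2 hz.1]
      simp
    · intro y hy
      rw [Finset.mem_erase] at hy
      rw [inner_neg_left, inner_smul_left, ← hbc, bc_ne hK hq hy.2 hy.1, bc_self hK hq]
      simpa using hpos
  have hun : ∀ n, IsOutwardNormal K q n → n = -(‖bcGrad K q‖⁻¹ • bcGrad K q) := by
    rintro n ⟨h1, h2, h3⟩
    obtain ⟨p, hp, hpq⟩ := exists_ne_mem hK hN q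
    have hpe : p ∈ K.erase q := Finset.mem_erase.mpr ⟨hpq, hp⟩
    set a := inner ℝ n (p - q) with ha
    have ha0 : 0 < a := h3 p hpe
    have hlin : ∀ y, inner ℝ n (y - p) = -a * bc K q y := by
      let f : E N →ᵃ[ℝ] ℝ :=
        ((innerSL ℝ n).toLinearMap.toAffineMap) - AffineMap.const ℝ _ (inner ℝ n p)
      have hf : ∀ y, f y = inner ℝ n (y - p) := fun y => by simp [f, inner_sub_right]
      intro y
      have : f = (-a) • bc K q := by
        refine affine_ext hK fun r hr => ?_
        rw [hf]
        simp only [AffineMap.coe_smul, Pi.smul_apply, smul_eq_mul]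
        by_cases hrq : r = q
        · rw [hrq, bc_self hK hq, ha, ← neg_sub p q, inner_neg_right]; ring
        · rw [bc_ne hK hq hr hrq, h2 r (Finset.mem_erase.mpr ⟨hrq, hr⟩) p hpe]; ring
      rw [← hf, this]; simp
    have hn : n = (-a) • bcGrad K q := by
      refine ext_inner_right ℝ fun y => ?_
      have e1 := hlin (y + p)
      rw [add_sub_cancel_right] at e1
      have e2 := hbc (y + p) p
      rw [add_sub_cancel_right, bc_ne hK hq hp hpq, sub_zero] at e2
      rw [e1, e2, inner_smul_left]; simp
    have hna : a * ‖bcGrad K q‖ = 1 := by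
      rw [hn, norm_smul, norm_neg, Real.norm_of_nonneg ha0.le] at h1; exact h1
    rw [hn, neg_smul, eq_inv_of_mul_eq_one_left hna]
  have hexx : ∃ n, IsOutwardNormal K q n := ⟨_, hex⟩
  rw [outwardNormal, dif_pos hexx]
  exact hun _ hexx.choose_spec

/-- A ball in a simplex bounds the gradients of the barycentric coordinates. -/
lemma norm_bcGrad_le (hK : IsSimplex K) {q x : E N} {ρ : ℝ} (hρ : 0 < ρ) (hq : q ∈ K)
    (hball : Metric.closedBall x ρ ⊆ hull K) : ‖bcGrad K q‖ * ρ ≤ 1 := by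
  by_cases hg : bcGrad K q = 0
  · simp [hg]
  have hng : ‖bcGrad K q‖ ≠ 0 := norm_ne_zero_iff.mpr hg
  -- Moving from the centre of the ball a distance `ρ` up the gradient raises `bc K q` by `‖bcGrad K
  -- q‖ ρ`, while its values on `K` stay in `[0, 1]`.
  set y := x + (ρ * ‖bcGrad K q‖⁻¹) • bcGrad K q with hy
  have hyb : y ∈ Metric.closedBall x ρ := by
    rw [mem_closedBall_iff_norm, hy, add_sub_cancel_left, norm_smul, norm_mul, norm_inv, norm_norm,
      mul_assoc, inv_mul_cancel₀ hng, mul_one, Real.norm_of_nonneg hρ.le]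
  have h1 : bc K q y - bc K q x = inner ℝ (bcGrad K q) (y - x) := affine_sub _ _ _
  have h2 : inner ℝ (bcGrad K q) (y - x) = ‖bcGrad K q‖ * ρ := by
    rw [hy, add_sub_cancel_left, inner_smul_right, real_inner_self_eq_norm_sq]
    field_simp
  have h3 := bc_le_one hK hq (hball hyb)
  have h4 := (mem_hull_iff hK).mp (hball (Metric.mem_closedBall_self hρ.le)) q hq
  linarith

/-- The coordinate drops from `1` to `0` between two vertices, whose distance is at most the
diameter. -/
lemma one_le_norm_bcGrad_mul_diam (hK : IsSimplex K) (hN : 0 < N) {q : E N} (hq : q ∈ K) :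
    1 ≤ ‖bcGrad K q‖ * Metric.diam (hull K) := by
  obtain ⟨p, hp, hpq⟩ := exists_ne_mem hK hN q
  have h1 : bc K q q - bc K q p = inner ℝ (bcGrad K q) (q - p) := affine_sub _ _ _
  rw [bc_self hK hq, bc_ne hK hq hp hpq, sub_zero] at h1
  rw [h1]
  refine (real_inner_le_norm _ _).trans (mul_le_mul_of_nonneg_left ?_ (norm_nonneg _))
  rw [← dist_eq_norm]
  exact Metric.dist_le_diam_of_mem (isCompact_hull K).isBounded
    (subset_convexHull ℝ _ hq) (subset_convexHull ℝ _ hp)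

end

/-! ### Two elements sharing a facet, and the reflection argument for half-space moments -/

section

variable {N : ℕ}

/-! ### Neighbouring elements -/

lemma SimplicialMesh.isSimplex {T : SimplicialMesh N} {K : Finset (E N)} (hK : K ∈ T.elements) :
    IsSimplex K := by
  simp only [SimplicialMesh.elements, Finset.mem_filter, Set.Finite.mem_toFinset] at hK
  exact ⟨T.complex.indep hK.1, hK.2⟩

lemma SimplicialMesh.mem_faces {T : SimplicialMesh N} {K : Finset (E N)} (hK : K ∈ T.elements) :
    K ∈ T.complex.faces := by
  simp only [SimplicialMesh.elements, Finset.mem_filter, Set.Finite.mem_toFinset] at hK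
  exact hK.1

lemma SimplicialMesh.interior_hull_subset {T : SimplicialMesh N} {K : Finset (E N)}
    (hK : K ∈ T.elements) : interior (hull K) ⊆ T.domain :=
  interior_mono (Geometry.SimplicialComplex.convexHull_subset_space (SimplicialMesh.mem_faces hK))

/-- A simplex sharing the facet of `K` opposite to `q` has exactly one further vertex. -/
lemma exists_opposite {K K' : Finset (E N)} (hc : K.card = N + 1) (hc' : K'.card = N + 1)
    {q : E N} (hq : q ∈ K) (hne : K' ≠ K) (hsub : K.erase q ⊆ K') :
    ∃ q' ∈ K', q' ∉ K ∧ q ∉ K' ∧ K'.erase q' = K.erase q := by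
  have hqK' : q ∉ K' := by
    intro h
    have : K ⊆ K' := by
      rw [← Finset.insert_erase hq]
      exact Finset.insert_subset h hsub
    exact hne (Finset.eq_of_subset_of_card_le this (by omega)).symm
  have hcard : (K' \ K.erase q).card = 1 := by
    rw [Finset.card_sdiff_of_subset hsub, Finset.card_erase_of_mem hq]; omega
  obtain ⟨q', hq'⟩ := Finset.card_eq_one.mp hcard
  have hmem : q' ∈ K' \ K.erase q := by rw [hq']; simp
  rw [Finset.mem_sdiff] at hmem
  refine ⟨q', hmem.1, ?_, hqK', ?_⟩
  · intro h
    refine hmem.2 (Finset.mem_erase.mpr ⟨?_, h⟩)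
    rintro rfl
    exact hqK' hmem.1
  · rw [Finset.erase_eq, ← hq', Finset.sdiff_sdiff_eq_self hsub]

/-- `K` and `K'` are distinct elements of the mesh that share the facet opposite to `q` in `K`
and to `q'` in `K'`. -/
structure SharesFacet (T : SimplicialMesh N) (K K' : Finset (E N)) (q q' : E N) : Prop where
  mem : K ∈ T.elements
  mem' : K' ∈ T.elements
  apex : q ∈ K
  apex' : q' ∈ K'
  notMem : q' ∉ K
  notMem' : q ∉ K'
  erase_eq : K'.erase q' = K.erase q

namespace SharesFacet

variable {T : SimplicialMesh N} {K K' : Finset (E N)} {q q' : E N}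

lemma symm (h : SharesFacet T K K' q q') : SharesFacet T K' K q' q :=
  ⟨h.mem', h.mem, h.apex', h.apex, h.notMem', h.notMem, h.erase_eq.symm⟩

/-- Both coordinates vanish on the common facet, so as affine functions they are proportional. -/
lemma bc_eq (h : SharesFacet T K K' q q') : bc K' q' = bc K' q' q • bc K q := by
  have hK := SimplicialMesh.isSimplex h.mem
  have hK' := SimplicialMesh.isSimplex h.mem'
  refine affine_ext hK fun r hr => ?_
  simp only [AffineMap.coe_smul, Pi.smul_apply, smul_eq_mul]
  by_cases hrq : r = q
  · rw [hrq, bc_self hK h.apex, mul_one]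
  · have : r ∈ K'.erase q' := by rw [h.erase_eq]; exact Finset.mem_erase.mpr ⟨hrq, hr⟩
    rw [Finset.mem_erase] at this
    rw [bc_ne hK h.apex hr hrq, bc_ne hK' h.apex' this.2 this.1, mul_zero]

lemma facet_nonempty (h : SharesFacet T K K' q q') (hN : 0 < N) : (K.erase q).Nonempty := by
  rw [← Finset.card_pos, Finset.card_erase_of_mem h.apex, (SimplicialMesh.isSimplex h.mem).2]
  omega

lemma bc_facet_centroid (h : SharesFacet T K K' q q') (hN : 0 < N) {p : E N} (hp : p ∈ K.erase q) :
    0 < bc K p ((K.erase q).centroid ℝ id) := by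
  have hK := SimplicialMesh.isSimplex h.mem
  have hF := h.facet_nonempty hN
  have h1 := Finset.sum_centroidWeights_eq_one_of_nonempty ℝ _ hF
  have hpK := Finset.mem_of_mem_erase hp
  rw [Finset.centroid, Finset.map_affineCombination _ _ _ h1,
    Finset.affineCombination_eq_linear_combination _ _ _ h1]
  rw [Finset.sum_eq_single_of_mem p hp]
  · have := hF.card_pos
    simp only [Finset.centroidWeights_apply, Function.comp_apply, id, bc_self hK hpK]
    positivity
  · intro r hr hrp
    simp [bc_ne hK hpK (Finset.mem_of_mem_erase hr) hrp]

lemma bc_apex_facet_centroid (h : SharesFacet T K K' q q') (hN : 0 < N) :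
    bc K q ((K.erase q).centroid ℝ id) = 0 := by
  have hK := SimplicialMesh.isSimplex h.mem
  refine ((mem_facet_iff hK h.apex).mp ?_).2
  exact Finset.centroid_mem_convexHull _ (h.facet_nonempty hN)

lemma eventually_pos (h : SharesFacet T K K' q q') (hN : 0 < N) :
    ∀ᶠ x in nhds ((K.erase q).centroid ℝ id), ∀ p ∈ K.erase q, 0 < bc K p x := by
  rw [Filter.eventually_all_finset]
  intro p hp
  exact (continuous_bc K p).continuousAt.eventually (lt_mem_nhds (h.bc_facet_centroid hN hp))

/-- The two elements lie on opposite sides of the common facet. Otherwise a point just off the facet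
centroid towards `q` would belong to both, hence to the hull of their common vertices, which lies in
the facet; but `bc K q` is positive there. -/
lemma bc_neg (h : SharesFacet T K K' q q') (hN : 0 < N) : bc K' q' q < 0 := by
  have hK := SimplicialMesh.isSimplex h.mem
  have hK' := SimplicialMesh.isSimplex h.mem'
  by_contra! ha
  set m := (K.erase q).centroid ℝ id with hm
  have h1 := h.eventually_pos hN
  have h2 := h.symm.eventually_pos hN
  rw [h.erase_eq] at h2
  have hlim : Filter.Tendsto (fun ε : ℝ => AffineMap.lineMap m q ε) (nhdsWithin 0 (Set.Ioi 0))
      (nhds m) := by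
    have hc : Continuous (fun ε : ℝ => (AffineMap.lineMap m q ε : E N)) := by
      simp only [AffineMap.lineMap_apply]; fun_prop
    have := hc.tendsto 0
    simp only [AffineMap.lineMap_apply_zero] at this
    exact this.mono_left nhdsWithin_le_nhds
  obtain ⟨ε, hε, he1, he2⟩ := ((eventually_mem_nhdsWithin (a := (0 : ℝ)) (s := Set.Ioi 0)).and
    ((hlim.eventually h1).and (hlim.eventually h2))).exists
  simp only [Set.mem_Ioi] at hε
  set x := (AffineMap.lineMap m q ε : E N) with hx
  have hxq : bc K q x = ε := by
    rw [hx, AffineMap.apply_lineMap, h.bc_apex_facet_centroid hN, bc_self hK h.apex]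
    simp [AffineMap.lineMap_apply]
  have hxK : x ∈ hull K := by
    rw [mem_hull_iff hK]
    intro p hp
    by_cases hpq : p = q
    · rw [hpq, hxq]; exact hε.le
    · exact (he1 p (Finset.mem_erase.mpr ⟨hpq, hp⟩)).le
  have hxK' : x ∈ hull K' := by
    rw [mem_hull_iff hK']
    intro p hp
    by_cases hpq : p = q'
    · rw [hpq, h.bc_eq]
      simp only [AffineMap.coe_smul, Pi.smul_apply, smul_eq_mul, hxq]
      positivity
    · refine (he2 p ?_).le
      rw [← h.erase_eq]
      exact Finset.mem_erase.mpr ⟨hpq, hp⟩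
  have hxF := T.complex.inter_subset_convexHull (SimplicialMesh.mem_faces h.mem)
    (SimplicialMesh.mem_faces h.mem') ⟨hxK, hxK'⟩
  have hsub : ((K : Set (E N)) ∩ K') ⊆ (K.erase q : Finset (E N)) := by
    rintro p ⟨hp, hp'⟩
    refine Finset.mem_coe.mpr (Finset.mem_erase.mpr ⟨?_, hp⟩)
    rintro rfl
    exact h.notMem' hp'
  have := ((mem_facet_iff hK h.apex).mp (convexHull_mono hsub hxF)).2
  linarith

/-- At most two elements share a facet. -/
lemma unique (h : SharesFacet T K K' q q') (hN : 0 < N) {K'' : Finset (E N)} {q'' : E N}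
    (h' : SharesFacet T K K'' q q'') : K'' = K' := by
  by_contra hne
  obtain ⟨r, hr, -, -, -⟩ := exists_opposite (K := K') (K' := K'') (q := q')
    (SimplicialMesh.isSimplex h.mem').2
    (SimplicialMesh.isSimplex h'.mem').2 h.apex' hne (by
      rw [h.erase_eq, ← h'.erase_eq]; exact Finset.erase_subset _ _)
  -- Three elements on one facet would lie pairwise on opposite sides: the factor here is a product
  -- of two negative numbers, whereas `bc_neg` for `K'`, `K''` makes it negative.
  have h1 : bc K'' q'' = (bc K'' q'' q * bc K q q') • bc K' q' := by
    conv_lhs => rw [h'.bc_eq, h.symm.bc_eq]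
    rw [smul_smul]
  have hqne : q'' ∉ K' := by
    intro hq
    have : q'' ∉ K'.erase q' := by rw [h.erase_eq, ← h'.erase_eq]; simp
    have hqq : q'' = q' := by
      by_contra hcon
      exact this (Finset.mem_erase.mpr ⟨hcon, hq⟩)
    refine hne ?_
    rw [← Finset.insert_erase h'.apex', ← Finset.insert_erase h.apex', h.erase_eq, h'.erase_eq, hqq]
  have hqne' : q' ∉ K'' := by
    intro hq
    have : q' ∉ K''.erase q'' := by rw [h'.erase_eq, ← h.erase_eq]; simp
    have hqq : q'' = q' := by
      by_contra hcon
      exact this (Finset.mem_erase.mpr ⟨Ne.symm hcon, hq⟩)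
    exact hqne (hqq ▸ h.apex')
  have hs : SharesFacet T K' K'' q' q'' :=
    ⟨h.mem', h'.mem', h.apex', h'.apex', hqne, hqne', by rw [h.erase_eq, h'.erase_eq]⟩
  have h2 := hs.bc_neg hN
  have h3 := h'.bc_neg hN
  have h4 := h.symm.bc_neg hN
  rw [h1] at h2
  simp only [AffineMap.coe_smul, Pi.smul_apply, smul_eq_mul,
    bc_self (SimplicialMesh.isSimplex h.mem') h.apex', mul_one] at h2
  nlinarith

lemma bcGrad_eq (h : SharesFacet T K K' q q') : bcGrad K' q' = bc K' q' q • bcGrad K q := by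
  refine ext_inner_right ℝ fun y => ?_
  rw [inner_smul_left, bcGrad, bcGrad, inner_affGrad, inner_affGrad]
  conv_lhs => rw [h.bc_eq]
  simp

lemma outwardNormal_neg (h : SharesFacet T K K' q q') (hN : 0 < N) :
    outwardNormal K' q' = -outwardNormal K q := by
  have ha := h.bc_neg hN
  rw [outwardNormal_eq (SimplicialMesh.isSimplex h.mem) hN h.apex,
    outwardNormal_eq (SimplicialMesh.isSimplex h.mem') hN h.apex', h.bcGrad_eq, norm_smul,
    Real.norm_of_nonpos ha.le, smul_smul, mul_inv, neg_neg, mul_comm, ← mul_assoc]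
  rw [inv_neg, mul_neg, mul_inv_cancel₀ ha.ne]
  simp

/-- Near the centroid of a shared facet, the two simplices fill the whole space. -/
lemma exists_ball (h : SharesFacet T K K' q q') (hN : 0 < N) :
    ∃ r > 0, Metric.ball ((K.erase q).centroid ℝ id) r ⊆ T.domain ∧
      ∀ x ∈ Metric.ball ((K.erase q).centroid ℝ id) r,
        (0 < bc K q x → x ∈ interior (hull K)) ∧ (bc K q x < 0 → x ∈ interior (hull K')) := by
  have hK := SimplicialMesh.isSimplex h.mem
  have hK' := SimplicialMesh.isSimplex h.mem'
  set m := (K.erase q).centroid ℝ id with hm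
  have h1 := h.eventually_pos hN
  have h2 := h.symm.eventually_pos hN
  rw [h.erase_eq] at h2
  obtain ⟨r, hr, hball⟩ := Metric.eventually_nhds_iff_ball.mp (h1.and h2)
  have hbc' : ∀ x, bc K' q' x = bc K' q' q * bc K q x := fun x => by
    conv_lhs => rw [h.bc_eq]
    simp
  have ha := h.bc_neg hN
  refine ⟨r, hr, ?_, ?_⟩
  · refine interior_maximal (fun x hx => ?_) Metric.isOpen_ball
    obtain ⟨hx1, hx2⟩ := hball x hx
    rcases le_total 0 (bc K q x) with hx0 | hx0
    · refine Geometry.SimplicialComplex.convexHull_subset_space (SimplicialMesh.mem_faces h.mem)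
        ((mem_hull_iff hK).mpr fun p hp => ?_)
      by_cases hpq : p = q
      · rwa [hpq]
      · exact (hx1 p (Finset.mem_erase.mpr ⟨hpq, hp⟩)).le
    · refine Geometry.SimplicialComplex.convexHull_subset_space (SimplicialMesh.mem_faces h.mem')
        ((mem_hull_iff hK').mpr fun p hp => ?_)
      by_cases hpq : p = q'
      · rw [hpq, hbc']; exact mul_nonneg_of_nonpos_of_nonpos ha.le hx0
      · refine (hx2 p ?_).le
        rw [← h.erase_eq]
        exact Finset.mem_erase.mpr ⟨hpq, hp⟩
  · intro x hx
    obtain ⟨hx1, hx2⟩ := hball x hx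
    refine ⟨fun hx0 => (mem_interior_hull_iff hK).mpr fun p hp => ?_,
      fun hx0 => (mem_interior_hull_iff hK').mpr fun p hp => ?_⟩
    · by_cases hpq : p = q
      · rwa [hpq]
      · exact hx1 p (Finset.mem_erase.mpr ⟨hpq, hp⟩)
    · by_cases hpq : p = q'
      · rw [hpq, hbc']; exact mul_pos_of_neg_of_neg ha hx0
      · refine hx2 p ?_
        rw [← h.erase_eq]
        exact Finset.mem_erase.mpr ⟨hpq, hp⟩

end SharesFacet

/-! ### Half-space moments of radial weights -/

/-- The reflection fixing the line of `g` preserves the half-space and the radial weight, so `b` may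
be replaced by `b + R b`, a multiple of `g`. The moment of `g` itself is positive, which forces the
multiple to vanish. -/
lemma inner_eq_zero_of_half_moment {W : E N → ℝ} (hc : Continuous W) (hs : HasCompactSupport W)
    (hnonneg : ∀ y, 0 ≤ W y) (h0 : 0 < W 0) (hrad : ∀ x y, ‖x‖ = ‖y‖ → W x = W y)
    {g b : E N} (hint : ∫ y in {y | 0 < inner ℝ g y}, W y * inner ℝ b y = 0) :
    inner ℝ b g = 0 := by
  by_cases hg : g = 0
  · simp [hg]
  have hmeas : MeasurableSet {y : E N | 0 < inner ℝ g y} :=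
    measurableSet_lt measurable_const (by fun_prop)
  have hcont : ∀ v : E N, Continuous fun y => W y * inner ℝ v y := fun v => by fun_prop
  have hInt : ∀ v : E N, Integrable fun y => W y * inner ℝ v y := fun v =>
    (hcont v).integrable_of_hasCompactSupport hs.mul_right
  let R : E N ≃ₗᵢ[ℝ] E N := (ℝ ∙ g).reflection
  have hRg : R g = g := Submodule.reflection_mem_subspace_eq_self (Submodule.mem_span_singleton_self g)
  have hsymm : ∀ x y : E N, inner ℝ x (R y) = inner ℝ (R x) y := fun x y => by
    rw [← R.inner_map_map x (R y)]
    simp [R, Submodule.reflection_reflection]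
  have hR : ∫ y in {y | 0 < inner ℝ g y}, W y * inner ℝ (R b) y = 0 := by
    have hpre : R ⁻¹' {y | 0 < inner ℝ g y} = {y | 0 < inner ℝ g y} := by
      ext y
      simp only [Set.mem_preimage, Set.mem_ofPred_eq]
      rw [hsymm, hRg]
    have := (R.measurePreserving).setIntegral_preimage_emb
      R.toHomeomorph.measurableEmbedding (fun y => W y * inner ℝ b y) {y | 0 < inner ℝ g y}
    rw [hint, hpre] at this
    refine Eq.trans ?_ this
    refine integral_congr_ae (Filter.Eventually.of_forall fun y => ?_)
    simp only
    rw [hsymm, hrad (R y) y (R.norm_map y)]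
  have hsum : ∫ y in {y | 0 < inner ℝ g y}, W y * inner ℝ (b + R b) y = 0 := by
    simp only [inner_add_left, mul_add]
    rw [integral_add (hInt b).integrableOn (hInt (R b)).integrableOn, hint, hR, add_zero]
  have hbR : b + R b = (2 * (inner ℝ g b / ‖g‖ ^ 2)) • g := by
    have : R b = 2 • (ℝ ∙ g).starProjection b - b := Submodule.reflection_apply b
    rw [this, Submodule.starProjection_singleton, two_nsmul, mul_smul, two_smul]
    simp
  rw [hbR] at hsum
  have hpull : ∀ y, W y * inner ℝ ((2 * (inner ℝ g b / ‖g‖ ^ 2)) • g) y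
      = (2 * (inner ℝ g b / ‖g‖ ^ 2)) * (W y * inner ℝ g y) := fun y => by
    rw [inner_smul_left]; simp; ring
  simp only [hpull] at hsum
  rw [integral_const_mul] at hsum
  have hpos : 0 < ∫ y in {y | 0 < inner ℝ g y}, W y * inner ℝ g y := by
    have heq : ∫ y in {y | 0 < inner ℝ g y}, W y * inner ℝ g y
        = ∫ y, W y * max (inner ℝ g y) 0 := by
      rw [← integral_indicator hmeas]
      refine integral_congr_ae (Filter.Eventually.of_forall fun y => ?_)
      by_cases hy : 0 < inner ℝ g y
      · simp [Set.indicator, hy, max_eq_left hy.le]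
      · simp [Set.indicator, hy, max_eq_right (not_lt.mp hy)]
    rw [heq]
    have hev : ∀ᶠ t : ℝ in nhdsWithin 0 (Set.Ioi 0), 0 < W (t • g) := by
      have hct : Continuous fun t : ℝ => W (t • g) := by fun_prop
      have := hct.tendsto 0
      rw [zero_smul] at this
      exact (this.eventually (lt_mem_nhds h0)).filter_mono nhdsWithin_le_nhds
    obtain ⟨t, ht, hWt⟩ :=
      ((eventually_mem_nhdsWithin (a := (0 : ℝ)) (s := Set.Ioi 0)).and hev).exists
    refine Continuous.integral_pos_of_hasCompactSupport_nonneg_nonzero (x := t • g) (by fun_prop)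
      hs.mul_right (fun y => mul_nonneg (hnonneg y) (le_max_right _ _)) ?_
    have hgt : 0 < inner ℝ g (t • g) := by
      rw [inner_smul_right, real_inner_self_eq_norm_sq]
      have : 0 < ‖g‖ := norm_pos_iff.mpr hg
      have ht' : 0 < t := ht
      positivity
    rw [max_eq_left hgt.le]
    positivity
  have h2 := (mul_eq_zero.mp hsum).resolve_right hpos.ne'
  have hng : ‖g‖ ^ 2 ≠ 0 := pow_ne_zero _ (norm_ne_zero_iff.mpr hg)
  rw [real_inner_comm]
  field_simp at h2
  linarith

end

section

variable {N L : ℕ}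

/-! ### Continuity of the normal component of a divergence-free field -/

/-- A radial bump weight supported in the ball of radius `ρ`. -/
def bumpWeight (ρ : ℝ) (y : E N) : ℝ :=
  (ρ ^ 2 - ‖y‖ ^ 2)⁻¹ ^ 2 * expNegInvGlue (ρ ^ 2 - ‖y‖ ^ 2)

lemma continuous_bumpWeight (ρ : ℝ) : Continuous (bumpWeight (N := N) ρ) := by
  have h := expNegInvGlue.continuous_polynomial_eval_inv_mul (Polynomial.X ^ 2)
  simp only [Polynomial.eval_pow, Polynomial.eval_X] at h
  exact h.comp (by fun_prop : Continuous fun y : E N => ρ ^ 2 - ‖y‖ ^ 2)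

lemma bumpWeight_nonneg (ρ : ℝ) (y : E N) : 0 ≤ bumpWeight ρ y :=
  mul_nonneg (sq_nonneg _) (expNegInvGlue.nonneg _)

lemma bumpWeight_zero_pos {ρ : ℝ} (hρ : 0 < ρ) : 0 < bumpWeight (N := N) ρ 0 := by
  have : 0 < ρ ^ 2 - ‖(0 : E N)‖ ^ 2 := by simp; positivity
  have h2 := expNegInvGlue.pos_of_pos this
  rw [bumpWeight]
  positivity

lemma bumpWeight_eq_zero {ρ : ℝ} (hρ : 0 < ρ) {y : E N} (hy : ρ ≤ ‖y‖) : bumpWeight ρ y = 0 := by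
  rw [bumpWeight, expNegInvGlue.zero_of_nonpos, mul_zero]
  nlinarith

lemma hasCompactSupport_bumpWeight {ρ : ℝ} (hρ : 0 < ρ) :
    HasCompactSupport (bumpWeight (N := N) ρ) := by
  refine HasCompactSupport.intro (isCompact_closedBall (0 : E N) ρ) fun y hy => ?_
  rw [mem_closedBall_zero_iff, not_le] at hy
  exact bumpWeight_eq_zero hρ hy.le

/-- A radial bump function about `m`. -/
def radialBump (m : E N) (ρ : ℝ) (x : E N) : ℝ := expNegInvGlue (ρ ^ 2 - ‖x - m‖ ^ 2)

lemma contDiff_radialBump (m : E N) (ρ : ℝ) : ContDiff ℝ ∞ (radialBump m ρ) :=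
  expNegInvGlue.contDiff.comp (contDiff_const.sub ((contDiff_id.sub contDiff_const).norm_sq ℝ))

lemma radialBump_eq_zero (m : E N) {ρ : ℝ} (hρ : 0 < ρ) {x : E N}
    (hx : x ∉ Metric.closedBall m ρ) : radialBump m ρ x = 0 := by
  rw [mem_closedBall_iff_norm, not_le] at hx
  rw [radialBump, expNegInvGlue.zero_of_nonpos]
  nlinarith

lemma tsupport_radialBump (m : E N) {ρ : ℝ} (hρ : 0 < ρ) :
    tsupport (radialBump m ρ) ⊆ Metric.closedBall m ρ := by
  refine closure_minimal (fun x hx => ?_) Metric.isClosed_closedBall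
  by_contra h
  exact hx (radialBump_eq_zero m hρ h)

lemma gradient_radialBump (m : E N) (ρ : ℝ) (x : E N) :
    ∇ (radialBump m ρ) x = (-2 * bumpWeight ρ (x - m)) • (x - m) := by
  refine HasGradientAt.gradient ?_
  rw [hasGradientAt_iff_hasFDerivAt]
  -- The derivative of `exp(-1/s)` is `s⁻² exp(-1/s)`, which is where the factor in `bumpWeight`
  -- comes from.
  have h1 := expNegInvGlue.hasDerivAt_polynomial_eval_inv_mul 1 (ρ ^ 2 - ‖x - m‖ ^ 2)
  simp only [Polynomial.eval_one, one_mul, Polynomial.derivative_one, sub_zero, mul_one,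
    Polynomial.eval_pow, Polynomial.eval_X] at h1
  have h2 : HasFDerivAt (fun x : E N => ρ ^ 2 - ‖x - m‖ ^ 2) (-(2 • innerSL ℝ (x - m))) x := by
    have := ((hasFDerivAt_id x).sub_const m).norm_sq.const_sub (ρ ^ 2)
    simpa using this
  have h3 := h1.comp_hasFDerivAt x h2
  refine h3.congr_fderiv ?_
  ext y
  simp [bumpWeight]
  ring

namespace Setting

variable {Q : Setting N L} {γ Λ c : ℝ}

/-- The gradient of a radial bump about the facet centroid `m` is `-2 W(x - m) (x - m)`. Tested with
it, the divergence condition becomes a half-space moment of the jump of the coefficients, and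
`inner_eq_zero_of_half_moment` shows that this jump is orthogonal to the facet normal. -/
lemma normal_component_eq (hH : Q.IsHyperbolic γ Λ c) (hN : 0 < N) {K K' : Finset (E N)}
    {q q' : E N} (h : SharesFacet Q.mesh K K' q q') (l k : Fin L) :
    ∑ j, bcGrad K q j * Q.LcOn K j l k = ∑ j, bcGrad K q j * Q.LcOn K' j l k := by
  obtain ⟨r, hr, hdom, hint⟩ := h.exists_ball hN
  set m := (K.erase q).centroid ℝ id with hm
  set g := bcGrad K q with hg
  have hbc : ∀ x, bc K q x = inner ℝ g (x - m) := fun x => by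
    have := affine_sub (bc K q) x m
    rwa [h.bc_apex_facet_centroid hN, sub_zero] at this
  set ρ := r / 2 with hρ
  have hρ0 : 0 < ρ := by positivity
  have hsub : Metric.closedBall m ρ ⊆ Metric.ball m r :=
    Metric.closedBall_subset_ball (by rw [hρ]; linarith)
  have hdiv := hH.div_Lc (radialBump m ρ) (contDiff_radialBump m ρ)
    (HasCompactSupport.of_support_subset_isCompact (isCompact_closedBall m ρ)
      ((subset_tsupport _).trans (tsupport_radialBump m hρ0)))
    ((tsupport_radialBump m hρ0).trans (hsub.trans hdom)) l k
  set W := bumpWeight (N := N) ρ with hW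
  let b : E N := WithLp.toLp 2 fun j => Q.LcOn K j l k - Q.LcOn K' j l k
  let β : E N := WithLp.toLp 2 fun j => Q.LcOn K' j l k
  have hinner : ∀ y : E N, inner ℝ b y = ∑ j, y j * (Q.LcOn K j l k - Q.LcOn K' j l k) := fun y => by
    simp [b, PiLp.inner_apply]
  have hinner' : ∀ y : E N, inner ℝ β y = ∑ j, y j * Q.LcOn K' j l k := fun y => by
    simp [β, PiLp.inner_apply]
  have hg0 : g ≠ 0 := bcGrad_ne_zero (SimplicialMesh.isSimplex h.mem) hN h.apex
  have hmeas : MeasurableSet {y : E N | 0 < inner ℝ g y} :=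
    measurableSet_lt measurable_const (by fun_prop)
  have hInt : ∀ v : E N, Integrable fun y => W y * inner ℝ v y := fun v =>
    Continuous.integrable_of_hasCompactSupport
      ((continuous_bumpWeight ρ).mul (by fun_prop)) (hasCompactSupport_bumpWeight hρ0).mul_right
  have hnull : ∀ᵐ x : E N, inner ℝ g (x - m) ≠ 0 := by
    let S : AffineSubspace ℝ (E N) := AffineSubspace.mk' m (ℝ ∙ g)ᗮ
    have hS : S ≠ ⊤ := by
      intro hS
      have : (g + m) ∈ S := by rw [hS]; trivial
      rw [AffineSubspace.mem_mk', Submodule.mem_orthogonal_singleton_iff_inner_right] at this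
      simp at this
      exact hg0 this
    have h0 := Measure.addHaar_affineSubspace volume S hS
    rw [ae_iff]
    refine measure_mono_null ?_ h0
    intro x hx
    simp only [ne_eq, not_not, Set.mem_ofPred_eq] at hx
    rw [SetLike.mem_coe, AffineSubspace.mem_mk', Submodule.mem_orthogonal_singleton_iff_inner_right]
    exact hx
  -- The field is written as its value `β` on `K'`, extended to both sides, plus the jump `b` on the
  -- side of `K`. The first part drops out below because its integrand is odd.
  have hae : ∀ᵐ x : E N, Q.mesh.domain.indicator
      (fun x => ∑ j, (∇ (radialBump m ρ) x) j * Q.Lc j x l k) x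
      = -2 * (W (x - m) * inner ℝ β (x - m) + {y : E N | 0 < inner ℝ g y}.indicator
          (fun y => W y * inner ℝ b y) (x - m)) := by
    filter_upwards [hnull] with x hx
    by_cases hxb : x ∈ Metric.ball m r
    · rw [Set.indicator_of_mem (hdom hxb), hinner']
      have hgr : ∀ j, (∇ (radialBump m ρ) x) j = -2 * W (x - m) * (x - m) j := fun j => by
        rw [gradient_radialBump]; rfl
      simp only [hgr]
      rcases lt_or_gt_of_ne hx with hx' | hx'
      · rw [Set.indicator_of_notMem (by simpa using hx'.le), add_zero, Finset.mul_sum, Finset.mul_sum]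
        have hxK := (hint x hxb).2 (by rw [hbc]; exact hx')
        refine Finset.sum_congr rfl fun j _ => ?_
        rw [hH.const_Lc K' h.mem' x hxK]; ring
      · rw [Set.indicator_of_mem (by simpa using hx'), hinner, ← mul_add, ← Finset.sum_add_distrib,
          Finset.mul_sum, Finset.mul_sum]
        have hxK := (hint x hxb).1 (by rw [hbc]; exact hx')
        refine Finset.sum_congr rfl fun j _ => ?_
        rw [hH.const_Lc K h.mem x hxK]; ring
    · have hW0 : W (x - m) = 0 := by
        refine bumpWeight_eq_zero hρ0 ?_
        rw [Metric.mem_ball, dist_eq_norm, not_lt] at hxb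
        rw [hρ]; linarith
      have hgr : ∇ (radialBump m ρ) x = 0 := by
        rw [gradient_radialBump, ← hW, hW0]; simp
      simp only [Set.indicator, hgr, hW0]
      simp
  have hdomm : MeasurableSet Q.mesh.domain := isOpen_interior.measurableSet
  rw [← integral_indicator hdomm, integral_congr_ae hae, integral_const_mul,
    integral_sub_right_eq_self (fun y => W y * inner ℝ β y + {y : E N | 0 < inner ℝ g y}.indicator
          (fun y => W y * inner ℝ b y) y) m,
    integral_add (hInt β) ((hInt b).indicator hmeas), integral_indicator hmeas] at hdiv
  have hodd : ∫ y, W y * inner ℝ β y = 0 := by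
    have h1 := integral_neg_eq_self (fun y => W y * inner ℝ β y) volume
    have h2 : ∀ y : E N, W (-y) * inner ℝ β (-y) = -(W y * inner ℝ β y) := fun y => by
      rw [inner_neg_right, hW, bumpWeight, bumpWeight, norm_neg]; ring
    simp only [h2] at h1
    rw [integral_neg] at h1
    linarith
  have hz : ∫ y in {y : E N | 0 < inner ℝ g y}, W y * inner ℝ b y = 0 := by
    rw [hodd] at hdiv; linarith
  have key := inner_eq_zero_of_half_moment (continuous_bumpWeight ρ)
    (hasCompactSupport_bumpWeight hρ0) (bumpWeight_nonneg ρ) (bumpWeight_zero_pos hρ0)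
    (fun x y hxy => by rw [bumpWeight, bumpWeight, hxy]) hz
  rw [hinner] at key
  simp only [mul_sub, Finset.sum_sub_distrib] at key
  linarith

/-- Opposite normals combined with continuity of the normal component: `𝒟` is single-valued on the
facet up to sign, so a contribution symmetric in the two traces cancels between neighbours. -/
lemma Dmat_neg (hH : Q.IsHyperbolic γ Λ c) (hN : 0 < N) {K K' : Finset (E N)}
    {q q' : E N} (h : SharesFacet Q.mesh K K' q q') : Q.Dmat K' q' = -Q.Dmat K q := by
  ext l k
  have h1 := normal_component_eq hH hN h l k
  rw [Dmat, Dmat, h.outwardNormal_neg hN, outwardNormal_eq (SimplicialMesh.isSimplex h.mem) hN h.apex]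
  simp only [Matrix.sum_apply, Matrix.neg_apply, Matrix.smul_apply, PiLp.neg_apply, PiLp.smul_apply,
    smul_eq_mul, neg_mul, neg_neg, mul_assoc, Finset.sum_neg_distrib]
  rw [← Finset.mul_sum, ← Finset.mul_sum, h1]

end Setting

end

/-! ### The case `p = 0`: forms on `V_h` as sums over elements -/

section

variable {N L : ℕ}

namespace Setting

variable {Q : Setting N L}

/-! ### Piecewise constant functions -/

lemma val_zero_eq (w : Q.Vh 0) (K : Finset (E N)) (x : E N) : val w K x = val w K 0 := by
  funext l
  simp only [val]
  split_ifs with h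
  · have h1 : (w ⟨K, h⟩ l : MvPolynomial (Fin N) ℝ).totalDegree ≤ 0 :=
      (MvPolynomial.mem_restrictTotalDegree _ _ _).mp (w ⟨K, h⟩ l).2
    rw [MvPolynomial.totalDegree_eq_zero_iff_eq_C.mp (Nat.le_zero.mp h1)]
    simp
  · rfl

lemma dval_zero_eq (w : Q.Vh 0) (K : Finset (E N)) (j : Fin N) (x : E N) : dval w K j x = 0 := by
  funext l
  simp only [dval]
  split_ifs with h
  · have h1 : (w ⟨K, h⟩ l : MvPolynomial (Fin N) ℝ).totalDegree ≤ 0 :=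
      (MvPolynomial.mem_restrictTotalDegree _ _ _).mp (w ⟨K, h⟩ l).2
    rw [MvPolynomial.totalDegree_eq_zero_iff_eq_C.mp (Nat.le_zero.mp h1)]
    simp
  · rfl

/-- The constant value of `w` on the element `K`. -/
def coef (K : Finset (E N)) : Q.Vh 0 →ₗ[ℝ] (Fin L → ℝ) where
  toFun w := val w K 0
  map_add' w u := by
    funext l
    simp only [val, Pi.add_apply]
    split_ifs <;> simp
  map_smul' r w := by
    funext l
    simp only [val, Pi.smul_apply, RingHom.id_apply]
    split_ifs <;> simp

lemma val_eq_coef (w : Q.Vh 0) (K : Finset (E N)) (x : E N) : val w K x = coef K w :=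
  val_zero_eq w K x

lemma eq_zero_of_coef (w : Q.Vh 0) (h : ∀ K ∈ Q.patch, coef K w = 0) : w = 0 := by
  funext K l
  have h1 := congrFun (h K K.2) l
  have h2 : (w K l : MvPolynomial (Fin N) ℝ).totalDegree ≤ 0 :=
    (MvPolynomial.mem_restrictTotalDegree _ _ _).mp (w K l).2
  have h3 := MvPolynomial.totalDegree_eq_zero_iff_eq_C.mp (Nat.le_zero.mp h2)
  simp only [coef, LinearMap.coe_mk, AddHom.coe_mk, val, K.2, dif_pos] at h1
  rw [h3] at h1
  simp only [MvPolynomial.eval_C, Pi.zero_apply] at h1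
  apply Subtype.ext
  rw [h3, h1]
  simp

/-- The dot product as a bilinear map. -/
def dotB : LinearMap.BilinForm ℝ (Fin L → ℝ) :=
  LinearMap.mk₂ ℝ (fun y z => y ⬝ᵥ z) (fun _ _ _ => add_dotProduct _ _ _)
    (fun _ _ _ => smul_dotProduct _ _ _) (fun _ _ _ => dotProduct_add _ _ _)
    (fun _ _ _ => dotProduct_smul _ _ _)

/-- The bilinear form `∑_K |K| (A_K w, u)` of a piecewise constant matrix field. -/
def matForm (Q : Setting N L) (A : Finset (E N) → Mat L) : LinearMap.BilinForm ℝ (Q.Vh 0) :=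
  ∑ K ∈ Q.patch, (volume (hull K)).toReal •
    (dotB.compl₁₂ ((A K).mulVecLin ∘ₗ coef K) (coef K))

lemma matForm_apply (A : Finset (E N) → Mat L) (w u : Q.Vh 0) :
    Q.matForm A w u
      = ∑ K ∈ Q.patch, (volume (hull K)).toReal * ((A K *ᵥ coef K w) ⬝ᵥ coef K u) := by
  simp [matForm, LinearMap.sum_apply, dotB]

lemma mem_elements {K : Finset (E N)} (hK : K ∈ Q.patch) : K ∈ Q.mesh.elements :=
  (Finset.mem_filter.mp hK).1

lemma vtx_mem {K : Finset (E N)} (hK : K ∈ Q.patch) : Q.vtx ∈ K := (Finset.mem_filter.mp hK).2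

lemma isSimplex_of_mem_patch {K : Finset (E N)} (hK : K ∈ Q.patch) : IsSimplex K :=
  SimplicialMesh.isSimplex (mem_elements hK)

lemma ip_eq (w u : Q.Vh 0) : ip w u = Q.matForm (fun _ => 1) w u := by
  rw [ip, matForm_apply]
  refine Finset.sum_congr rfl fun K _ => ?_
  refine setIntegral_hull_const K fun x _ => ?_
  rw [val_eq_coef, val_eq_coef, one_mulVec]

lemma ip_eq_sum (w u : Q.Vh 0) :
    ip w u = ∑ K ∈ Q.patch, (volume (hull K)).toReal * (coef K w ⬝ᵥ coef K u) := by
  simp [ip_eq, matForm_apply]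

lemma ip_pos (w : Q.Vh 0) (hw : w ≠ 0) : 0 < Q.matForm (fun _ => 1) w w := by
  rw [← ip_eq, ip_eq_sum]
  have hterm : ∀ K ∈ Q.patch, 0 ≤ (volume (hull K)).toReal * (coef K w ⬝ᵥ coef K w) := fun K _ =>
    mul_nonneg ENNReal.toReal_nonneg (dotProduct_self_nonneg' _)
  refine lt_of_le_of_ne (Finset.sum_nonneg hterm) fun h => hw (eq_zero_of_coef w fun K hK => ?_)
  have h1 := (Finset.sum_eq_zero_iff_of_nonneg hterm).mp h.symm K hK
  exact dotProduct_self_eq_zero.mp ((mul_eq_zero.mp h1).resolve_left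
    (volume_hull_pos (isSimplex_of_mem_patch hK)).ne')

lemma matForm_symm {A : Finset (E N) → Mat L} (hA : ∀ K ∈ Q.patch, (A K).IsSymm) (w u : Q.Vh 0) :
    Q.matForm A w u = Q.matForm A u w := by
  rw [matForm_apply, matForm_apply]
  exact Finset.sum_congr rfl fun K hK => by rw [mulVec_dotProduct_comm_of_isSymm (hA K hK)]

lemma ip_comm (w u : Q.Vh 0) : Q.matForm (fun _ => 1) w u = Q.matForm (fun _ => 1) u w :=
  matForm_symm (fun _ _ => Matrix.isSymm_one) w u

/-- `opOf b` represents a bilinear form `b`. -/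
lemma opOf_spec (b : LinearMap.BilinForm ℝ (Q.Vh 0)) {b' : Q.Vh 0 → Q.Vh 0 → ℝ}
    (hb : ∀ w u, b' w u = b w u) (w u : Q.Vh 0) :
    Q.matForm (fun _ => 1) (opOf b' w) u = b w u := by
  have h : ∃ O : Module.End ℝ (Q.Vh 0), ∀ w u, ip (O w) u = b' w u := by
    obtain ⟨O, hO⟩ := exists_operator (Q.matForm (fun _ => 1)) ip_pos b
    exact ⟨O, fun w u => by rw [ip_eq, hO, hb]⟩
  rw [opOf, dif_pos h, ← ip_eq, h.choose_spec, hb]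

lemma ip_ext {w w' : Q.Vh 0}
    (h : ∀ u, Q.matForm (fun _ => 1) w u = Q.matForm (fun _ => 1) w' u) : w = w' := by
  by_contra hne
  have := ip_pos (w - w') (sub_ne_zero.mpr hne)
  simp [h] at this

/-! ### The tent -/

/-- `φ` is affine on every element of the patch. -/
def AffineOnPatch (Q : Setting N L) (φ : E N → ℝ) : Prop :=
  ∀ K ∈ Q.patch, ∃ g : E N →ᵃ[ℝ] ℝ, ∀ x ∈ hull K, φ x = g x

/-- The gradient of `φ` at the centroid of `K`. -/
def gradOn (φ : E N → ℝ) (K : Finset (E N)) : E N := ∇ φ (K.centroid ℝ id)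

lemma AffineOnPatch.gradient_eq {φ : E N → ℝ} (h : Q.AffineOnPatch φ) {K : Finset (E N)}
    (hK : K ∈ Q.patch) {x : E N} (hx : x ∈ interior (hull K)) : ∇ φ x = gradOn φ K := by
  obtain ⟨g, hg⟩ := h K hK
  rw [gradOn, gradient_eq_affGrad hg hx,
    gradient_eq_affGrad hg (centroid_mem_interior (isSimplex_of_mem_patch hK))]

lemma AffineOnPatch.combination {φ ψ : E N → ℝ} (hφ : Q.AffineOnPatch φ) (hψ : Q.AffineOnPatch ψ)
    (a b : ℝ) : Q.AffineOnPatch (fun x => a * φ x + b * ψ x) := by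
  intro K hK
  obtain ⟨f, hf⟩ := hφ K hK
  obtain ⟨g, hg⟩ := hψ K hK
  exact ⟨a • f + b • g, fun x hx => by simp [hf x hx, hg x hx]⟩

lemma gradOn_combination {φ ψ : E N → ℝ} (hφ : Q.AffineOnPatch φ) (hψ : Q.AffineOnPatch ψ)
    (a b : ℝ) {K : Finset (E N)} (hK : K ∈ Q.patch) :
    gradOn (fun x => a * φ x + b * ψ x) K = a • gradOn φ K + b • gradOn ψ K := by
  obtain ⟨f, hf⟩ := hφ K hK
  obtain ⟨g, hg⟩ := hψ K hK
  have hc := centroid_mem_interior (isSimplex_of_mem_patch hK)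
  rw [gradOn, gradOn, gradOn, gradient_eq_affGrad hf hc, gradient_eq_affGrad hg hc,
    gradient_eq_affGrad (f := a • f + b • g) (fun x hx => by simp [hf x hx, hg x hx]) hc]
  refine affGrad_unique _ _ fun y => ?_
  rw [inner_add_left, inner_smul_left, inner_smul_left, inner_affGrad, inner_affGrad]
  simp

/-- `∑ⱼ gⱼ ℒ^j` on the element `K`. -/
def symbolOn (Q : Setting N L) (K : Finset (E N)) (g : E N) : Mat L := ∑ j, g j • Q.LcOn K j

lemma symbolOn_add (K : Finset (E N)) (g h : E N) :
    Q.symbolOn K (g + h) = Q.symbolOn K g + Q.symbolOn K h := by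
  simp [symbolOn, add_smul, Finset.sum_add_distrib]

lemma symbolOn_smul (K : Finset (E N)) (r : ℝ) (g : E N) :
    Q.symbolOn K (r • g) = r • Q.symbolOn K g := by
  simp [symbolOn, Finset.smul_sum, mul_smul]

/-- `𝒢 - ∑ⱼ gⱼ ℒ^j` on the element `K`. -/
def massOn (Q : Setting N L) (K : Finset (E N)) (g : E N) : Mat L :=
  Q.G (K.centroid ℝ id) - Q.symbolOn K g

lemma sum_mulVec_dot {ι : Type*} (s : Finset ι) (A : ι → Mat L) (y z : Fin L → ℝ) :
    ((∑ j ∈ s, A j) *ᵥ y) ⬝ᵥ z = ∑ j ∈ s, (A j *ᵥ y) ⬝ᵥ z := by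
  rw [sum_mulVec, sum_dotProduct]

variable {γ Λ c : ℝ}

lemma m1Form_eq (hH : Q.IsHyperbolic γ Λ c) {φb φt : E N → ℝ} (hb : Q.AffineOnPatch φb)
    (ht : Q.AffineOnPatch φt) (w u : Q.Vh 0) :
    m1Form φb φt w u = Q.matForm (fun K => Q.symbolOn K (gradOn φt K - gradOn φb K)) w u := by
  rw [m1Form, matForm_apply]
  refine Finset.sum_congr rfl fun K hK => ?_
  have hfun : (fun y => φt y - φb y) = fun y => 1 * φt y + (-1) * φb y := by funext y; ring
  have hg : ∀ x ∈ interior (hull K), ∇ (fun y => φt y - φb y) x = gradOn φt K - gradOn φb K := by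
    intro x hx
    rw [hfun, (ht.combination hb 1 (-1)).gradient_eq hK hx, gradOn_combination ht hb 1 (-1) hK]
    simp [sub_eq_add_neg]
  rw [symbolOn, sum_mulVec_dot, Finset.mul_sum]
  refine Finset.sum_congr rfl fun j _ => ?_
  refine setIntegral_hull_const K fun x hx => ?_
  rw [hg x hx, hH.const_Lc K (mem_elements hK) x hx, val_eq_coef, val_eq_coef, smul_mulVec,
    smul_dotProduct, smul_eq_mul]

lemma m0Form_eq (hH : Q.IsHyperbolic γ Λ c) {φb : E N → ℝ} (hb : Q.AffineOnPatch φb)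
    (w u : Q.Vh 0) : m0Form φb w u = Q.matForm (fun K => Q.massOn K (gradOn φb K)) w u := by
  rw [m0Form, matForm_apply]
  refine Finset.sum_congr rfl fun K hK => ?_
  rw [massOn, sub_mulVec, sub_dotProduct, mul_sub, symbolOn, sum_mulVec_dot, Finset.mul_sum]
  congr 1
  · refine setIntegral_hull_const K fun x hx => ?_
    rw [hH.const_G K (mem_elements hK) x hx, val_eq_coef, val_eq_coef]
  · refine Finset.sum_congr rfl fun j _ => ?_
    refine setIntegral_hull_const K fun x hx => ?_
    rw [hb.gradient_eq hK hx, hH.const_Lc K (mem_elements hK) x hx, val_eq_coef, val_eq_coef,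
      smul_mulVec, smul_dotProduct, smul_eq_mul]

lemma centroid_mem_domain {K : Finset (E N)} (hK : K ∈ Q.mesh.elements) :
    K.centroid ℝ id ∈ Q.mesh.domain :=
  SimplicialMesh.interior_hull_subset hK (centroid_mem_interior (SimplicialMesh.isSimplex hK))

lemma isSymm_symbolOn (hH : Q.IsHyperbolic γ Λ c) {K : Finset (E N)} (hK : K ∈ Q.mesh.elements)
    (g : E N) : (Q.symbolOn K g).IsSymm := by
  rw [Matrix.IsSymm, symbolOn, transpose_sum]
  refine Finset.sum_congr rfl fun j _ => ?_
  rw [transpose_smul]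
  congr 1
  exact hH.symm_Lc _ (centroid_mem_domain hK) j

lemma isSymm_Dmat (hH : Q.IsHyperbolic γ Λ c) {K : Finset (E N)} (hK : K ∈ Q.mesh.elements)
    (q : E N) : (Q.Dmat K q).IsSymm := isSymm_symbolOn hH hK (outwardNormal K q)

lemma isSymm_massOn (hH : Q.IsHyperbolic γ Λ c) {K : Finset (E N)} (hK : K ∈ Q.mesh.elements)
    (g : E N) : (Q.massOn K g).IsSymm :=
  (hH.symm_G _ (centroid_mem_domain hK)).sub (isSymm_symbolOn hH hK g)

/-- Causality makes the mass matrices uniformly positive definite. -/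
lemma massOn_coercive (hH : Q.IsHyperbolic γ Λ c) (hγ : 0 < γ) (hc : 0 ≤ c) {chat : ℝ}
    (hchat : c < chat) {K : Finset (E N)} (hK : K ∈ Q.mesh.elements) {g : E N}
    (hg : ‖g‖ ≤ 1 / chat) (y : Fin L → ℝ) :
    (1 - c / chat) * γ * (y ⬝ᵥ y) ≤ (Q.massOn K g *ᵥ y) ⬝ᵥ y := by
  have hx := centroid_mem_domain hK
  set x := K.centroid ℝ id with hxdef
  have hch : 0 < chat := hc.trans_lt hchat
  have hGpos := hH.pos_G x hx
  have hG0 : 0 ≤ (Q.G x *ᵥ y) ⬝ᵥ y := le_trans (by positivity) (hGpos y)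
  have hsym : (Q.symbolOn K g *ᵥ y) ⬝ᵥ y ≤ c / chat * ((Q.G x *ᵥ y) ⬝ᵥ y) := by
    by_cases hg0 : g = 0
    · have : Q.symbolOn K g = 0 := by simp [hg0, symbolOn]
      rw [this]
      simp only [zero_mulVec, zero_dotProduct]
      positivity
    have hng : 0 < ‖g‖ := norm_pos_iff.mpr hg0
    -- Normalising the gradient brings in the wave speed bound for unit directions; the factor `‖g‖
    -- ≤ 1/ĉ` then turns `c` into `c/ĉ < 1`.
    have hdec : Q.symbolOn K g = ‖g‖ • Q.symbol (‖g‖⁻¹ • g) x := by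
      have : Q.symbol (‖g‖⁻¹ • g) x = Q.symbolOn K (‖g‖⁻¹ • g) := rfl
      rw [this, ← symbolOn_smul, smul_smul, mul_inv_cancel₀ hng.ne', one_smul]
    have h1 := pencil_le (D := Q.symbol (‖g‖⁻¹ • g) x) (c := c) hγ (isSymm_symbolOn hH hK _)
      (hH.symm_G x hx) hGpos (fun e lam he hel => (le_abs_self lam).trans
        (hH.wave_speed x hx (‖g‖⁻¹ • g) (by
          rw [norm_smul, norm_inv, norm_norm, inv_mul_cancel₀ hng.ne']) e lam he hel)) y
    rw [hdec, smul_mulVec, smul_dotProduct, smul_eq_mul]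
    calc ‖g‖ * ((Q.symbol (‖g‖⁻¹ • g) x *ᵥ y) ⬝ᵥ y)
        ≤ ‖g‖ * (c * ((Q.G x *ᵥ y) ⬝ᵥ y)) := mul_le_mul_of_nonneg_left h1 hng.le
      _ ≤ 1 / chat * (c * ((Q.G x *ᵥ y) ⬝ᵥ y)) :=
        mul_le_mul_of_nonneg_right hg (mul_nonneg hc hG0)
      _ = _ := by ring
  have h1c : 0 ≤ 1 - c / chat := by
    rw [sub_nonneg, div_le_one hch]; exact hchat.le
  rw [massOn, sub_mulVec, sub_dotProduct]
  have h2 := hGpos y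
  rw [norm2_sq] at h2
  have h3 := mul_le_mul_of_nonneg_left h2 h1c
  nlinarith

end Setting

end

/-! ### Facet estimates: averaging over the facet and the design conditions -/

section

variable {N L : ℕ}

/-! ### Weighted averages of matrix fields -/

section Average

variable {X : Type*} [MeasurableSpace X] {μ : Measure X} {F : Set X} {δ : X → ℝ}
  {S : X → Mat L} {C : ℝ}

lemma abs_entry_le {A : Mat L} (h : ∀ y, norm2 (A *ᵥ y) ≤ C * norm2 y) (i j : Fin L) :
    |A i j| ≤ C := by
  have h1 := h (Pi.single j 1)
  have h2 : norm2 (Pi.single j (1 : ℝ) : Fin L → ℝ) = 1 := by simp [norm2]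
  rw [h2, mul_one, mulVec_single_one] at h1
  refine le_trans (Real.abs_le_sqrt ?_) h1
  rw [sq]
  exact Finset.single_le_sum (f := fun i => A.col j i * A.col j i) (fun i _ => mul_self_nonneg _)
    (Finset.mem_univ i)

/-- The weighted average `∫_F δ S dμ` of a matrix field. -/
def matAvg (μ : Measure X) (F : Set X) (δ : X → ℝ) (S : X → Mat L) : Mat L :=
  Matrix.of fun i j => ∫ x in F, δ x * S x i j ∂μ

lemma integrable_entry (hF : MeasurableSet F) (hδ : IntegrableOn δ F μ)
    (hS : ∀ i j, Measurable fun x => S x i j)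
    (hb : ∀ x ∈ F, ∀ y, norm2 (S x *ᵥ y) ≤ C * norm2 y) (i j : Fin L) :
    IntegrableOn (fun x => δ x * S x i j) F μ := by
  refine Integrable.mul_bdd (c := C) hδ (hS i j).aestronglyMeasurable ?_
  rw [ae_restrict_iff' hF]
  exact Filter.Eventually.of_forall fun x hx => abs_entry_le (hb x hx) i j

lemma integrable_mulVec_dot (hF : MeasurableSet F) (hδ : IntegrableOn δ F μ)
    (hS : ∀ i j, Measurable fun x => S x i j)
    (hb : ∀ x ∈ F, ∀ y, norm2 (S x *ᵥ y) ≤ C * norm2 y) (y z : Fin L → ℝ) :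
    IntegrableOn (fun x => δ x * ((S x *ᵥ y) ⬝ᵥ z)) F μ := by
  have h : (fun x => δ x * ((S x *ᵥ y) ⬝ᵥ z))
      = fun x => ∑ i, ∑ j, (δ x * S x i j) * (y j * z i) := by
    funext x
    simp only [dotProduct, mulVec, Finset.mul_sum, Finset.sum_mul]
    exact Finset.sum_congr rfl fun i _ => Finset.sum_congr rfl fun j _ => by ring
  rw [h]
  exact integrable_finsetSum _ fun i _ => integrable_finsetSum _ fun j _ =>
    (integrable_entry hF hδ hS hb i j).mul_const _

lemma integral_mulVec_dot (hF : MeasurableSet F) (hδ : IntegrableOn δ F μ)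
    (hS : ∀ i j, Measurable fun x => S x i j)
    (hb : ∀ x ∈ F, ∀ y, norm2 (S x *ᵥ y) ≤ C * norm2 y) (y z : Fin L → ℝ) :
    ∫ x in F, δ x * ((S x *ᵥ y) ⬝ᵥ z) ∂μ = (matAvg μ F δ S *ᵥ y) ⬝ᵥ z := by
  have h : (fun x => δ x * ((S x *ᵥ y) ⬝ᵥ z))
      = fun x => ∑ i, ∑ j, (δ x * S x i j) * (y j * z i) := by
    funext x
    simp only [dotProduct, mulVec, Finset.mul_sum, Finset.sum_mul]
    exact Finset.sum_congr rfl fun i _ => Finset.sum_congr rfl fun j _ => by ring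
  have hI := integrable_entry hF hδ hS hb
  rw [h, integral_finsetSum _ fun i _ => integrable_finsetSum _ fun j _ => (hI i j).mul_const _]
  simp only [dotProduct, mulVec, Finset.sum_mul]
  refine Finset.sum_congr rfl fun i _ => ?_
  rw [integral_finsetSum _ fun j _ => (hI i j).mul_const _]
  refine Finset.sum_congr rfl fun j _ => ?_
  rw [integral_mul_const]
  simp only [matAvg, Matrix.of_apply]
  ring

lemma matAvg_nonneg (hF : MeasurableSet F) (hδ : IntegrableOn δ F μ) (hδ0 : ∀ x ∈ F, 0 ≤ δ x)
    (hS : ∀ i j, Measurable fun x => S x i j)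
    (hb : ∀ x ∈ F, ∀ y, norm2 (S x *ᵥ y) ≤ C * norm2 y)
    (h0 : ∀ x ∈ F, ∀ y, 0 ≤ (S x *ᵥ y) ⬝ᵥ y) (y : Fin L → ℝ) :
    0 ≤ (matAvg μ F δ S *ᵥ y) ⬝ᵥ y := by
  rw [← integral_mulVec_dot hF hδ hS hb]
  exact setIntegral_nonneg hF fun x hx => mul_nonneg (hδ0 x hx) (h0 x hx y)

/-- Averaging a pointwise bound on the dissipative part of a flux. -/
lemma avg_bound (hF : MeasurableSet F) (hδ : IntegrableOn δ F μ) (hδ0 : ∀ x ∈ F, 0 ≤ δ x)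
    (hS : ∀ i j, Measurable fun x => S x i j)
    (hb : ∀ x ∈ F, ∀ y, norm2 (S x *ᵥ y) ≤ C * norm2 y) {C₂ : ℝ} (D : Mat L) (r : ℝ)
    (h : ∀ x ∈ F, ∀ y u, (1 / 2) * ((D *ᵥ y) ⬝ᵥ u) - r * ((S x *ᵥ y) ⬝ᵥ u)
      ≤ C₂ * (norm2 u * matSeminorm (S x) y))
    (h0 : ∀ x ∈ F, ∀ y, 0 ≤ (S x *ᵥ y) ⬝ᵥ y) {lam : ℝ} (hlam : 0 < lam) (y u : Fin L → ℝ) :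
    (1 / 2) * ((∫ x in F, δ x ∂μ) * ((D *ᵥ y) ⬝ᵥ u)) - r * ((matAvg μ F δ S *ᵥ y) ⬝ᵥ u)
      ≤ 1 / 2 * (lam * ((matAvg μ F δ S *ᵥ y) ⬝ᵥ y)
        + C₂ ^ 2 / lam * ((∫ x in F, δ x ∂μ) * (u ⬝ᵥ u))) := by
  have e1 := integral_mulVec_dot hF hδ hS hb y u
  have e2 := integral_mulVec_dot hF hδ hS hb y y
  have i1 := integrable_mulVec_dot hF hδ hS hb y u
  have i2 := integrable_mulVec_dot hF hδ hS hb y y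
  have hl : (1 / 2) * ((∫ x in F, δ x ∂μ) * ((D *ᵥ y) ⬝ᵥ u)) - r * ((matAvg μ F δ S *ᵥ y) ⬝ᵥ u)
      = ∫ x in F, (δ x * ((1 / 2) * ((D *ᵥ y) ⬝ᵥ u)) - r * (δ x * ((S x *ᵥ y) ⬝ᵥ u))) ∂μ := by
    rw [integral_sub (hδ.mul_const _) (i1.const_mul r), integral_mul_const, integral_const_mul, e1]
    ring
  have hr : 1 / 2 * (lam * ((matAvg μ F δ S *ᵥ y) ⬝ᵥ y)
        + C₂ ^ 2 / lam * ((∫ x in F, δ x ∂μ) * (u ⬝ᵥ u)))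
      = ∫ x in F, (1 / 2 * lam * (δ x * ((S x *ᵥ y) ⬝ᵥ y))
          + δ x * (1 / 2 * (C₂ ^ 2 / lam) * (u ⬝ᵥ u))) ∂μ := by
    rw [integral_add (i2.const_mul _) (hδ.mul_const _), integral_mul_const, integral_const_mul, e2]
    ring
  rw [hl, hr]
  refine setIntegral_mono_on ((hδ.mul_const _).sub (i1.const_mul r))
    ((i2.const_mul _).add (hδ.mul_const _)) hF fun x hx => ?_
  have hp := h x hx y u
  have hsq : matSeminorm (S x) y ^ 2 = (S x *ᵥ y) ⬝ᵥ y := Real.sq_sqrt (h0 x hx y)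
  have hsu := norm2_sq u
  -- The seminorm varies with the point. Young's inequality is applied pointwise because its
  -- right-hand side is quadratic and integrates to the averaged matrix.
  have hyoung : C₂ * (norm2 u * matSeminorm (S x) y)
      ≤ 1 / 2 * (lam * matSeminorm (S x) y ^ 2 + C₂ ^ 2 / lam * norm2 u ^ 2) := by
    have h3 : 0 ≤ (lam * matSeminorm (S x) y - C₂ * norm2 u) ^ 2 / lam := by positivity
    have h4 : (lam * matSeminorm (S x) y - C₂ * norm2 u) ^ 2 / lam
        = lam * matSeminorm (S x) y ^ 2 + C₂ ^ 2 / lam * norm2 u ^ 2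
          - 2 * (C₂ * (norm2 u * matSeminorm (S x) y)) := by
      field_simp; ring
    linarith
  rw [hsq, hsu] at hyoung
  have := mul_le_mul_of_nonneg_left (hp.trans hyoung) (hδ0 x hx)
  linarith

end Average

/-! ### Pointwise flux bounds -/

/-- The factor `1 + C` replaces `√C` to keep later constants polynomial. -/
lemma matSeminorm_le {A : Mat L} {C : ℝ} (hC : 0 ≤ C)
    (hn : ∀ y, norm2 (A *ᵥ y) ≤ C * norm2 y) (y : Fin L → ℝ) :
    matSeminorm A y ≤ (1 + C) * norm2 y := by
  have h1 : (A *ᵥ y) ⬝ᵥ y ≤ C * norm2 y ^ 2 := by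
    refine (dotProduct_le_norm2 _ _).trans ?_
    have := mul_le_mul_of_nonneg_right (hn y) (norm2_nonneg y)
    linarith
  refine Real.sqrt_le_iff.mpr ⟨mul_nonneg (by linarith) (norm2_nonneg y), h1.trans ?_⟩
  rw [mul_pow]
  exact mul_le_mul_of_nonneg_right (by nlinarith) (sq_nonneg _)

lemma matSeminorm_neg (A : Mat L) (y : Fin L → ℝ) : matSeminorm A (-y) = matSeminorm A y := by
  simp [matSeminorm, mulVec_neg]

lemma matSeminorm_nonneg (A : Mat L) (y : Fin L → ℝ) : 0 ≤ matSeminorm A y := Real.sqrt_nonneg _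

/-- Symmetry of `D` moves the seminorm in `hDS` from the test value `u` to the jump `y`. The
`S`-term is bounded by `C |y|_S |u|_S`, and `|u|_S` by the Euclidean norm. -/
lemma interior_flux_le {D S : Mat L} {C : ℝ} (hC : 0 ≤ C) (hD : D.IsSymm)
    (hn : ∀ y, norm2 (S *ᵥ y) ≤ C * norm2 y)
    (hS : ∀ y z, (S *ᵥ y) ⬝ᵥ z ≤ C * matSeminorm S y * matSeminorm S z)
    (hDS : ∀ y z, (D *ᵥ y) ⬝ᵥ z ≤ C * norm2 y * matSeminorm S z) (y u : Fin L → ℝ) :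
    (1 / 2) * ((D *ᵥ y) ⬝ᵥ u) - 1 * ((S *ᵥ y) ⬝ᵥ u)
      ≤ (C / 2 + (1 + C) ^ 2) * (norm2 u * matSeminorm S y) := by
  have h1 := hDS u y
  rw [mulVec_dotProduct_comm_of_isSymm hD] at h1
  have h2 := hS y (-u)
  rw [dotProduct_neg, matSeminorm_neg] at h2
  have h3 := matSeminorm_le hC hn u
  have h4 := matSeminorm_nonneg S y
  have h5 := mul_le_mul_of_nonneg_left h3 (mul_nonneg hC h4)
  have h6 : 0 ≤ norm2 u * matSeminorm S y := mul_nonneg (norm2_nonneg u) h4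
  nlinarith

/-- `(D - B) y · u` equals `(D + B) u · y` minus the symmetrised form `B u · y + B y · u`. The
design condition handles the former, Cauchy–Schwarz the latter. -/
lemma boundary_flux_le {D B : Mat L} {C : ℝ} (hC : 0 ≤ C) (hD : D.IsSymm)
    (hn : ∀ y, norm2 (B *ᵥ y) ≤ C * norm2 y) (h0 : ∀ y, 0 ≤ (B *ᵥ y) ⬝ᵥ y)
    (hDB : ∀ y z, ((D + B) *ᵥ y) ⬝ᵥ z ≤ C * norm2 y * matSeminorm B z) (y u : Fin L → ℝ) :
    (1 / 2) * ((D *ᵥ y) ⬝ᵥ u) - 1 / 2 * ((B *ᵥ y) ⬝ᵥ u)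
      ≤ (C / 2 + (1 + C) ^ 2) * (norm2 u * matSeminorm B y) := by
  have h1 := hDB u y
  rw [add_mulVec, add_dotProduct, mulVec_dotProduct_comm_of_isSymm hD] at h1
  have hs : ∀ z, matSeminorm B z ^ 2 = (B *ᵥ z) ⬝ᵥ z := fun z => Real.sq_sqrt (h0 z)
  have h2 : -((B *ᵥ u) ⬝ᵥ y + (B *ᵥ y) ⬝ᵥ u) ≤ 2 * (matSeminorm B u * matSeminorm B y) := by
    -- `B` need not be symmetric, so Cauchy–Schwarz for its symmetric part is read off the
    -- discriminant of `t ↦ B(t u + y) · (t u + y)`.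
    have hdis : ∀ t : ℝ, 0 ≤ (B *ᵥ u) ⬝ᵥ u * (t * t) + ((B *ᵥ u) ⬝ᵥ y + (B *ᵥ y) ⬝ᵥ u) * t
        + (B *ᵥ y) ⬝ᵥ y := by
      intro t
      have := h0 (t • u + y)
      simp only [mulVec_add, mulVec_smul, add_dotProduct, dotProduct_add, smul_dotProduct,
        dotProduct_smul, smul_eq_mul] at this
      linarith
    have hd := discrim_le_zero hdis
    rw [discrim, ← hs, ← hs] at hd
    refine (neg_le_abs _).trans (abs_le_of_sq_le_sq ?_ ?_)
    · nlinarith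
    · exact mul_nonneg zero_le_two (mul_nonneg (matSeminorm_nonneg _ _) (matSeminorm_nonneg _ _))
  have h3 := matSeminorm_le hC hn u
  have h4 := matSeminorm_nonneg B y
  have h5 := mul_le_mul_of_nonneg_right h3 h4
  have h6 : 0 ≤ norm2 u * matSeminorm B y := mul_nonneg (norm2_nonneg u) h4
  have h7 : (1 + C) * (norm2 u * matSeminorm B y) ≤ (1 + C) ^ 2 * (norm2 u * matSeminorm B y) :=
    mul_le_mul_of_nonneg_right (by nlinarith) h6
  linarith

end

/-! ### The tent: divergence theorem, dissipation identity and residual bound -/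

section

variable {N L : ℕ}

namespace Setting

variable {Q : Setting N L} {γ Λ c Cd chat : ℝ} {φb φt : E N → ℝ}

lemma IsDesign.abs (h : Q.IsDesign Cd) : Q.IsDesign |Cd| where
  meas_B := h.meas_B
  meas_S := h.meas_S
  nonneg_B := h.nonneg_B
  nonneg_S := h.nonneg_S
  norm_B K hK q hq hi x hx y := (h.norm_B K hK q hq hi x hx y).trans
    (mul_le_mul_of_nonneg_right (le_abs_self _) (norm2_nonneg y))
  norm_S K hK q hq hi x hx y := (h.norm_S K hK q hq hi x hx y).trans
    (mul_le_mul_of_nonneg_right (le_abs_self _) (norm2_nonneg y))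
  bound_DB K hK q hq hi x hx y z := (h.bound_DB K hK q hq hi x hx y z).trans
    (mul_le_mul_of_nonneg_right (mul_le_mul_of_nonneg_right (le_abs_self _) (norm2_nonneg y))
      (matSeminorm_nonneg _ _))
  bound_S K hK q hq hi x hx y z := (h.bound_S K hK q hq hi x hx y z).trans
    (mul_le_mul_of_nonneg_right (mul_le_mul_of_nonneg_right (le_abs_self _) (matSeminorm_nonneg _ _))
      (matSeminorm_nonneg _ _))
  bound_D K hK q hq hi x hx y z := (h.bound_D K hK q hq hi x hx y z).trans
    (mul_le_mul_of_nonneg_right (mul_le_mul_of_nonneg_right (le_abs_self _) (norm2_nonneg y))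
      (matSeminorm_nonneg _ _))

/-! ### The tent height -/

/-- The height of the tent pole. -/
def pole (Q : Setting N L) (φb φt : E N → ℝ) : ℝ := φt Q.vtx - φb Q.vtx

/-- `δ` vanishes at every vertex of `K` other than the pitched one, so it is the pole height times
the barycentric coordinate of `Q.vtx`. -/
lemma delta_affine (hT : Q.IsCausalTent chat φb φt) {K : Finset (E N)} (hK : K ∈ Q.patch) :
    ∃ g : E N →ᵃ[ℝ] ℝ, (∀ x ∈ hull K, φt x - φb x = g x) ∧ g = Q.pole φb φt • bc K Q.vtx := by
  obtain ⟨gb, hgb⟩ := hT.affine_bot K hK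
  obtain ⟨gt, hgt⟩ := hT.affine_top K hK
  have hKs := isSimplex_of_mem_patch hK
  have hsub : ∀ p ∈ K, p ∈ hull K := fun p hp => subset_convexHull ℝ _ hp
  refine ⟨gt - gb, fun x hx => by simp [hgb x hx, hgt x hx], affine_ext hKs fun p hp => ?_⟩
  simp only [AffineMap.coe_sub, Pi.sub_apply, AffineMap.coe_smul, Pi.smul_apply, smul_eq_mul]
  rw [← hgb p (hsub p hp), ← hgt p (hsub p hp)]
  by_cases hpv : p = Q.vtx
  · rw [hpv, bc_self hKs (vtx_mem hK), pole, mul_one]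
  · rw [bc_ne hKs (vtx_mem hK) hp hpv, hT.fixed K hK p hp hpv]; simp

lemma delta_eq (hT : Q.IsCausalTent chat φb φt) {K : Finset (E N)} (hK : K ∈ Q.patch) {x : E N}
    (hx : x ∈ hull K) : φt x - φb x = Q.pole φb φt * bc K Q.vtx x := by
  obtain ⟨g, hg, rfl⟩ := delta_affine hT hK
  rw [hg x hx]; simp

lemma pole_pos (hT : Q.IsCausalTent chat φb φt) : 0 < Q.pole φb φt := sub_pos.mpr hT.raised

lemma hull_erase_subset (K : Finset (E N)) (q : E N) : hull (K.erase q) ⊆ hull K :=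
  convexHull_mono (by simp)

lemma delta_nonneg (hT : Q.IsCausalTent chat φb φt) {K : Finset (E N)} (hK : K ∈ Q.patch) {q x : E N}
    (hx : x ∈ hull (K.erase q)) : 0 ≤ φt x - φb x := by
  have hx' := hull_erase_subset K q hx
  rw [delta_eq hT hK hx']
  exact mul_nonneg (pole_pos hT).le
    ((mem_hull_iff (isSimplex_of_mem_patch hK)).mp hx' _ (vtx_mem hK))

lemma gradOn_delta (hT : Q.IsCausalTent chat φb φt) {K : Finset (E N)} (hK : K ∈ Q.patch) :
    gradOn φt K - gradOn φb K = Q.pole φb φt • bcGrad K Q.vtx := by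
  obtain ⟨g, hg, hg'⟩ := delta_affine hT hK
  have h1 := gradOn_combination (Q := Q) hT.affine_top hT.affine_bot 1 (-1) hK
  have hfun : (fun y => φt y - φb y) = fun y => 1 * φt y + (-1) * φb y := by funext y; ring
  rw [← hfun, gradOn, gradient_eq_affGrad hg (centroid_mem_interior (isSimplex_of_mem_patch hK)),
    hg'] at h1
  have h2 : gradOn φt K - gradOn φb K = (1 : ℝ) • gradOn φt K + (-1 : ℝ) • gradOn φb K := by
    simp [sub_eq_add_neg]
  rw [h2, ← h1]
  refine affGrad_unique _ _ fun y => ?_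
  rw [inner_smul_left, bcGrad, inner_affGrad]
  simp

/-- The integral of `δ` over a facet. -/
def facInt (φb φt : E N → ℝ) (K : Finset (E N)) (q : E N) : ℝ :=
  ∫ x in hull (K.erase q), (φt x - φb x) ∂(μHE[N - 1])

lemma integrableOn_delta (hN : 0 < N) (hT : Q.IsCausalTent chat φb φt) {K : Finset (E N)}
    (hK : K ∈ Q.patch) {q : E N} (hq : q ∈ K.erase Q.vtx) :
    IntegrableOn (fun x => φt x - φb x) (hull (K.erase q)) (μHE[N - 1]) := by
  rw [Finset.mem_erase] at hq
  have h := (integrableOn_bc_facet (isSimplex_of_mem_patch hK) hN hq.2 (vtx_mem hK)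
    (Ne.symm hq.1)).const_mul (Q.pole φb φt)
  exact IntegrableOn.congr_fun h (fun x hx => (delta_eq hT hK (hull_erase_subset K q hx)).symm)
    (measurableSet_hull _)

lemma facInt_eq (hN : 0 < N) (hT : Q.IsCausalTent chat φb φt) {K : Finset (E N)}
    (hK : K ∈ Q.patch) {q : E N} (hq : q ∈ K.erase Q.vtx) :
    facInt φb φt K q = Q.pole φb φt * (‖bcGrad K q‖ * (volume (hull K)).toReal) := by
  rw [Finset.mem_erase] at hq
  rw [facInt, setIntegral_congr_fun (measurableSet_hull _)
    (fun x hx => delta_eq hT hK (hull_erase_subset K q hx)), integral_const_mul,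
    integral_bc_facet (isSimplex_of_mem_patch hK) hN hq.2 (vtx_mem hK) (Ne.symm hq.1)]

/-- The divergence theorem for the tent height on an element of the patch. -/
lemma divergence_identity (hN : 0 < N) (hT : Q.IsCausalTent chat φb φt) {K : Finset (E N)}
    (hK : K ∈ Q.patch) (y z : Fin L → ℝ) :
    (volume (hull K)).toReal * ((Q.symbolOn K (gradOn φt K - gradOn φb K) *ᵥ y) ⬝ᵥ z)
      = ∑ q ∈ K.erase Q.vtx, facInt φb φt K q * ((Q.Dmat K q *ᵥ y) ⬝ᵥ z) := by
  have hKs := isSimplex_of_mem_patch hK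
  have hs := sum_bcGrad hKs
  rw [← Finset.add_sum_erase _ _ (vtx_mem hK)] at hs
  have hterm : ∀ q ∈ K.erase Q.vtx, facInt φb φt K q * ((Q.Dmat K q *ᵥ y) ⬝ᵥ z)
      = (volume (hull K)).toReal *
        ((Q.symbolOn K (-(Q.pole φb φt • bcGrad K q)) *ᵥ y) ⬝ᵥ z) := by
    intro q hq
    have hqK := Finset.mem_of_mem_erase hq
    have hng : ‖bcGrad K q‖ ≠ 0 := norm_ne_zero_iff.mpr (bcGrad_ne_zero hKs hN hqK)
    have hD : Q.Dmat K q = Q.symbolOn K (outwardNormal K q) := rfl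
    rw [facInt_eq hN hT hK hq, hD, outwardNormal_eq hKs hN hqK, ← smul_neg, ← smul_neg,
      symbolOn_smul, symbolOn_smul]
    simp only [smul_mulVec, smul_dotProduct, smul_eq_mul]
    field_simp
  rw [Finset.sum_congr rfl hterm, ← Finset.mul_sum, ← sum_mulVec_dot]
  have hsum : ∑ q ∈ K.erase Q.vtx, Q.symbolOn K (-(Q.pole φb φt • bcGrad K q))
      = Q.symbolOn K (Q.pole φb φt • bcGrad K Q.vtx) := by
    have h1 : bcGrad K Q.vtx = -∑ q ∈ K.erase Q.vtx, bcGrad K q := eq_neg_of_add_eq_zero_left hs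
    have h2 : ∀ q, Q.symbolOn K (-(Q.pole φb φt • bcGrad K q))
        = (-Q.pole φb φt) • Q.symbolOn K (bcGrad K q) := fun q => by
      rw [← neg_smul, symbolOn_smul]
    have h3 : Q.symbolOn K (∑ q ∈ K.erase Q.vtx, bcGrad K q)
        = ∑ q ∈ K.erase Q.vtx, Q.symbolOn K (bcGrad K q) := by
      simp only [symbolOn, WithLp.ofLp_sum, Finset.sum_apply, Finset.sum_smul]
      rw [Finset.sum_comm]
    simp only [h2]
    rw [← Finset.smul_sum, ← h3, ← symbolOn_smul, h1]
    congr 1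
    simp
  rw [hsum, gradOn_delta hT hK]

/-! ### Neighbours in the patch -/

open Classical in
/-- The neighbour of `K` across its facet opposite to `q`. -/
def nbr (Q : Setting N L) (K : Finset (E N)) (q : E N) : Finset (E N) :=
  if h : Q.mesh.IsInteriorFacet K q then h.choose else ∅

lemma exists_sharesFacet {K : Finset (E N)} (hK : K ∈ Q.mesh.elements) {q : E N} (hq : q ∈ K)
    (hi : Q.mesh.IsInteriorFacet K q) : ∃ q', SharesFacet Q.mesh K (Q.nbr K q) q q' := by
  obtain ⟨h1, h2, h3⟩ := hi.choose_spec
  rw [nbr, dif_pos hi]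
  obtain ⟨q', ha, hb, hc, hd⟩ := exists_opposite (SimplicialMesh.isSimplex hK).2
    (SimplicialMesh.isSimplex h1).2 hq h2 h3
  exact ⟨q', hK, h1, hq, ha, hb, hc, hd⟩

open Classical in
/-- The vertex of the neighbour of `K` opposite to the common facet. -/
def opp (Q : Setting N L) (K : Finset (E N)) (q : E N) : E N :=
  if h : ∃ q', SharesFacet Q.mesh K (Q.nbr K q) q q' then h.choose else q

lemma sharesFacet {K : Finset (E N)} (hK : K ∈ Q.mesh.elements) {q : E N} (hq : q ∈ K)
    (hi : Q.mesh.IsInteriorFacet K q) : SharesFacet Q.mesh K (Q.nbr K q) q (Q.opp K q) := by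
  have h := exists_sharesFacet hK hq hi
  rw [opp, dif_pos h]
  exact h.choose_spec

lemma _root_.TentDG.SharesFacet.isInterior {K K' : Finset (E N)} {q q' : E N}
    (h : SharesFacet Q.mesh K K' q q') : Q.mesh.IsInteriorFacet K q :=
  ⟨K', h.mem', fun he => h.notMem (he ▸ h.apex'), h.erase_eq ▸ Finset.erase_subset _ _⟩

/-- `numFlux` picks its neighbour by choice; uniqueness of the element across a facet makes passing
to the neighbour an involution. -/
lemma nbr_eq (hN : 0 < N) {K K' : Finset (E N)} {q q' : E N} (h : SharesFacet Q.mesh K K' q q') :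
    Q.nbr K q = K' :=
  h.unique hN (sharesFacet h.mem h.apex h.isInterior)

lemma opp_eq (hN : 0 < N) {K K' : Finset (E N)} {q q' : E N} (h : SharesFacet Q.mesh K K' q q') :
    Q.opp K q = q' := by
  have h1 := sharesFacet h.mem h.apex h.isInterior
  rw [nbr_eq hN h] at h1
  have h2 : K'.erase (Q.opp K q) = K'.erase q' := h1.erase_eq.trans h.erase_eq.symm
  by_contra hne
  have : q' ∈ K'.erase (Q.opp K q) := Finset.mem_erase.mpr ⟨Ne.symm hne, h.apex'⟩
  rw [h2] at this
  simp at this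

/-! ### Averaged fluxes -/

open Classical in
/-- The dissipative matrix field of the numerical flux on a facet. -/
def dissField (Q : Setting N L) (K : Finset (E N)) (q : E N) : E N → Mat L :=
  if Q.mesh.IsInteriorFacet K q then Q.S (K.erase q) else Q.B (K.erase q)

/-- The weighted average of the dissipative matrix on a facet. -/
def diss (Q : Setting N L) (φb φt : E N → ℝ) (K : Finset (E N)) (q : E N) : Mat L :=
  matAvg (μHE[N - 1]) (hull (K.erase q)) (fun x => φt x - φb x) (Q.dissField K q)

open Classical in
/-- The jump across a facet, or the value on a boundary facet. -/
def jump (K : Finset (E N)) (q : E N) : Q.Vh 0 →ₗ[ℝ] (Fin L → ℝ) :=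
  if Q.mesh.IsInteriorFacet K q then coef K - coef (Q.nbr K q) else coef K

open Classical in
/-- The integral of `δ` times the numerical flux over a facet. -/
def facFlux (φb φt : E N → ℝ) (K : Finset (E N)) (q : E N) : Q.Vh 0 →ₗ[ℝ] (Fin L → ℝ) :=
  if Q.mesh.IsInteriorFacet K q then
    (facInt φb φt K q • Q.Dmat K q).mulVecLin ∘ₗ ((1 / 2 : ℝ) • (coef K + coef (Q.nbr K q)))
      + (Q.diss φb φt K q).mulVecLin ∘ₗ (coef K - coef (Q.nbr K q))
  else (1 / 2 : ℝ) • ((facInt φb φt K q • Q.Dmat K q + Q.diss φb φt K q).mulVecLin ∘ₗ coef K)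

/-- The form `a` on piecewise constants. -/
def aB (Q : Setting N L) (φb φt : E N → ℝ) : LinearMap.BilinForm ℝ (Q.Vh 0) :=
  -∑ K ∈ Q.patch, ∑ q ∈ K.erase Q.vtx, dotB.compl₁₂ (facFlux φb φt K q) (coef K)

lemma aB_apply (w u : Q.Vh 0) : Q.aB φb φt w u
    = -∑ K ∈ Q.patch, ∑ q ∈ K.erase Q.vtx, facFlux φb φt K q w ⬝ᵥ coef K u := by
  simp [aB, LinearMap.sum_apply, dotB]

section

variable (hD : Q.IsDesign Cd) {K : Finset (E N)} (hK : K ∈ Q.patch) {q : E N} (hq : q ∈ K)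
include hD

lemma meas_dissField (K : Finset (E N)) (q : E N) (i j : Fin L) :
    Measurable fun x => Q.dissField K q x i j := by
  unfold dissField
  split_ifs
  · exact hD.meas_S _ i j
  · exact hD.meas_B _ i j

include hK hq

lemma norm_dissField : ∀ x ∈ hull (K.erase q), ∀ y,
    norm2 (Q.dissField K q x *ᵥ y) ≤ Cd * norm2 y := by
  unfold dissField
  split_ifs with h
  · exact hD.norm_S K hK q hq h
  · exact hD.norm_B K hK q hq h

lemma nonneg_dissField : ∀ x ∈ hull (K.erase q), ∀ y,
    0 ≤ (Q.dissField K q x *ᵥ y) ⬝ᵥ y := by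
  unfold dissField
  split_ifs with h
  · exact hD.nonneg_S K hK q hq h
  · exact hD.nonneg_B K hK q hq h

end

lemma integral_numFlux (hN : 0 < N) (hD : Q.IsDesign Cd) (hT : Q.IsCausalTent chat φb φt)
    {K : Finset (E N)} (hK : K ∈ Q.patch) {q : E N} (hq : q ∈ K.erase Q.vtx) (w u : Q.Vh 0) :
    ∫ x in hull (K.erase q), (φt x - φb x) * (numFlux w K q x ⬝ᵥ val u K x) ∂(μHE[N - 1])
      = facFlux φb φt K q w ⬝ᵥ coef K u := by
  have hδ := integrableOn_delta hN hT hK hq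
  have hqK := Finset.mem_of_mem_erase hq
  have hF := measurableSet_hull (K.erase q)
  have hS := meas_dissField hD K q
  have hb := norm_dissField hD hK hqK
  have hI := integral_mulVec_dot hF hδ hS hb
  have hi := integrable_mulVec_dot hF hδ hS hb
  by_cases h : Q.mesh.IsInteriorFacet K q
  · have hfun : ∀ x, (φt x - φb x) * (numFlux w K q x ⬝ᵥ val u K x)
        = (φt x - φb x) * ((Q.Dmat K q *ᵥ ((1 / 2 : ℝ) • (coef K w + coef (Q.nbr K q) w))) ⬝ᵥ coef K u)
          + (φt x - φb x) * ((Q.dissField K q x *ᵥ (coef K w - coef (Q.nbr K q) w)) ⬝ᵥ coef K u) := by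
      intro x
      rw [numFlux, dif_pos h, dissField, if_pos h, nbr, dif_pos h]
      simp only [val_eq_coef, add_dotProduct, mul_add]
    simp only [hfun]
    rw [integral_add (hδ.mul_const _) (hi _ _), hI, integral_mul_const, facFlux, if_pos h]
    simp only [LinearMap.add_apply, LinearMap.comp_apply, LinearMap.smul_apply, LinearMap.sub_apply,
      Matrix.mulVecLin_apply, add_dotProduct, smul_mulVec, smul_dotProduct, smul_eq_mul]
    rfl
  · have hfun : ∀ x, (φt x - φb x) * (numFlux w K q x ⬝ᵥ val u K x)
        = (φt x - φb x) * ((1 / 2 : ℝ) * ((Q.Dmat K q *ᵥ coef K w) ⬝ᵥ coef K u))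
          + (1 / 2 : ℝ) * ((φt x - φb x) * ((Q.dissField K q x *ᵥ coef K w) ⬝ᵥ coef K u)) := by
      intro x
      rw [numFlux, dif_neg h, dissField, if_neg h]
      simp only [val_eq_coef, add_mulVec, smul_dotProduct, add_dotProduct, smul_eq_mul]
      ring
    simp only [hfun]
    rw [integral_add (hδ.mul_const _) ((hi _ _).const_mul _), integral_const_mul, hI,
      integral_mul_const, facFlux, if_neg h]
    simp only [LinearMap.comp_apply, LinearMap.smul_apply, Matrix.mulVecLin_apply, add_mulVec,
      add_dotProduct, smul_mulVec, smul_dotProduct, smul_eq_mul]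
    rw [facInt, diss]
    ring

/-- Constants have no gradient, so only facet terms survive, and the facet opposite to `Q.vtx` is
missing because `δ` vanishes on it. -/
lemma aForm_eq (hN : 0 < N) (hD : Q.IsDesign Cd) (hT : Q.IsCausalTent chat φb φt) (w u : Q.Vh 0) :
    aForm φb φt w u = Q.aB φb φt w u := by
  rw [aForm, aB_apply, ← Finset.sum_neg_distrib]
  refine Finset.sum_congr rfl fun K hK => ?_
  have h0 : ∑ j, ∫ x in hull K, (φt x - φb x) * ((Q.Lc j x *ᵥ val w K x) ⬝ᵥ dval u K j x) = 0 := by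
    refine Finset.sum_eq_zero fun j _ => ?_
    simp [dval_zero_eq]
  rw [h0, zero_sub, ← Finset.add_sum_erase _ _ (vtx_mem hK)]
  have hv : ∫ x in hull (K.erase Q.vtx), (φt x - φb x) * (numFlux w K Q.vtx x ⬝ᵥ val u K x)
      ∂(μHE[N - 1]) = 0 := by
    rw [setIntegral_congr_fun (g := fun _ => 0) (measurableSet_hull _)]
    · simp
    · intro x hx
      have h1 := ((mem_facet_iff (isSimplex_of_mem_patch hK) (vtx_mem hK)).mp hx)
      simp only [delta_eq hT hK h1.1, h1.2]
      simp
  rw [hv, zero_add]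
  congr 1
  exact Finset.sum_congr rfl fun q hq => integral_numFlux hN hD hT hK hq w u

/-- The form `(M₁ w, u)_v` on piecewise constants. -/
def m1B (Q : Setting N L) (φb φt : E N → ℝ) : LinearMap.BilinForm ℝ (Q.Vh 0) :=
  Q.matForm (fun K => Q.symbolOn K (gradOn φt K - gradOn φb K))

lemma m1B_apply (hN : 0 < N) (hT : Q.IsCausalTent chat φb φt) (w u : Q.Vh 0) :
    Q.m1B φb φt w u = ∑ K ∈ Q.patch, ∑ q ∈ K.erase Q.vtx,
      facInt φb φt K q * ((Q.Dmat K q *ᵥ coef K w) ⬝ᵥ coef K u) := by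
  rw [m1B, matForm_apply]
  exact Finset.sum_congr rfl fun K hK => divergence_identity hN hT hK _ _

/-- The quadratic form `|w|_d²`. -/
def dQ (Q : Setting N L) (φb φt : E N → ℝ) (w : Q.Vh 0) : ℝ :=
  -(2 * Q.aB φb φt w w + Q.m1B φb φt w w)

/-- The dissipation is carried by the jumps. -/
lemma dQ_eq (hN : 0 < N) (hH : Q.IsHyperbolic γ Λ c) (hT : Q.IsCausalTent chat φb φt)
    (w : Q.Vh 0) : Q.dQ φb φt w = ∑ K ∈ Q.patch, ∑ q ∈ K.erase Q.vtx,
      (Q.diss φb φt K q *ᵥ jump K q w) ⬝ᵥ jump K q w := by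
  classical
  -- The non-dissipative remainder on an interior facet, integrated against `δ`: `𝒟 w_o · w + S(w -
  -- w_o) · (w + w_o)`. It changes sign under exchange of the two sides, since `𝒟` and the jump do.
  -- Symmetry of `S` is not needed.
  let f : (Σ _ : Finset (E N), E N) → ℝ := fun a =>
    facInt φb φt a.1 a.2 * ((Q.Dmat a.1 a.2 *ᵥ coef (Q.nbr a.1 a.2) w) ⬝ᵥ coef a.1 w)
      + 2 * ((Q.diss φb φt a.1 a.2 *ᵥ (coef a.1 w - coef (Q.nbr a.1 a.2) w)) ⬝ᵥ coef a.1 w)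
      - (Q.diss φb φt a.1 a.2 *ᵥ (coef a.1 w - coef (Q.nbr a.1 a.2) w))
        ⬝ᵥ (coef a.1 w - coef (Q.nbr a.1 a.2) w)
  have hterm : ∀ K ∈ Q.patch, ∀ q ∈ K.erase Q.vtx,
      2 * (facFlux φb φt K q w ⬝ᵥ coef K w)
          - facInt φb φt K q * ((Q.Dmat K q *ᵥ coef K w) ⬝ᵥ coef K w)
        = (Q.diss φb φt K q *ᵥ jump K q w) ⬝ᵥ jump K q w
          + if Q.mesh.IsInteriorFacet K q then f ⟨K, q⟩ else 0 := by
    intro K hK q hq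
    by_cases h : Q.mesh.IsInteriorFacet K q
    · rw [facFlux, jump, if_pos h, if_pos h, if_pos h]
      simp only [LinearMap.add_apply, LinearMap.comp_apply, LinearMap.smul_apply,
        LinearMap.sub_apply, Matrix.mulVecLin_apply, add_dotProduct, smul_mulVec, mulVec_smul,
        mulVec_add, smul_dotProduct, smul_eq_mul, f]
      ring
    · rw [facFlux, jump, if_neg h, if_neg h, if_neg h]
      simp only [LinearMap.comp_apply, LinearMap.smul_apply, Matrix.mulVecLin_apply,
        add_dotProduct, smul_mulVec, add_mulVec, smul_dotProduct, smul_eq_mul]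
      ring
  have hzero : ∑ a ∈ Q.patch.sigma
      (fun K => (K.erase Q.vtx).filter (fun q => Q.mesh.IsInteriorFacet K q)), f a = 0 := by
    have hsh : ∀ a ∈ Q.patch.sigma
        (fun K => (K.erase Q.vtx).filter (fun q => Q.mesh.IsInteriorFacet K q)),
        SharesFacet Q.mesh a.1 (Q.nbr a.1 a.2) a.2 (Q.opp a.1 a.2) := by
      intro a ha
      simp only [Finset.mem_sigma, Finset.mem_filter, Finset.mem_erase] at ha
      exact sharesFacet (mem_elements ha.1) ha.2.1.2 ha.2.2
    -- Pairing each facet with itself seen from the neighbour. The index set is preserved: a facet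
    -- not opposite to `Q.vtx` contains `Q.vtx`, so the neighbour is again in the patch.
    refine Finset.sum_involution (fun a _ => ⟨Q.nbr a.1 a.2, Q.opp a.1 a.2⟩) ?_ ?_ ?_ ?_
    · intro a ha
      have hs := hsh a ha
      have hI : facInt φb φt (Q.nbr a.1 a.2) (Q.opp a.1 a.2) = facInt φb φt a.1 a.2 := by
        rw [facInt, facInt, hs.erase_eq]
      have hR : Q.diss φb φt (Q.nbr a.1 a.2) (Q.opp a.1 a.2) = Q.diss φb φt a.1 a.2 := by
        rw [diss, diss, dissField, dissField, if_pos hs.isInterior, if_pos hs.symm.isInterior,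
          hs.erase_eq]
      have hnn : Q.nbr (Q.nbr a.1 a.2) (Q.opp a.1 a.2) = a.1 := nbr_eq hN hs.symm
      simp only [f, hI, hR, hnn, Dmat_neg hH hN hs]
      rw [neg_mulVec, neg_dotProduct, mulVec_dotProduct_comm_of_isSymm (isSymm_Dmat hH hs.mem a.2)
        (coef a.1 w)]
      simp only [mulVec_sub, sub_dotProduct, dotProduct_sub]
      ring
    · intro a ha _ he
      have hs := hsh a ha
      have h1 : Q.nbr a.1 a.2 = a.1 := congrArg Sigma.fst he
      have h2 := hs.notMem'
      rw [h1] at h2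
      exact h2 hs.apex
    · intro a ha
      have hs := hsh a ha
      simp only [Finset.mem_sigma, Finset.mem_filter, Finset.mem_erase] at ha ⊢
      refine ⟨Finset.mem_filter.mpr ⟨hs.mem', ?_⟩, ⟨?_, hs.apex'⟩, hs.symm.isInterior⟩
      · have : Q.vtx ∈ a.1.erase a.2 :=
          Finset.mem_erase.mpr ⟨fun h => ha.2.1.1 h.symm, vtx_mem ha.1⟩
        rw [← hs.erase_eq] at this
        exact Finset.mem_of_mem_erase this
      · intro h
        exact hs.notMem (h ▸ vtx_mem ha.1)
    · intro a ha
      have hs := hsh a ha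
      have h1 := nbr_eq hN hs.symm
      have h2 := opp_eq hN hs.symm
      simp only [h1, h2]
  rw [Finset.sum_sigma] at hzero
  simp only [Finset.sum_filter] at hzero
  rw [dQ, aB_apply, m1B_apply hN hT]
  have h1 : ∑ K ∈ Q.patch, ∑ q ∈ K.erase Q.vtx, (2 * (facFlux φb φt K q w ⬝ᵥ coef K w)
          - facInt φb φt K q * ((Q.Dmat K q *ᵥ coef K w) ⬝ᵥ coef K w))
      = ∑ K ∈ Q.patch, ∑ q ∈ K.erase Q.vtx, ((Q.diss φb φt K q *ᵥ jump K q w) ⬝ᵥ jump K q w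
          + if Q.mesh.IsInteriorFacet K q then f ⟨K, q⟩ else 0) :=
    Finset.sum_congr rfl fun K hK => Finset.sum_congr rfl fun q hq => hterm K hK q hq
  simp only [Finset.sum_sub_distrib, Finset.sum_add_distrib, ← Finset.mul_sum] at h1
  rw [hzero, add_zero] at h1
  rw [← h1]
  ring

lemma diss_nonneg (hN : 0 < N) (hD : Q.IsDesign Cd) (hT : Q.IsCausalTent chat φb φt)
    {K : Finset (E N)} (hK : K ∈ Q.patch) {q : E N} (hq : q ∈ K.erase Q.vtx) (y : Fin L → ℝ) :
    0 ≤ (Q.diss φb φt K q *ᵥ y) ⬝ᵥ y :=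
  have hqK := Finset.mem_of_mem_erase hq
  matAvg_nonneg (measurableSet_hull _) (integrableOn_delta hN hT hK hq)
    (fun _ hx => delta_nonneg hT hK hx) (meas_dissField hD K q) (norm_dissField hD hK hqK)
    (nonneg_dissField hD hK hqK) y

lemma dQ_nonneg (hN : 0 < N) (hH : Q.IsHyperbolic γ Λ c) (hD : Q.IsDesign Cd)
    (hT : Q.IsCausalTent chat φb φt) (w : Q.Vh 0) : 0 ≤ Q.dQ φb φt w := by
  rw [dQ_eq hN hH hT]
  exact Finset.sum_nonneg fun K hK => Finset.sum_nonneg fun q hq => diss_nonneg hN hD hT hK hq _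

/-- The difference of the physical and the numerical flux involves only the jump, or the boundary
value, so Young's inequality splits it into dissipation and an `L²` part of `u`. -/
lemma facet_bound (hN : 0 < N) (hCd : 0 ≤ Cd) (hH : Q.IsHyperbolic γ Λ c) (hD : Q.IsDesign Cd)
    (hT : Q.IsCausalTent chat φb φt) {K : Finset (E N)} (hK : K ∈ Q.patch) {q : E N}
    (hq : q ∈ K.erase Q.vtx) {lam : ℝ} (hlam : 0 < lam) (w u : Q.Vh 0) :
    facInt φb φt K q * ((Q.Dmat K q *ᵥ coef K w) ⬝ᵥ coef K u) - facFlux φb φt K q w ⬝ᵥ coef K u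
      ≤ 1 / 2 * (lam * ((Q.diss φb φt K q *ᵥ jump K q w) ⬝ᵥ jump K q w)
        + (Cd / 2 + (1 + Cd) ^ 2) ^ 2 / lam
          * (facInt φb φt K q * (coef K u ⬝ᵥ coef K u))) := by
  have hqK := Finset.mem_of_mem_erase hq
  have hsym := isSymm_Dmat hH (mem_elements hK) q
  have hb := norm_dissField hD hK hqK
  have h0 := nonneg_dissField hD hK hqK
  -- `r` is the weight of the dissipative matrix in the flux: `1` for `S`, `1/2` for `B`.
  have key := fun r h => avg_bound (measurableSet_hull _) (integrableOn_delta hN hT hK hq)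
    (fun _ hx => delta_nonneg hT hK hx) (meas_dissField hD K q) hb
    (C₂ := Cd / 2 + (1 + Cd) ^ 2) (Q.Dmat K q) r h h0 hlam (jump K q w) (coef K u)
  by_cases h : Q.mesh.IsInteriorFacet K q
  · have hp := key 1 fun x hx y u => by
      have hbx := hb x hx
      rw [dissField, if_pos h] at hbx ⊢
      exact interior_flux_le hCd hsym hbx (hD.bound_S K hK q hqK h x hx)
        (hD.bound_D K hK q hqK h x hx) y u
    refine le_trans (le_of_eq ?_) hp
    rw [facFlux, jump, if_pos h, if_pos h]
    simp only [LinearMap.add_apply, LinearMap.comp_apply, LinearMap.smul_apply,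
      LinearMap.sub_apply, Matrix.mulVecLin_apply, add_dotProduct, smul_mulVec, mulVec_smul,
      mulVec_add, mulVec_sub, sub_dotProduct, smul_dotProduct, smul_eq_mul, facInt, diss]
    ring
  · have hp := key (1 / 2) fun x hx y u => by
      have hbx := hb x hx
      have h0x := h0 x hx
      rw [dissField, if_neg h] at hbx h0x ⊢
      exact boundary_flux_le hCd hsym hbx h0x (hD.bound_DB K hK q hqK h x hx) y u
    refine le_trans (le_of_eq ?_) hp
    rw [facFlux, jump, if_neg h, if_neg h]
    simp only [LinearMap.comp_apply, LinearMap.smul_apply, Matrix.mulVecLin_apply,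
      add_dotProduct, smul_mulVec, add_mulVec, smul_dotProduct, smul_eq_mul, facInt, diss]
    ring

/-- By `facInt_eq` the ratio to `|K|` is the pole height times `‖bcGrad K q‖`. Causality of both
fronts bounds the slope of `δ`, that is the pole height times `‖bcGrad K Q.vtx‖`, by `2/ĉ`; shape
regularity makes the two coordinate gradients comparable. -/
lemma facInt_le (hN : 0 < N) {σ : ℝ} (hchat : 0 < chat) (hσ : Q.mesh.ShapeRegular σ)
    (hT : Q.IsCausalTent chat φb φt) {K : Finset (E N)} (hK : K ∈ Q.patch) {q : E N}
    (hq : q ∈ K.erase Q.vtx) : facInt φb φt K q ≤ 2 * |σ| / chat * (volume (hull K)).toReal := by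
  have hKs := isSimplex_of_mem_patch hK
  have hqK := Finset.mem_of_mem_erase hq
  obtain ⟨x, ρ, hρ, hball, hdiam⟩ := hσ K (mem_elements hK)
  have h1 := norm_bcGrad_le hKs hρ hqK hball
  have h2 := one_le_norm_bcGrad_mul_diam hKs hN (vtx_mem hK)
  have hc := centroid_mem_interior hKs
  have h3 : Q.pole φb φt * ‖bcGrad K Q.vtx‖ ≤ 2 / chat := by
    have h4 := congrArg norm (gradOn_delta hT hK)
    rw [norm_smul, Real.norm_of_nonneg (pole_pos hT).le] at h4
    rw [← h4]
    have := norm_sub_le (gradOn φt K) (gradOn φb K)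
    have h5 : ‖gradOn φt K‖ ≤ 1 / chat := hT.causal_top K hK _ hc
    have h6 : ‖gradOn φb K‖ ≤ 1 / chat := hT.causal_bot K hK _ hc
    have h7 : 2 / chat = 1 / chat + 1 / chat := by ring
    linarith
  rw [facInt_eq hN hT hK hq, ← mul_assoc]
  refine mul_le_mul_of_nonneg_right ?_ ENNReal.toReal_nonneg
  have hp := (pole_pos hT).le
  have hd : Metric.diam (hull K) ≤ |σ| * ρ :=
    hdiam.trans (mul_le_mul_of_nonneg_right (le_abs_self _) hρ.le)
  -- The inserted factor is at least `1`. It trades the pole height for the slope of `δ`, and the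
  -- leftover `‖bcGrad K q‖ · diam` is at most `|σ|` by the inscribed ball.
  calc Q.pole φb φt * ‖bcGrad K q‖
      ≤ Q.pole φb φt * ‖bcGrad K q‖ * (‖bcGrad K Q.vtx‖ * Metric.diam (hull K)) :=
        le_mul_of_one_le_right (by positivity) h2
    _ = Q.pole φb φt * ‖bcGrad K Q.vtx‖ * (‖bcGrad K q‖ * Metric.diam (hull K)) := by ring
    _ ≤ 2 / chat * (‖bcGrad K q‖ * (|σ| * ρ)) := by gcongr
    _ = 2 / chat * |σ| * (‖bcGrad K q‖ * ρ) := by ring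
    _ ≤ 2 / chat * |σ| * 1 := by gcongr
    _ = 2 * |σ| / chat := by ring

/-- The constant in the bound of `A_h + M₁` by the dissipation. -/
def fluxConst (N : ℕ) (σ chat Cd : ℝ) : ℝ :=
  (Cd / 2 + (1 + Cd) ^ 2) ^ 2 * ((N : ℝ) * (2 * |σ| / chat))

/-- `A_h + M₁` is controlled by the dissipation. -/
lemma residual_le (hN : 0 < N) {σ : ℝ} (hchat : 0 < chat) (hCd : 0 ≤ Cd)
    (hσ : Q.mesh.ShapeRegular σ) (hH : Q.IsHyperbolic γ Λ c) (hD : Q.IsDesign Cd)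
    (hT : Q.IsCausalTent chat φb φt) {lam : ℝ} (hlam : 0 < lam) (w u : Q.Vh 0) :
    Q.aB φb φt w u + Q.m1B φb φt w u ≤ 1 / 2 * (lam * Q.dQ φb φt w
      + fluxConst N σ chat Cd / lam * Q.matForm (fun _ => 1) u u) := by
  set C₂ := Cd / 2 + (1 + Cd) ^ 2 with hC₂
  have h1 : Q.aB φb φt w u + Q.m1B φb φt w u = ∑ K ∈ Q.patch, ∑ q ∈ K.erase Q.vtx,
      (facInt φb φt K q * ((Q.Dmat K q *ᵥ coef K w) ⬝ᵥ coef K u)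
        - facFlux φb φt K q w ⬝ᵥ coef K u) := by
    rw [aB_apply, m1B_apply hN hT]
    simp only [Finset.sum_sub_distrib]
    ring
  have h2 : ∑ K ∈ Q.patch, ∑ q ∈ K.erase Q.vtx, facInt φb φt K q * (coef K u ⬝ᵥ coef K u)
      ≤ (N : ℝ) * (2 * |σ| / chat) * Q.matForm (fun _ => 1) u u := by
    rw [← ip_eq, ip_eq_sum, Finset.mul_sum]
    refine Finset.sum_le_sum fun K hK => ?_
    have hcard : (K.erase Q.vtx).card = N := by
      rw [Finset.card_erase_of_mem (vtx_mem hK), (isSimplex_of_mem_patch hK).2]; simp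
    refine (Finset.sum_le_card_nsmul _ _
      (2 * |σ| / chat * (volume (hull K)).toReal * (coef K u ⬝ᵥ coef K u)) fun q hq =>
        mul_le_mul_of_nonneg_right (facInt_le hN hchat hσ hT hK hq)
          (dotProduct_self_nonneg' _)).trans (le_of_eq ?_)
    rw [hcard, nsmul_eq_mul]
    ring
  rw [h1]
  refine (Finset.sum_le_sum fun K hK => Finset.sum_le_sum fun q hq =>
    facet_bound hN hCd hH hD hT hK hq hlam w u).trans ?_
  simp only [← Finset.mul_sum, Finset.sum_add_distrib]
  rw [← dQ_eq hN hH hT]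
  have h3 : 0 ≤ C₂ ^ 2 / lam := by positivity
  have h4 := mul_le_mul_of_nonneg_left h2 h3
  have h5 : fluxConst N σ chat Cd / lam * Q.matForm (fun _ => 1) u u
      = C₂ ^ 2 / lam * ((N : ℝ) * (2 * |σ| / chat) * Q.matForm (fun _ => 1) u u) := by
    rw [fluxConst]; ring
  rw [h5]
  linarith

end Setting

end

/-! ### Operators on `V_h`, the bound on `κ`, and the discrete flows -/

section

variable {N L : ℕ}

/-- Orthogonal decomposition with respect to a positive definite form. -/
lemma exists_orthogonal_decomposition {V : Type*} [AddCommGroup V] [Module ℝ V]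
    [FiniteDimensional ℝ V] (B : LinearMap.BilinForm ℝ V)
    (hpos : ∀ x, x ≠ 0 → 0 < B x x) (W : Submodule ℝ V) (w : V) :
    ∃ k ∈ W, ∃ v, (∀ k' ∈ W, B v k' = 0) ∧ w = k + v := by
  have hinj : Function.Injective (B.restrict W) := by
    rw [← LinearMap.ker_eq_bot, LinearMap.ker_eq_bot']
    intro x hx
    by_contra h
    have h1 := hpos x (by simpa using h)
    have h2 : B.restrict W x x = 0 := by rw [hx]; simp
    exact h1.ne' h2
  let e : W ≃ₗ[ℝ] Module.Dual ℝ W := LinearEquiv.ofInjectiveOfFinrankEq (B.restrict W) hinj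
    (Subspace.dual_finrank_eq).symm
  obtain ⟨k, hk⟩ := e.surjective ((B w).comp W.subtype)
  refine ⟨k, k.2, w - k, fun k' hk' => ?_, by abel⟩
  have h1 : B k k' = B w k' := LinearMap.congr_fun hk ⟨k', hk'⟩
  simp [h1]

namespace Setting

variable {Q : Setting N L} {γ Λ c Cd chat : ℝ} {φb φt : E N → ℝ}

/-! ### The operators on piecewise constants -/

lemma Ah_spec (hN : 0 < N) (hD : Q.IsDesign Cd) (hT : Q.IsCausalTent chat φb φt) (w u : Q.Vh 0) :
    Q.matForm (fun _ => 1) (Q.Ah 0 φb φt w) u = Q.aB φb φt w u :=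
  opOf_spec _ (aForm_eq hN hD hT) w u

lemma AhT_spec (hN : 0 < N) (hD : Q.IsDesign Cd) (hT : Q.IsCausalTent chat φb φt) (w u : Q.Vh 0) :
    Q.matForm (fun _ => 1) (Q.AhT 0 φb φt w) u = Q.aB φb φt u w :=
  opOf_spec (Q.aB φb φt).flip (fun w u => by
    rw [ip_eq, ip_comm, Ah_spec hN hD hT]; rfl) w u

lemma M0_spec (hH : Q.IsHyperbolic γ Λ c) (hb : Q.AffineOnPatch φb) (w u : Q.Vh 0) :
    Q.matForm (fun _ => 1) (Q.M0 0 φb w) u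
      = Q.matForm (fun K => Q.massOn K (gradOn φb K)) w u :=
  opOf_spec _ (m0Form_eq hH hb) w u

lemma M1_spec (hH : Q.IsHyperbolic γ Λ c) (hb : Q.AffineOnPatch φb) (ht : Q.AffineOnPatch φt)
    (w u : Q.Vh 0) : Q.matForm (fun _ => 1) (Q.M1 0 φb φt w) u = Q.m1B φb φt w u :=
  opOf_spec _ (m1Form_eq hH hb ht) w u

lemma M_spec (hH : Q.IsHyperbolic γ Λ c) (hb : Q.AffineOnPatch φb) (ht : Q.AffineOnPatch φt)
    (τ : ℝ) (w u : Q.Vh 0) : Q.matForm (fun _ => 1) (Q.M 0 φb φt τ w) u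
      = Q.matForm (fun K => Q.massOn K (gradOn φb K + τ • (gradOn φt K - gradOn φb K))) w u := by
  rw [M, LinearMap.sub_apply, LinearMap.smul_apply, map_sub, LinearMap.sub_apply, map_smul,
    LinearMap.smul_apply, M0_spec hH hb, M1_spec hH hb ht, m1B, matForm_apply, matForm_apply,
    matForm_apply, smul_eq_mul, Finset.mul_sum, ← Finset.sum_sub_distrib]
  refine Finset.sum_congr rfl fun K _ => ?_
  rw [massOn, massOn, symbolOn_add, symbolOn_smul]
  simp only [sub_mulVec, add_mulVec, smul_mulVec, sub_dotProduct, add_dotProduct, smul_dotProduct,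
    smul_eq_mul]
  ring

lemma M_zero (Q : Setting N L) (φb φt : E N → ℝ) : Q.M 0 φb φt 0 = Q.M0 0 φb :=
  LinearMap.ext fun w => by simp [M]

lemma M_symm (hH : Q.IsHyperbolic γ Λ c) (hb : Q.AffineOnPatch φb) (ht : Q.AffineOnPatch φt)
    (τ : ℝ) (w u : Q.Vh 0) : Q.matForm (fun _ => 1) (Q.M 0 φb φt τ w) u
      = Q.matForm (fun _ => 1) w (Q.M 0 φb φt τ u) := by
  rw [ip_comm w, M_spec hH hb ht, M_spec hH hb ht]
  exact matForm_symm (fun K hK => isSymm_massOn hH (mem_elements hK) _) w u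

lemma m1B_symm (hH : Q.IsHyperbolic γ Λ c) (w u : Q.Vh 0) :
    Q.m1B φb φt w u = Q.m1B φb φt u w :=
  matForm_symm (fun _ hK => isSymm_symbolOn hH (mem_elements hK) _) w u

/-- The front at pseudotime `τ` has a convex combination of the two causal gradients as its
gradient, so it is causal too and `massOn_coercive` applies on every element. -/
lemma M_coercive (hH : Q.IsHyperbolic γ Λ c) (hγ : 0 < γ) (hc : 0 ≤ c) (hchat : c < chat)
    (hT : Q.IsCausalTent chat φb φt) {τ : ℝ} (hτ : τ ∈ Set.Icc (0 : ℝ) 1) (w : Q.Vh 0) :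
    (1 - c / chat) * γ * Q.matForm (fun _ => 1) w w
      ≤ Q.matForm (fun _ => 1) (Q.M 0 φb φt τ w) w := by
  rw [M_spec hH hT.affine_bot hT.affine_top, ← ip_eq, ip_eq_sum, matForm_apply, Finset.mul_sum]
  refine Finset.sum_le_sum fun K hK => ?_
  have hcK := centroid_mem_interior (isSimplex_of_mem_patch hK)
  have h5 : ‖gradOn φt K‖ ≤ 1 / chat := hT.causal_top K hK _ hcK
  have h6 : ‖gradOn φb K‖ ≤ 1 / chat := hT.causal_bot K hK _ hcK
  have hg : ‖gradOn φb K + τ • (gradOn φt K - gradOn φb K)‖ ≤ 1 / chat := by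
    have h7 : gradOn φb K + τ • (gradOn φt K - gradOn φb K)
        = (1 - τ) • gradOn φb K + τ • gradOn φt K := by
      rw [smul_sub, sub_smul, one_smul]; abel
    rw [h7]
    refine (norm_add_le _ _).trans ?_
    rw [norm_smul, norm_smul, Real.norm_of_nonneg hτ.1, Real.norm_of_nonneg (sub_nonneg.mpr hτ.2)]
    have := mul_le_mul_of_nonneg_left h5 hτ.1
    have := mul_le_mul_of_nonneg_left h6 (sub_nonneg.mpr hτ.2)
    linarith
  have := mul_le_mul_of_nonneg_left
    (massOn_coercive hH hγ hc hchat (mem_elements hK) hg (coef K w))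
    (ENNReal.toReal_nonneg (a := volume (hull K)))
  linarith

lemma coercivity_pos (hγ : 0 < γ) (hc : 0 ≤ c) (hchat : c < chat) : 0 < (1 - c / chat) * γ := by
  have hch : 0 < chat := hc.trans_lt hchat
  have : c / chat < 1 := by rwa [div_lt_one hch]
  exact mul_pos (by linarith) hγ

/-- `Ring.inverse` is zero on non-units, so this is what makes `Minv` a true inverse. -/
lemma isUnit_M (hH : Q.IsHyperbolic γ Λ c) (hγ : 0 < γ) (hc : 0 ≤ c) (hchat : c < chat)
    (hT : Q.IsCausalTent chat φb φt) {τ : ℝ} (hτ : τ ∈ Set.Icc (0 : ℝ) 1) :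
    IsUnit (Q.M 0 φb φt τ) :=
  isUnit_of_pos (Q.matForm (fun _ => 1)) _ fun x hx =>
    lt_of_lt_of_le (mul_pos (coercivity_pos hγ hc hchat) (ip_pos x hx))
      (M_coercive hH hγ hc hchat hT hτ x)

lemma M_Minv (hH : Q.IsHyperbolic γ Λ c) (hγ : 0 < γ) (hc : 0 ≤ c) (hchat : c < chat)
    (hT : Q.IsCausalTent chat φb φt) {τ : ℝ} (hτ : τ ∈ Set.Icc (0 : ℝ) 1) (x : Q.Vh 0) :
    Q.M 0 φb φt τ (Q.Minv 0 φb φt τ x) = x := by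
  have h := Ring.mul_inverse_cancel _ (isUnit_M hH hγ hc hchat hT hτ)
  exact LinearMap.congr_fun h x

lemma M_nonneg (hH : Q.IsHyperbolic γ Λ c) (hγ : 0 < γ) (hc : 0 ≤ c) (hchat : c < chat)
    (hT : Q.IsCausalTent chat φb φt) {τ : ℝ} (hτ : τ ∈ Set.Icc (0 : ℝ) 1) (w : Q.Vh 0) :
    0 ≤ Q.matForm (fun _ => 1) (Q.M 0 φb φt τ w) w := by
  refine le_trans (mul_nonneg (coercivity_pos hγ hc hchat).le ?_) (M_coercive hH hγ hc hchat hT hτ w)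
  by_cases hw : w = 0
  · simp [hw]
  · exact (ip_pos w hw).le

lemma normM_sq (hH : Q.IsHyperbolic γ Λ c) (hγ : 0 < γ) (hc : 0 ≤ c) (hchat : c < chat)
    (hT : Q.IsCausalTent chat φb φt) {τ : ℝ} (hτ : τ ∈ Set.Icc (0 : ℝ) 1) (w : Q.Vh 0) :
    normM φb φt τ w ^ 2 = Q.matForm (fun _ => 1) (Q.M 0 φb φt τ w) w := by
  rw [normM, ip_eq, Real.sq_sqrt (M_nonneg hH hγ hc hchat hT hτ w)]

lemma dNorm_sq (hN : 0 < N) (hH : Q.IsHyperbolic γ Λ c) (hD : Q.IsDesign Cd)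
    (hT : Q.IsCausalTent chat φb φt) (w : Q.Vh 0) : dNorm φb φt w ^ 2 = Q.dQ φb φt w := by
  have h : dForm φb φt w w = Q.dQ φb φt w := by
    rw [dForm, aForm_eq hN hD hT, ip_eq, M1_spec hH hT.affine_bot hT.affine_top, dQ, two_mul]
  rw [dNorm, h, Real.sq_sqrt (dQ_nonneg hN hH hD hT w)]

lemma fluxConst_nonneg (N : ℕ) (σ : ℝ) (hchat : 0 < chat) (Cd : ℝ) :
    0 ≤ fluxConst N σ chat Cd := by
  rw [fluxConst]; positivity

lemma AM1_spec (hN : 0 < N) (hH : Q.IsHyperbolic γ Λ c) (hD : Q.IsDesign Cd)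
    (hT : Q.IsCausalTent chat φb φt) (w u : Q.Vh 0) :
    Q.matForm (fun _ => 1) ((Q.Ah 0 φb φt + Q.M1 0 φb φt) w) u
      = Q.aB φb φt w u + Q.m1B φb φt w u := by
  rw [LinearMap.add_apply, map_add, LinearMap.add_apply, Ah_spec hN hD hT,
    M1_spec hH hT.affine_bot hT.affine_top]

/-- The bound on `κ`. -/
def kappaConst (N : ℕ) (σ γ c chat Cd : ℝ) : ℝ :=
  (fluxConst N σ chat Cd + 1) / ((1 - c / chat) * γ)

/-- Testing the residual with `z` itself gives `(M z, z) ≤ ½ (lam |w|_d² + (F/lam) ‖z‖²)`. With `lam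
= kappaConst` coercivity bounds the last term by `(M z, z)`, and half of it is absorbed on the left.
-/
lemma ratio_bound (hN : 0 < N) {σ : ℝ} (hγ : 0 < γ) (hc : 0 ≤ c) (hchat : c < chat) (hCd : 0 ≤ Cd)
    (hσ : Q.mesh.ShapeRegular σ) (hH : Q.IsHyperbolic γ Λ c) (hD : Q.IsDesign Cd)
    (hT : Q.IsCausalTent chat φb φt) {τ : ℝ} (hτ : τ ∈ Set.Icc (0 : ℝ) 1) (w z : Q.Vh 0)
    (hz : Q.M 0 φb φt τ z = (Q.Ah 0 φb φt + Q.M1 0 φb φt) w) :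
    Q.matForm (fun _ => 1) (Q.M 0 φb φt τ z) z ≤ kappaConst N σ γ c chat Cd * Q.dQ φb φt w := by
  have hch : 0 < chat := hc.trans_lt hchat
  have hc0 := coercivity_pos hγ hc hchat
  have hF := fluxConst_nonneg N σ hch Cd
  set F := fluxConst N σ chat Cd with hFdef
  set c0 := (1 - c / chat) * γ with hc0def
  have hlam : 0 < kappaConst N σ γ c chat Cd := by
    rw [kappaConst, ← hFdef, ← hc0def]; positivity
  have h1 := residual_le hN hch hCd hσ hH hD hT hlam w z
  rw [← AM1_spec hN hH hD hT, ← hz] at h1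
  have h2 := M_coercive hH hγ hc hchat hT hτ z
  have h3 : F / kappaConst N σ γ c chat Cd * Q.matForm (fun _ => 1) z z
      ≤ Q.matForm (fun _ => 1) (Q.M 0 φb φt τ z) z := by
    -- The `+ 1` in `kappaConst` keeps `lam` positive even if the flux constant `F` is zero; it
    -- costs only the factor `F/(F+1) ≤ 1`.
    have h4 : 0 ≤ Q.matForm (fun _ => 1) (Q.M 0 φb φt τ z) z := M_nonneg hH hγ hc hchat hT hτ z
    have h5 : F / kappaConst N σ γ c chat Cd * Q.matForm (fun _ => 1) z z
        = F / (F + 1) * (c0 * Q.matForm (fun _ => 1) z z) := by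
      rw [kappaConst, ← hFdef, ← hc0def]; field_simp
    rw [h5]
    calc F / (F + 1) * (c0 * Q.matForm (fun _ => 1) z z)
        ≤ F / (F + 1) * Q.matForm (fun _ => 1) (Q.M 0 φb φt τ z) z :=
          mul_le_mul_of_nonneg_left h2 (by positivity)
      _ ≤ 1 * Q.matForm (fun _ => 1) (Q.M 0 φb φt τ z) z :=
          mul_le_mul_of_nonneg_right ((div_le_one (by positivity)).mpr (by linarith)) h4
      _ = _ := one_mul _
  linarith

/-- Bounding the numerator by a multiple of the denominator also covers `|w|_d = 0`: the numerator
is then zero, and `0 / 0 = 0` for extended nonnegative reals. -/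
lemma kappa_le (hN : 0 < N) {σ : ℝ} (hγ : 0 < γ) (hc : 0 ≤ c) (hchat : c < chat) (hCd : 0 ≤ Cd)
    (hσ : Q.mesh.ShapeRegular σ) (hH : Q.IsHyperbolic γ Λ c) (hD : Q.IsDesign Cd)
    (hT : Q.IsCausalTent chat φb φt) :
    Q.kappa 0 φb φt ≤ ENNReal.ofReal (kappaConst N σ γ c chat Cd) := by
  refine iSup₂_le fun τ hτ => iSup₂_le fun w _ => iSup_le fun _ => ?_
  refine ENNReal.div_le_of_le_mul ?_
  rw [normM_sq hH hγ hc hchat hT hτ, dNorm_sq hN hH hD hT,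
    ← ENNReal.ofReal_mul' (dQ_nonneg hN hH hD hT w)]
  exact ENNReal.ofReal_le_ofReal (ratio_bound hN hγ hc hchat hCd hσ hH hD hT hτ w _
    (M_Minv hH hγ hc hchat hT hτ _))

/-- On `K_h` the operator `A_h + M₁` vanishes. -/
lemma AM1_eq_zero_of_mem_Kh (hN : 0 < N) {σ : ℝ} (hchat : 0 < chat) (hCd : 0 ≤ Cd)
    (hσ : Q.mesh.ShapeRegular σ) (hH : Q.IsHyperbolic γ Λ c) (hD : Q.IsDesign Cd)
    (hT : Q.IsCausalTent chat φb φt) {k : Q.Vh 0} (hk : k ∈ Q.Kh 0 φb φt) :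
    (Q.Ah 0 φb φt + Q.M1 0 φb φt) k = 0 ∧
      ∀ u, Q.aB φb φt k u + Q.aB φb φt u k + Q.m1B φb φt k u = 0 := by
  have h1 : ∀ u, Q.aB φb φt k u + Q.aB φb φt u k + Q.m1B φb φt k u = 0 := by
    intro u
    have hk' : (Q.Ah 0 φb φt + Q.AhT 0 φb φt + Q.M1 0 φb φt) k = 0 := hk
    have h2 : Q.matForm (fun _ => 1) ((Q.Ah 0 φb φt + Q.AhT 0 φb φt + Q.M1 0 φb φt) k) u = 0 := by
      rw [hk']; simp
    simpa only [LinearMap.add_apply, map_add, Ah_spec hN hD hT, AhT_spec hN hD hT,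
      M1_spec hH hT.affine_bot hT.affine_top] using h2
  refine ⟨?_, h1⟩
  have hd : Q.dQ φb φt k = 0 := by
    rw [dQ]; linarith [h1 k]
  by_contra hne
  set z := (Q.Ah 0 φb φt + Q.M1 0 φb φt) k with hz
  have hF := fluxConst_nonneg N σ hchat Cd
  set F := fluxConst N σ chat Cd with hFdef
  have hpos := ip_pos z hne
  -- Since `|k|_d = 0`, testing with `z = (A_h + M₁) k` bounds `‖z‖²` by `½ F/(F+1) ‖z‖²`, which is
  -- impossible for `z ≠ 0`.
  have h3 := residual_le hN hchat hCd hσ hH hD hT (lam := F + 1) (by positivity) k z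
  rw [hd, ← AM1_spec hN hH hD hT, ← hz, ← hFdef] at h3
  have h4 : F / (F + 1) * Q.matForm (fun _ => 1) z z ≤ 1 * Q.matForm (fun _ => 1) z z :=
    mul_le_mul_of_nonneg_right ((div_le_one (by positivity)).mpr (by linarith)) hpos.le
  linarith

/-- The defining bound of `κ`, extended from `K_h^⊥` to the whole space. -/
lemma ratio_le_kappa (hN : 0 < N) {σ : ℝ} (hγ : 0 < γ) (hc : 0 ≤ c) (hchat : c < chat)
    (hCd : 0 ≤ Cd) (hσ : Q.mesh.ShapeRegular σ) (hH : Q.IsHyperbolic γ Λ c) (hD : Q.IsDesign Cd)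
    (hT : Q.IsCausalTent chat φb φt) {τ : ℝ} (hτ : τ ∈ Set.Icc (0 : ℝ) 1) (w : Q.Vh 0) :
    Q.matForm (fun _ => 1) (Q.M 0 φb φt τ
        (Q.Minv 0 φb φt τ ((Q.Ah 0 φb φt + Q.M1 0 φb φt) w)))
      (Q.Minv 0 φb φt τ ((Q.Ah 0 φb φt + Q.M1 0 φb φt) w))
      ≤ (Q.kappa 0 φb φt).toReal * Q.dQ φb φt w := by
  have hch : 0 < chat := hc.trans_lt hchat
  -- Without finiteness `toReal` would turn `κ = ⊤` into `0`.
  have hfin : Q.kappa 0 φb φt ≠ ⊤ :=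
    ((kappa_le hN hγ hc hchat hCd hσ hH hD hT).trans_lt ENNReal.ofReal_lt_top).ne
  obtain ⟨k, hk, v, hv, rfl⟩ := exists_orthogonal_decomposition (Q.matForm (fun _ => 1))
    ip_pos (Q.Kh 0 φb φt) w
  obtain ⟨hk0, hkd⟩ := AM1_eq_zero_of_mem_Kh hN hch hCd hσ hH hD hT hk
  -- The polar form of `dQ` vanishes against `k ∈ K_h`; symmetry of `M₁` merges its two cross terms.
  have hdv : Q.dQ φb φt (k + v) = Q.dQ φb φt v := by
    have h1 := hkd k
    have h2 := hkd v
    have h3 := m1B_symm (φb := φb) (φt := φt) hH v k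
    simp only [dQ, map_add, LinearMap.add_apply]
    linarith
  have hAv : (Q.Ah 0 φb φt + Q.M1 0 φb φt) (k + v) = (Q.Ah 0 φb φt + Q.M1 0 φb φt) v := by
    rw [map_add, hk0, zero_add]
  rw [hAv, hdv]
  have hd0 := dQ_nonneg hN hH hD hT v
  by_cases hv0 : v = 0
  · simp [hv0, dQ]
  -- If `|v|_d = 0` the quotient in `κ` carries no information; `ratio_bound` shows directly that
  -- the left side is at most zero.
  rcases hd0.eq_or_lt with hd | hd
  · have := ratio_bound hN hγ hc hchat hCd hσ hH hD hT hτ v _ (M_Minv hH hγ hc hchat hT hτ _)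
    rw [← hd, mul_zero] at this ⊢
    exact this
  have hvp : v ∈ Q.KhPerp 0 φb φt := fun k' hk' => by rw [ip_eq]; exact hv k' hk'
  have hle : ENNReal.ofReal (normM φb φt τ
      (Q.Minv 0 φb φt τ ((Q.Ah 0 φb φt + Q.M1 0 φb φt) v)) ^ 2)
        / ENNReal.ofReal (dNorm φb φt v ^ 2) ≤ Q.kappa 0 φb φt :=
    le_iSup₂_of_le τ hτ (le_iSup₂_of_le v hvp (le_iSup_of_le hv0 le_rfl))
  rw [normM_sq hH hγ hc hchat hT hτ, dNorm_sq hN hH hD hT,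
    ← ENNReal.ofReal_div_of_pos hd] at hle
  have := ENNReal.toReal_mono hfin hle
  rw [ENNReal.toReal_ofReal (div_nonneg (M_nonneg hH hγ hc hchat hT hτ _) hd0),
    div_le_iff₀ hd] at this
  exact this

/-- One step of length `h` from pseudotime `t`. -/
lemma substep_le (hN : 0 < N) {σ : ℝ} (hγ : 0 < γ) (hc : 0 ≤ c) (hchat : c < chat)
    (hCd : 0 ≤ Cd) (hσ : Q.mesh.ShapeRegular σ) (hH : Q.IsHyperbolic γ Λ c) (hD : Q.IsDesign Cd)
    (hT : Q.IsCausalTent chat φb φt) {t h : ℝ} (hh : 0 ≤ h)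
    (hth : t + h ∈ Set.Icc (0 : ℝ) 1) (hκ : h * (Q.kappa 0 φb φt).toReal ≤ 1) (w : Q.Vh 0) :
    Q.matForm (fun _ => 1) (Q.M 0 φb φt (t + h)
        (w + h • Q.Minv 0 φb φt (t + h) ((Q.Ah 0 φb φt + Q.M1 0 φb φt) w)))
      (w + h • Q.Minv 0 φb φt (t + h) ((Q.Ah 0 φb φt + Q.M1 0 φb φt) w))
      ≤ Q.matForm (fun _ => 1) (Q.M 0 φb φt t w) w := by
  have hd : -(2 * Q.matForm (fun _ => 1) (Q.Ah 0 φb φt w) w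
      + Q.matForm (fun _ => 1) (Q.M1 0 φb φt w) w) = Q.dQ φb φt w := by
    rw [Ah_spec hN hD hT, M1_spec hH hT.affine_bot hT.affine_top, dQ]
  refine step_le (Q.matForm (fun _ => 1)) ip_comm (A := Q.Ah 0 φb φt) (M1 := Q.M1 0 φb φt)
    (κ := (Q.kappa 0 φb φt).toReal) hh ?_ (M_symm hH hT.affine_bot hT.affine_top _) w _
    (M_Minv hH hγ hc hchat hT hth _) ?_ hκ ?_
  · rw [M, M, add_smul]; abel
  · rw [hd]; exact dQ_nonneg hN hH hD hT w
  · rw [hd]; exact ratio_le_kappa hN hγ hc hchat hCd hσ hH hD hT hth w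

lemma Rsat_one_apply (φb φt : E N → ℝ) (hu : IsUnit (Q.M0 0 φb)) (τ : ℝ) (w : Q.Vh 0) :
    Q.Rsat 0 φb φt 1 τ w
      = w + τ • Q.Minv 0 φb φt τ ((Q.Ah 0 φb φt + Q.M1 0 φb φt) w) := by
  have h : ∀ x, Q.M0 0 φb (Ring.inverse (Q.M0 0 φb) x) = x := fun x =>
    LinearMap.congr_fun (Ring.mul_inverse_cancel _ hu) x
  simp [Rsat, Xh, h]

/-! ### Subtents -/

lemma affineOnPatch_front (hb : Q.AffineOnPatch φb) (ht : Q.AffineOnPatch φt) (a : ℝ) :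
    Q.AffineOnPatch (front φb φt a) := hb.combination ht (1 - a) a

lemma gradOn_front (hb : Q.AffineOnPatch φb) (ht : Q.AffineOnPatch φt) (a : ℝ) {K : Finset (E N)}
    (hK : K ∈ Q.patch) :
    gradOn (front φb φt a) K = gradOn φb K + a • (gradOn φt K - gradOn φb K) := by
  have h := gradOn_combination hb ht (1 - a) a hK
  refine h.trans ?_
  rw [smul_sub, sub_smul, one_smul]; abel

lemma matForm_congr {A A' : Finset (E N) → Mat L} (h : ∀ K ∈ Q.patch, A K = A' K) :
    Q.matForm A = Q.matForm A' :=
  Finset.sum_congr rfl fun K hK => by rw [h K hK]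

lemma M0_front (hH : Q.IsHyperbolic γ Λ c) (hb : Q.AffineOnPatch φb) (ht : Q.AffineOnPatch φt)
    (a : ℝ) : Q.M0 0 (front φb φt a) = Q.M 0 φb φt a := by
  refine LinearMap.ext fun w => ip_ext fun u => ?_
  rw [M0_spec hH (affineOnPatch_front hb ht a), M_spec hH hb ht]
  rw [matForm_congr fun K hK => by rw [gradOn_front hb ht a hK]]

lemma M1_front (hH : Q.IsHyperbolic γ Λ c) (hb : Q.AffineOnPatch φb) (ht : Q.AffineOnPatch φt)
    (a b : ℝ) : Q.M1 0 (front φb φt a) (front φb φt b) = (b - a) • Q.M1 0 φb φt := by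
  refine LinearMap.ext fun w => ip_ext fun u => ?_
  rw [M1_spec hH (affineOnPatch_front hb ht a) (affineOnPatch_front hb ht b), LinearMap.smul_apply,
    map_smul, LinearMap.smul_apply, M1_spec hH hb ht, m1B, m1B, matForm_apply, matForm_apply,
    smul_eq_mul, Finset.mul_sum]
  refine Finset.sum_congr rfl fun K hK => ?_
  have h : gradOn (front φb φt b) K - gradOn (front φb φt a) K
      = (b - a) • (gradOn φt K - gradOn φb K) := by
    rw [gradOn_front hb ht a hK, gradOn_front hb ht b hK, sub_smul]; abel
  rw [h, symbolOn_smul, smul_mulVec, smul_dotProduct, smul_eq_mul]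
  ring

/-- The numerical flux does not depend on the fronts, so `a` is linear in `δ`, and `δ` of a subtent
is `b - a` times that of the tent. -/
lemma aForm_front (a b : ℝ) (w u : Q.Vh 0) :
    aForm (front φb φt a) (front φb φt b) w u = (b - a) * aForm φb φt w u := by
  have h : ∀ x, front φb φt b x - front φb φt a x = (b - a) * (φt x - φb x) := fun x => by
    rw [front, front]; ring
  simp only [aForm, h, mul_assoc, integral_const_mul]
  simp only [Finset.mul_sum, mul_sub]

lemma Ah_front (hN : 0 < N) (hD : Q.IsDesign Cd) (hT : Q.IsCausalTent chat φb φt) (a b : ℝ) :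
    Q.Ah 0 (front φb φt a) (front φb φt b) = (b - a) • Q.Ah 0 φb φt := by
  refine LinearMap.ext fun w => ip_ext fun u => ?_
  have h := opOf_spec ((b - a) • Q.aB φb φt) (b' := aForm (front φb φt a) (front φb φt b))
    (fun w u => by rw [aForm_front, aForm_eq hN hD hT]; rfl) w u
  refine h.trans ?_
  simp [Ah_spec hN hD hT]

/-- The height factor `h` of `A_h` and `M₁` on the subtent becomes the step length, while the mass
operator at the subtent's top front is `M(a + h)` of the whole tent. The single `κ` of the whole
tent therefore controls every subtent. -/
lemma Rsat_front_apply (hN : 0 < N) (hγ : 0 < γ) (hc : 0 ≤ c) (hchat : c < chat)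
    (hH : Q.IsHyperbolic γ Λ c) (hD : Q.IsDesign Cd) (hT : Q.IsCausalTent chat φb φt) {a h : ℝ}
    (ha : a ∈ Set.Icc (0 : ℝ) 1) (w : Q.Vh 0) :
    Q.Rsat 0 (front φb φt a) (front φb φt (a + h)) 1 1 w
      = w + h • Q.Minv 0 φb φt (a + h) ((Q.Ah 0 φb φt + Q.M1 0 φb φt) w) := by
  have hM0 := M0_front hH hT.affine_bot hT.affine_top a
  have hM1 := M1_front hH hT.affine_bot hT.affine_top a (a + h)
  have hA := Ah_front hN hD hT a (a + h)
  rw [add_sub_cancel_left] at hM1 hA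
  have hM : Q.M 0 (front φb φt a) (front φb φt (a + h)) 1 = Q.M 0 φb φt (a + h) := by
    rw [M, hM0, hM1, one_smul, M, M, add_smul]; abel
  rw [Rsat_one_apply _ _ (hM0 ▸ isUnit_M hH hγ hc hchat hT ha), Minv, hM, hA, hM1, ← smul_add,
    LinearMap.smul_apply, map_smul, one_smul, Minv]

lemma RsubUpTo_le (hN : 0 < N) {σ : ℝ} (hγ : 0 < γ) (hc : 0 ≤ c) (hchat : c < chat)
    (hCd : 0 ≤ Cd) (hσ : Q.mesh.ShapeRegular σ) (hH : Q.IsHyperbolic γ Λ c) (hD : Q.IsDesign Cd)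
    (hT : Q.IsCausalTent chat φb φt) {r : ℕ} (hr : 0 < r)
    (hκ : (1 / (r : ℝ)) * (Q.kappa 0 φb φt).toReal ≤ 1) (w : Q.Vh 0) (l : ℕ) (hl : l ≤ r) :
    Q.matForm (fun _ => 1) (Q.M 0 φb φt ((l : ℝ) / r) (Q.RsubUpTo 0 φb φt r 1 l w))
      (Q.RsubUpTo 0 φb φt r 1 l w) ≤ Q.matForm (fun _ => 1) (Q.M 0 φb φt 0 w) w := by
  have hr0 : (0 : ℝ) < r := by exact_mod_cast hr
  have hmem : ∀ m : ℕ, m ≤ r → (m : ℝ) / r ∈ Set.Icc (0 : ℝ) 1 := fun m hm =>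
    ⟨by positivity, (div_le_one hr0).mpr (by exact_mod_cast hm)⟩
  induction l with
  | zero => simp [RsubUpTo]
  | succ l ih =>
    refine le_trans ?_ (ih (by omega))
    have hstep : ((l + 1 : ℕ) : ℝ) / r = (l : ℝ) / r + 1 / r := by push_cast; ring
    have hstep' : ((l : ℝ) + 1) / r = (l : ℝ) / r + 1 / r := by ring
    have hm := hmem (l + 1) hl
    rw [hstep] at hm ⊢
    rw [RsubUpTo, hstep', Module.End.mul_apply,
      Rsat_front_apply hN hγ hc hchat hH hD hT (hmem l (by omega))]
    exact substep_le hN hγ hc hchat hCd hσ hH hD hT (by positivity) hm hκ _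

end Setting

end

end TentDG

end

/-! ### Assembly of the three claims -/

theorem mainTheorem6 (N L : ℕ) (hN : 0 < N) (hL : 0 < L)
    (σ γ Λ c chat Cd : ℝ) (hγ : 0 < γ) (hc : 0 ≤ c) (hchat : c < chat) :
    ∃ C : ℝ≥0, ∀ (Q : TentDG.Setting N L) (φb φt : TentDG.E N → ℝ),
      Q.mesh.ShapeRegular σ → Q.vtx ∈ Q.mesh.complex.vertices →
      Q.IsHyperbolic γ Λ c → Q.IsDesign Cd → Q.IsCausalTent chat φb φt →
      Q.kappa 0 φb φt ≤ (C : ℝ≥0∞) ∧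
      (∀ τ : ℝ, 0 ≤ τ → τ ≤ 1 → ENNReal.ofReal τ ≤ 1 / Q.kappa 0 φb φt →
        ∀ w : Q.Vh 0, TentDG.Setting.normM φb φt τ (Q.Rsat 0 φb φt 1 τ w)
          ≤ TentDG.Setting.normM φb φt 0 w) ∧
      (∀ r : ℕ, 0 < r → Q.kappa 0 φb φt ≤ (r : ℝ≥0∞) →
        (∀ w : Q.Vh 0, TentDG.Setting.normM φb φt 1 (Q.Rsub 0 φb φt r 1 w)
          ≤ TentDG.Setting.normM φb φt 0 w) ∧
        Q.SATStable 0 φb φt r 1 0) := by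
  refine ⟨(TentDG.Setting.kappaConst N σ γ c chat |Cd|).toNNReal,
    fun Q φb φt hσ _ hH hD' hT => ?_⟩
  -- The sign of `Cd` is not prescribed; enlarging it to `|Cd|` only weakens the design bounds.
  have hD := hD'.abs
  have hCd := abs_nonneg Cd
  refine ⟨TentDG.Setting.kappa_le hN hγ hc hchat hCd hσ hH hD hT, ?_, ?_⟩
  · intro τ h0 h1 hτ w
    -- The product form also covers `κ = 0`, where `1 / κ = ⊤` leaves `τ` unrestricted.
    have hκ : τ * (Q.kappa 0 φb φt).toReal ≤ 1 := by
      have h2 := ENNReal.toReal_mono ENNReal.one_ne_top (ENNReal.mul_le_of_le_div hτ)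
      rwa [ENNReal.toReal_mul, ENNReal.toReal_ofReal h0, ENNReal.toReal_one] at h2
    have hu : IsUnit (Q.M0 0 φb) := by
      have := TentDG.Setting.isUnit_M hH hγ hc hchat hT (τ := 0) ⟨le_rfl, zero_le_one⟩
      rwa [TentDG.Setting.M_zero] at this
    have h := TentDG.Setting.substep_le hN hγ hc hchat hCd hσ hH hD hT (t := 0) h0
      (by rw [zero_add]; exact ⟨h0, h1⟩) hκ w
    rw [zero_add] at h
    rw [TentDG.Setting.normM, TentDG.Setting.normM, TentDG.Setting.ip_eq, TentDG.Setting.ip_eq,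
      TentDG.Setting.Rsat_one_apply _ _ hu]
    exact Real.sqrt_le_sqrt h
  · intro r hr hκr
    have hr0 : (0 : ℝ) < r := by exact_mod_cast hr
    have hκ : (1 / (r : ℝ)) * (Q.kappa 0 φb φt).toReal ≤ 1 := by
      have h2 := ENNReal.toReal_mono (ENNReal.natCast_ne_top r) hκr
      rw [ENNReal.toReal_natCast] at h2
      rw [one_div, inv_mul_le_iff₀ hr0]
      linarith
    have hmain : ∀ w : Q.Vh 0, TentDG.Setting.normM φb φt 1 (Q.Rsub 0 φb φt r 1 w)
        ≤ TentDG.Setting.normM φb φt 0 w := by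
      intro w
      have h := TentDG.Setting.RsubUpTo_le hN hγ hc hchat hCd hσ hH hD hT hr hκ w r le_rfl
      rw [div_self hr0.ne'] at h
      rw [TentDG.Setting.normM, TentDG.Setting.normM, TentDG.Setting.ip_eq, TentDG.Setting.ip_eq]
      exact Real.sqrt_le_sqrt h
    refine ⟨hmain, fun w => ?_⟩
    rw [zero_mul, add_zero, one_mul]
    exact hmain w
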